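/- Let $S$ be a quasi-separated scheme. All group schemes below are finite, flat and finitely presented over $S$. For such a group scheme $\pi\colon G\to S$, let $\operatorname{QCoh}^{G}(S)$ be the category of $G$-equivariant quasi-coherent sheaves on $S$: quasi-coherent $\mathcal{O}_S$-modules $F$ with an isomorphism $\phi\colon \pi^{*}F\simeq\pi^{*}F$ of $\mathcal{O}_G$-modules satisfying the cocycle condition $m^{*}\phi=\mathrm{pr}_1^{*}\phi\circ\mathrm{pr}_2^{*}\phi$ on $G\times_S G$, where $m$ is the multiplication. The invariant subsheaf $F^{G}\subseteq F$ is the kernel of $\alpha-\iota\colon F\to\pi_{*}\pi^{*}F=F\otimes_{\mathcal{O}_S}\pi_{*}\mathcal{O}_G$, where $\alpha$ is the coaction corresponding to $\phi$ by adjunction and $\iota(s)=s\otimes 1$. The group scheme $G$ is called linearly reductive if the functor $\operatorname{QCoh}^{G}(S)\to\operatorname{QCoh}(S)$, $F\mapsto F^{G}$, is exact. The class of linearly reductive group schemes over $S$ is closed under taking subgroup schemes, quotients, and extensions: (a) if $H\hookrightarrow G$ is a subgroup scheme (a homomorphism of group schemes that is a monomorphism) and $G$ is linearly reductive, then $H$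 is linearly reductive; (b) if $p\colon G\to Q$ is a faithfully flat homomorphism of group schemes, so that $Q$ is the quotient of $G$ by $\ker p$, and $G$ is linearly reductive, then $Q$ is linearly reductive; (c) if $1\to N\to G\to Q\to 1$ is an exact sequence of group schemes (that is, $G\to Q$ is a faithfully flat homomorphism with kernel $N$), and $N$ and $Q$ are linearly reductive, then $G$ is linearly reductive. -/

import Mathlib

universe u

open CategoryTheory Limits AlgebraicGeometry MonoidalCategory CartesianMonoidalCategory MonObj

noncomputable section

namespace LinRed

variable {S : Scheme.{u}}

/-- The standing assumption on group schemes: the structure morphism `G ⟶ S` is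
finite, flat and finitely presented (finite morphisms being affine, "finitely presented" and
"locally of finite presentation" agree here). -/
class IsFiniteFlat (G : Over S) : Prop where
  isFinite : IsFinite G.hom
  flat : Flat G.hom
  locallyOfFinitePresentation : LocallyOfFinitePresentation G.hom

/-- Given an automorphism `φ` of `π^* F` on `G`, where `π : G ⟶ S` is the structure morphism,
and a `T`-valued point `g : T ⟶ G` over `S`, the automorphism `g^* φ` of `f^* F`, where
`f : T ⟶ S` is the structure morphism; here `g^* (π^* F)` is identified with `f^* F`
through the canonical isomorphism. -/
def pullbackAct {G : Over S} {F : S.Modules}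
    (φ : (Scheme.Modules.pullback G.hom).obj F ≅ (Scheme.Modules.pullback G.hom).obj F)
    {T : Over S} (g : T ⟶ G) :
    (Scheme.Modules.pullback T.hom).obj F ≅ (Scheme.Modules.pullback T.hom).obj F :=
  let e : (Scheme.Modules.pullback g.left).obj ((Scheme.Modules.pullback G.hom).obj F) ≅
      (Scheme.Modules.pullback T.hom).obj F :=
    (Scheme.Modules.pullbackComp g.left G.hom).app F ≪≫
      (Scheme.Modules.pullbackCongr (Over.w g)).app F
  e.symm ≪≫ (Scheme.Modules.pullback g.left).mapIso φ ≪≫ e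

/-- A `G`-equivariant quasi-coherent sheaf on `S`: a quasi-coherent sheaf `F` with an isomorphism
`φ : π^* F ≅ π^* F` of `𝒪_G`-modules satisfying the cocycle condition
`m^* φ = pr₁^* φ ∘ pr₂^* φ` on `G ×_S G`. -/
structure QCohEquiv (G : Over S) [GrpObj G] where
  sheaf : S.Modules
  isQuasicoherent : sheaf.IsQuasicoherent
  act : (Scheme.Modules.pullback G.hom).obj sheaf ≅ (Scheme.Modules.pullback G.hom).obj sheaf
  act_mul : pullbackAct act μ[G] = pullbackAct act (snd G G) ≪≫ pullbackAct act (fst G G)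

namespace QCohEquiv

variable {G : Over S} [GrpObj G]

/-- Equivariant homomorphisms. -/
@[ext]
structure Hom (F F' : QCohEquiv G) where
  hom : F.sheaf ⟶ F'.sheaf
  comm : (Scheme.Modules.pullback G.hom).map hom ≫ F'.act.hom =
    F.act.hom ≫ (Scheme.Modules.pullback G.hom).map hom

/-- The category `QCoh^G(S)`. -/
instance : Category (QCohEquiv G) where
  Hom F F' := Hom F F'
  id F := ⟨𝟙 F.sheaf, by simp⟩
  comp f g := ⟨f.hom ≫ g.hom, by
    rw [Functor.map_comp, Category.assoc, g.comm, ← Category.assoc, f.comm, Category.assoc]⟩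
  id_comp f := Hom.ext (Category.id_comp f.hom)
  comp_id f := Hom.ext (Category.comp_id f.hom)
  assoc f g h := Hom.ext (Category.assoc f.hom g.hom h.hom)

instance : HasZeroMorphisms (QCohEquiv G) where
  zero F F' := ⟨⟨0, by
    rw [(Scheme.Modules.pullback G.hom).map_zero, zero_comp, comp_zero]⟩⟩
  comp_zero f _ := Hom.ext (comp_zero (f := f.hom))
  zero_comp _ _ _ f := Hom.ext (zero_comp (f := f.hom))

/-- The functor that forgets the action. -/
def forget (G : Over S) [GrpObj G] : QCohEquiv G ⥤ S.Modules where
  obj F := F.sheaf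
  map f := f.hom
  map_id _ := rfl
  map_comp _ _ := rfl

instance : (forget G).PreservesZeroMorphisms where
  map_zero _ _ := rfl

/-- The trivial coaction `ι : F ⟶ π_* π^* F = F ⊗ π_* 𝒪_G`, `s ↦ s ⊗ 1`. -/
def trivialCoaction (F : QCohEquiv G) : F.sheaf ⟶
    (Scheme.Modules.pushforward G.hom).obj ((Scheme.Modules.pullback G.hom).obj F.sheaf) :=
  (Scheme.Modules.pullbackPushforwardAdjunction G.hom).unit.app F.sheaf

/-- The coaction `α : F ⟶ π_* π^* F = F ⊗ π_* 𝒪_G` that corresponds to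
`φ : π^* F ⟶ π^* F` by adjunction. -/
def coaction (F : QCohEquiv G) : F.sheaf ⟶
    (Scheme.Modules.pushforward G.hom).obj ((Scheme.Modules.pullback G.hom).obj F.sheaf) :=
  F.trivialCoaction ≫ (Scheme.Modules.pushforward G.hom).map F.act.hom

theorem hom_coaction_sub {F F' : QCohEquiv G} (f : F ⟶ F') :
    (F.coaction - F.trivialCoaction) ≫ (Scheme.Modules.pushforward G.hom).map
      ((Scheme.Modules.pullback G.hom).map f.hom) =
    f.hom ≫ (F'.coaction - F'.trivialCoaction) := by
  have h : f.hom ≫ F'.trivialCoaction = F.trivialCoaction ≫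
      (Scheme.Modules.pushforward G.hom).map ((Scheme.Modules.pullback G.hom).map f.hom) :=
    (Scheme.Modules.pullbackPushforwardAdjunction G.hom).unit.naturality f.hom
  rw [Preadditive.sub_comp, Preadditive.comp_sub, h, coaction, coaction, ← Category.assoc f.hom, h,
    Category.assoc, Category.assoc, ← Functor.map_comp, ← Functor.map_comp, f.comm]

/-- The functor of invariants `F ↦ F^G`, the invariant subsheaf `F^G` being the kernel
of `α - ι`. -/
def invariants (G : Over S) [GrpObj G] : QCohEquiv G ⥤ S.Modules where
  obj F := kernel (F.coaction - F.trivialCoaction)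
  map f := kernel.map _ _ f.hom _ (hom_coaction_sub f)
  map_id F := by
    rw [← cancel_mono (kernel.ι _), kernel.lift_ι, Category.id_comp]
    exact Category.comp_id _
  map_comp f g := by
    rw [← cancel_mono (kernel.ι _), kernel.lift_ι, Category.assoc, kernel.lift_ι, ← Category.assoc,
      kernel.lift_ι, Category.assoc]
    rfl

instance : (invariants G).PreservesZeroMorphisms where
  map_zero F F' := by
    refine (cancel_mono (kernel.ι (F'.coaction - F'.trivialCoaction))).1 ?_
    exact (kernel.lift_ι _ _ _).trans (comp_zero.trans zero_comp.symm)

end QCohEquiv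

/-- `G` is linearly reductive if `F ↦ F^G` is exact on `QCoh^G(S)`, that is, takes short exact
sequences to short exact sequences. Exactness in `QCoh^G(S)` is exactness of the underlying
sequence of sheaves; quasi-coherent sheaves are closed under kernels and cokernels in the category
of all `𝒪_S`-modules, so it can be tested there. -/
def IsLinearlyReductive (G : Over S) [GrpObj G] : Prop :=
  ∀ C : ShortComplex (QCohEquiv G),
    (C.map (QCohEquiv.forget G)).ShortExact → (C.map (QCohEquiv.invariants G)).ShortExact

/-- `p : G ⟶ Q` exhibits `Q` as a quotient group scheme of `G` (by the kernel of `p`):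
`p` is a faithfully flat homomorphism. -/
structure IsQuotient {G Q : Over S} [GrpObj G] [GrpObj Q] (p : G ⟶ Q) : Prop where
  isMonHom : IsMonHom p
  flat : Flat p.left
  surjective : Surjective p.left

/-- `1 ⟶ N ⟶ G ⟶ Q ⟶ 1` is exact, so that `G` is an extension of `Q` by `N`: `p` is a quotient
homomorphism, and `i` is a homomorphism that identifies `N` with the kernel of `p`. -/
structure IsExtension {N G Q : Over S} [GrpObj N] [GrpObj G] [GrpObj Q]
    (i : N ⟶ G) (p : G ⟶ Q) : Prop where
  isMonHom : IsMonHom i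
  isKernel : IsPullback i (toUnit N) p η[Q]
  isQuotient : IsQuotient p

end LinRed

end

/-! Representations are traded for invariant integrals. Over an affine open `U` of `S`, a left
integral on `G` is an `𝒪(U)`-linear functional `l` on the functions on `G` with `∫ d(gh) dh = ∫ d(h)
dh`; its mass is `l 1`. The group `G` is linearly reductive if and only if for every affine open `U`
and every `x ∈ U` some left integral over `U` has a mass that does not vanish at `x`
(`HasLeftIntegral`).

Sufficiency (`isLinearlyReductive_of_hasLeftIntegral`): integrating the coaction against `l` turns
every section into an invariant one and multiplies invariant sections by `l 1`. Dividing by `l 1`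
near `x` lifts invariants along equivariant epimorphisms. Left exactness follows from flatness of
`G`.

Necessity (`IsLinearlyReductive.hasLeftIntegral`): a finite locally free group scheme always has a
left integral `l` and a function `y` with `l y` nonzero at `x` (`exists_isLeftIntegral`). For any
functional `l₀`, the functional `d ↦ Tr (y ↦ (g ↦ ∫ d(gh) y(gh) dl₀(h)))` is left invariant, because
convolution on the right commutes with left translation and a trace is unchanged by conjugation;
suitable values of such functionals add up to the trace of `y ↦ y(1) · 1`, which is `1`. Let `Y` be
the spectrum of the residue field of `x`. Integration against `l` is an equivariant epimorphism from
the functions on `G × Y`, with left translation, to the functions on `Y`, with trivial action. By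
exactness `1` lifts, near `x`, to an invariant function; this is constant along `G`, so its integral
is a multiple of `l 1`, and `l 1` is nonzero at `x`.

The closure properties become statements about integrals. For a quotient, push the integral forward.
For an extension, average over `N`, descend the result to `Q`, and integrate over `Q`; the masses
multiply. For a subgroup `H` of `G`, take a left integral `k` on `H` with `k y` nonzero at `x`.
Averaging over `H` is linear over the ring `B` of functions on `G` invariant under right translation
by `H`, so the averages form an ideal `J` of `B`. One finds `k y ∈ J 𝒪(G)`, and since `𝒪(G)` is
integral over `B`, a power `(k y) ^ n` is the average of some `a`. A right invariant integral on
`G`, obtained from `l` by inversion, then gives `(k y) ^ n * l 1 = l (a ∘ inv) * k 1`, so `k 1`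
cannot vanish at `x`. -/

noncomputable section

namespace LinRed

open TopologicalSpace Opposite TensorProduct
open Scheme (Modules)

/-! ### Sections of pulled back sheaves of modules -/

section PullbackSections

variable {X Y Z : Scheme.{u}}

/-- The pullback of a section of a sheaf of modules along a morphism. -/
def pb (f : X ⟶ Y) (F : Y.Modules) (V : Y.Opens) :
    Γ(F, V) ⟶ Γ((Scheme.Modules.pullback f).obj F, f ⁻¹ᵁ V) :=
  Scheme.Modules.Hom.app ((Scheme.Modules.pullbackPushforwardAdjunction f).unit.app F) V

theorem pb_smul (f : X ⟶ Y) (F : Y.Modules) (V : Y.Opens) (r : Γ(Y, V)) (m : Γ(F, V)) :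
    pb f F V (r • m) = f.app V r • pb f F V m :=
  Scheme.Modules.Hom.app_smul ((Scheme.Modules.pullbackPushforwardAdjunction f).unit.app F) r m

theorem app_presheaf_map {F F' : X.Modules} (h : F ⟶ F') {U V : X.Opens} (i : U ⟶ V)
    (m : Γ(F, V)) : h.app U (F.presheaf.map i.op m) = F'.presheaf.map i.op (h.app V m) :=
  congr($(h.mapPresheaf.naturality i.op) m)

theorem pb_map (f : X ⟶ Y) (F : Y.Modules) {U V : Y.Opens} (i : U ⟶ V) (m : Γ(F, V)) :
    pb f F U (F.presheaf.map i.op m) =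
      ((Scheme.Modules.pullback f).obj F).presheaf.map ((Opens.map f.base).map i).op (pb f F V m) :=
  app_presheaf_map ((Scheme.Modules.pullbackPushforwardAdjunction f).unit.app F) i m

theorem map_app_pb (f : X ⟶ Y) {F F' : Y.Modules} (h : F ⟶ F') (V : Y.Opens) (m : Γ(F, V)) :
    ((Scheme.Modules.pullback f).map h).app (f ⁻¹ᵁ V) (pb f F V m) = pb f F' V (h.app V m) :=
  congr(($((Scheme.Modules.pullbackPushforwardAdjunction f).unit.naturality h)).app V m).symm

theorem hom_ext_of_isBasis {F N : Y.Modules} {φ ψ : F ⟶ N} {B : Set Y.Opens}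
    (hB : Opens.IsBasis B) (H : ∀ V ∈ B, ∀ m : Γ(F, V), φ.app V m = ψ.app V m) : φ = ψ := by
  ext V m
  apply TopCat.Presheaf.IsSheaf.section_ext N.isSheaf
  intro x hx
  obtain ⟨W, hW, hxW, hWV⟩ := Opens.isBasis_iff_nbhd.mp hB hx
  refine ⟨W, hWV, hxW, ?_⟩
  have := H W hW (F.presheaf.map (homOfLE hWV).op m)
  rw [app_presheaf_map, app_presheaf_map] at this
  exact this

/-- By adjunction a morphism out of `f^* F` is a morphism out of `F`, hence is known from its values
on pulled back sections. -/
theorem pullback_hom_ext (f : X ⟶ Y) {F : Y.Modules} {N : X.Modules}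
    {φ ψ : (Scheme.Modules.pullback f).obj F ⟶ N} {B : Set Y.Opens} (hB : Opens.IsBasis B)
    (H : ∀ V ∈ B, ∀ m : Γ(F, V),
      φ.app (f ⁻¹ᵁ V) (pb f F V m) = ψ.app (f ⁻¹ᵁ V) (pb f F V m)) : φ = ψ := by
  apply ((Scheme.Modules.pullbackPushforwardAdjunction f).homEquiv F N).injective
  rw [Adjunction.homEquiv_unit, Adjunction.homEquiv_unit]
  exact hom_ext_of_isBasis hB H

/-- `pullbackComp` is conjugate, under the pullback-pushforward adjunctions, to the comparison of
pushforwards, which is the identity on sections. The unit formula for conjugates turns this into a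
formula for sections. -/
theorem pb_comp (g : X ⟶ Y) (f : Y ⟶ Z) (F : Z.Modules) (V : Z.Opens) (m : Γ(F, V)) :
    ((Scheme.Modules.pullbackComp g f).hom.app F).app (g ⁻¹ᵁ f ⁻¹ᵁ V)
      (pb g ((Scheme.Modules.pullback f).obj F) (f ⁻¹ᵁ V) (pb f F V m)) = pb (g ≫ f) F V m := by
  have h := unit_conjugateEquiv
    ((Scheme.Modules.pullbackPushforwardAdjunction f).comp (Scheme.Modules.pullbackPushforwardAdjunction g))
      (Scheme.Modules.pullbackPushforwardAdjunction (g ≫ f)) (Scheme.Modules.pullbackComp g f).inv F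
  rw [Scheme.Modules.conjugateEquiv_pullbackComp_inv] at h
  have h2 := congr(((Scheme.Modules.pullbackComp g f).hom.app F).app (g ⁻¹ᵁ f ⁻¹ᵁ V)
    (($h).app V m))
  have h3 := congr(($((Scheme.Modules.pullbackComp g f).inv_hom_id_app F)).app (g ⁻¹ᵁ f ⁻¹ᵁ V)
    (pb (g ≫ f) F V m))
  exact h2.trans h3

end PullbackSections

/-! ### Base change of modules along a ring homomorphism -/

section SemilinearBaseChange

variable {R A M N N' M' : Type*} [CommRing R] [CommRing A] [AddCommGroup M] [Module R M]
  [AddCommGroup M'] [Module R M'] [AddCommGroup N] [Module A N] [AddCommGroup N'] [Module A N']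

/-- The map `u` exhibits the `A`-module `N` as the base change of the `R`-module `M`
along `σ : R →+* A`. -/
structure IsSBC (σ : R →+* A) (u : M →+ N) : Prop where
  exists_equiv : letI := σ.toAlgebra; ∃ e : A ⊗[R] M ≃ₗ[A] N, ∀ m, e (1 ⊗ₜ m) = u m

theorem tensor_hom_ext [Algebra R A] {f g : A ⊗[R] M →ₗ[A] N}
    (H : ∀ m, f (1 ⊗ₜ m) = g (1 ⊗ₜ m)) : f = g := by
  ext x
  induction x with
  | zero => simp
  | add x y hx hy => rw [map_add, map_add, hx, hy]
  | tmul a m =>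
    have : a ⊗ₜ[R] m = a • (1 ⊗ₜ[R] m : A ⊗[R] M) := by
      rw [smul_tmul', smul_eq_mul, _root_.mul_one]
    rw [this, map_smul, map_smul, H]

theorem IsSBC.exists_linearEquiv [Algebra R A] {u : M →+ N} (h : IsSBC (algebraMap R A) u) :
    ∃ e : A ⊗[R] M ≃ₗ[A] N, ∀ a m, e (a ⊗ₜ m) = a • u m := by
  have h' := h.exists_equiv
  have : (algebraMap R A).toAlgebra = ‹Algebra R A› := Algebra.algebra_ext _ _ fun _ => rfl
  rw [this] at h'
  obtain ⟨e, he⟩ := h'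
  refine ⟨e, fun a m => ?_⟩
  rw [← he, ← map_smul, smul_tmul', smul_eq_mul, _root_.mul_one]

theorem IsSBC.of_linearEquiv [Algebra R A] {u : M →+ N} (e : A ⊗[R] M ≃ₗ[A] N)
    (he : ∀ m, e (1 ⊗ₜ m) = u m) : IsSBC (algebraMap R A) u := by
  have : (algebraMap R A).toAlgebra = ‹Algebra R A› := Algebra.algebra_ext _ _ fun _ => rfl
  refine ⟨?_⟩
  rw [this]
  exact ⟨e, he⟩

theorem IsSBC.smul {σ : R →+* A} {u : M →+ N} (h : IsSBC σ u) (r : R) (m : M) :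
    u (r • m) = σ r • u m := by
  letI := σ.toAlgebra
  obtain ⟨e, he⟩ := IsSBC.exists_linearEquiv (R := R) (A := A) h
  have h1 := he 1 (r • m)
  rw [one_smul] at h1
  rw [← h1, tmul_smul, ← algebraMap_smul A r, map_smul, he, one_smul]
  rfl

theorem IsSBC.hom_ext {σ : R →+* A} {u : M →+ N} (h : IsSBC σ u) {f g : N →ₗ[A] N'}
    (H : ∀ m, f (u m) = g (u m)) : f = g := by
  letI := σ.toAlgebra
  obtain ⟨e, he⟩ := IsSBC.exists_linearEquiv (R := R) (A := A) h
  have : f ∘ₗ e.toLinearMap = g ∘ₗ e.toLinearMap := by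
    refine tensor_hom_ext fun m => ?_
    simp [he, H]
  ext n
  simpa using congr($this (e.symm n))

/-- The linear extension of a semilinear map. -/
theorem IsSBC.exists_lift {σ : R →+* A} {u : M →+ N} (h : IsSBC σ u) (v : M →+ N')
    (hv : ∀ r m, v (r • m) = σ r • v m) : ∃ f : N →ₗ[A] N', ∀ m, f (u m) = v m := by
  letI := σ.toAlgebra
  obtain ⟨e, he⟩ := IsSBC.exists_linearEquiv (R := R) (A := A) h
  letI : Module R N' := Module.compHom N' σ
  haveI : IsScalarTower R A N' := ⟨fun r a n => by
    change (σ r * a) • n = σ r • a • n; rw [mul_smul]⟩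
  let v' : M →ₗ[R] N' := { v with map_smul' := hv }
  refine ⟨(v'.liftBaseChange A) ∘ₗ e.symm.toLinearMap, fun m => ?_⟩
  have : u m = e (1 ⊗ₜ m) := by rw [he, one_smul]
  simp [this, v']

theorem IsSBC.comp_equiv {σ : R →+* A} {u : M →+ N} (h : IsSBC σ u) (e : N ≃ₗ[A] N') {v : M →+ N'}
    (hv : ∀ m, v m = e (u m)) : IsSBC σ v := by
  letI := σ.toAlgebra
  obtain ⟨e', he'⟩ := IsSBC.exists_linearEquiv (R := R) (A := A) h
  exact IsSBC.of_linearEquiv (e'.trans e) fun m => by simp [he', hv]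

theorem IsSBC.equiv_comp {σ : R →+* A} {u : M →+ N} (h : IsSBC σ u) (e : M' ≃ₗ[R] M) {v : M' →+ N}
    (hv : ∀ m, v m = u (e m)) : IsSBC σ v := by
  letI := σ.toAlgebra
  obtain ⟨e', he'⟩ := IsSBC.exists_linearEquiv (R := R) (A := A) h
  exact IsSBC.of_linearEquiv ((e.baseChange R A).trans e') fun m => by simp [he', hv]

theorem IsSBC.bijective_of_comp {σ : R →+* A} {u : M →+ N} (h : IsSBC σ u) {v : M →+ N'}
    (h' : IsSBC σ v) {f : N →ₗ[A] N'} (hf : ∀ m, f (u m) = v m) : Function.Bijective f := by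
  obtain ⟨g, hg⟩ := h'.exists_lift u h.smul
  have h1 : g ∘ₗ f = LinearMap.id := h.hom_ext fun m => by simp [hf, hg]
  have h2 : f ∘ₗ g = LinearMap.id := h'.hom_ext fun m => by simp [hf, hg]
  exact ⟨Function.LeftInverse.injective fun x => congr($h1 x),
    Function.RightInverse.surjective fun x => congr($h2 x)⟩

theorem IsSBC.injective_of_flat {σ : R →+* A} (hσ : σ.Flat) {u : M →+ N} (h : IsSBC σ u)
    {v : M' →+ N'} (h' : IsSBC σ v) (f : M →ₗ[R] M') (hf : Function.Injective f) {g : N →ₗ[A] N'}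
    (hg : ∀ m, g (u m) = v (f m)) : Function.Injective g := by
  letI := σ.toAlgebra
  obtain ⟨e, he⟩ := IsSBC.exists_linearEquiv (R := R) (A := A) h
  obtain ⟨e', he'⟩ := IsSBC.exists_linearEquiv (R := R) (A := A) h'
  haveI : Module.Flat R A := hσ
  have h1 : g ∘ₗ e.toLinearMap = e'.toLinearMap ∘ₗ f.baseChange A := by
    refine tensor_hom_ext fun m => ?_
    simp [he, he', hg]
  have h2 : Function.Injective (f.baseChange A) := by
    rw [← LinearMap.coe_restrictScalars R]
    exact Module.Flat.lTensor_preserves_injective_linearMap f hf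
  have h3 : Function.Injective (g ∘ₗ e.toLinearMap) := by
    rw [h1]; exact e'.injective.comp h2
  intro x y hxy
  have := @h3 (e.symm x) (e.symm y) (by simpa using hxy)
  simpa using this

/-- Flat base change of kernels. -/
theorem IsSBC.exact_of_flat {σ : R →+* A} (hσ : σ.Flat) {M'' N'' : Type*} [AddCommGroup M'']
    [Module R M''] [AddCommGroup N''] [Module A N''] {u : M →+ N} (h : IsSBC σ u)
    {v : M' →+ N'} (h' : IsSBC σ v) {w : M'' →+ N''} (h'' : IsSBC σ w) (f : M →ₗ[R] M')
    (f' : M' →ₗ[R] M'') (hf : Function.Exact f f') {g : N →ₗ[A] N'} {g' : N' →ₗ[A] N''}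
    (hg : ∀ m, g (u m) = v (f m)) (hg' : ∀ m, g' (v m) = w (f' m)) : Function.Exact g g' := by
  letI := σ.toAlgebra
  obtain ⟨e, he⟩ := IsSBC.exists_linearEquiv (R := R) (A := A) h
  obtain ⟨e', he'⟩ := IsSBC.exists_linearEquiv (R := R) (A := A) h'
  obtain ⟨e'', he''⟩ := IsSBC.exists_linearEquiv (R := R) (A := A) h''
  haveI : Module.Flat R A := hσ
  have h1 : g ∘ₗ e.toLinearMap = e'.toLinearMap ∘ₗ f.baseChange A := by
    refine tensor_hom_ext fun m => ?_
    simp [he, he', hg]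
  have h2 : g' ∘ₗ e'.toLinearMap = e''.toLinearMap ∘ₗ f'.baseChange A := by
    refine tensor_hom_ext fun m => ?_
    simp [he', he'', hg']
  have h3 : Function.Exact (f.baseChange A) (f'.baseChange A) := by
    rw [← LinearMap.coe_restrictScalars R, ← LinearMap.coe_restrictScalars R]
    exact Module.Flat.lTensor_exact A hf
  intro y
  have hy : g' y = e'' (f'.baseChange A (e'.symm y)) := by simpa using congr($h2 (e'.symm y))
  rw [hy, LinearEquiv.map_eq_zero_iff, h3]
  constructor
  · rintro ⟨z, hz⟩
    exact ⟨e z, (congr($h1 z)).trans (by simp [hz])⟩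
  · rintro ⟨z, rfl⟩
    exact ⟨e.symm z, e'.injective (by simpa using (congr($h1 (e.symm z))).symm)⟩

end SemilinearBaseChange

/-! ### Pulled back sections on smaller opens -/

section

variable {X Y Z : Scheme.{u}}

/-- The pullback of a section of a sheaf of modules, restricted to a smaller open. -/
def pbLE (f : X ⟶ Y) (F : Y.Modules) (V : Y.Opens) (U : X.Opens) (h : U ≤ f ⁻¹ᵁ V) :
    Γ(F, V) ⟶ Γ((Scheme.Modules.pullback f).obj F, U) :=
  pb f F V ≫ ((Scheme.Modules.pullback f).obj F).presheaf.map (homOfLE h).op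

theorem pbLE_apply (f : X ⟶ Y) (F : Y.Modules) (V : Y.Opens) (U : X.Opens) (h : U ≤ f ⁻¹ᵁ V)
    (m : Γ(F, V)) : pbLE f F V U h m =
      ((Scheme.Modules.pullback f).obj F).presheaf.map (homOfLE h).op (pb f F V m) := rfl

theorem pbLE_preimage (f : X ⟶ Y) (F : Y.Modules) (V : Y.Opens) (m : Γ(F, V)) :
    pbLE f F V (f ⁻¹ᵁ V) le_rfl m = pb f F V m :=
  congr($(((Scheme.Modules.pullback f).obj F).presheaf.map_id (op (f ⁻¹ᵁ V))) (pb f F V m))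

theorem map_pbLE (f : X ⟶ Y) (F : Y.Modules) (V : Y.Opens) {U U' : X.Opens} (h : U ≤ f ⁻¹ᵁ V)
    (i : U' ⟶ U) (m : Γ(F, V)) :
    ((Scheme.Modules.pullback f).obj F).presheaf.map i.op (pbLE f F V U h m) =
      pbLE f F V U' (i.le.trans h) m := by
  rw [pbLE_apply, pbLE_apply, ← Functor.map_comp_apply, ← op_comp]
  rfl

theorem pbLE_map (f : X ⟶ Y) (F : Y.Modules) {V V' : Y.Opens} (i : V' ⟶ V) {U : X.Opens}
    (h : U ≤ f ⁻¹ᵁ V') (m : Γ(F, V)) :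
    pbLE f F V' U h (F.presheaf.map i.op m) =
      pbLE f F V U (h.trans ((Opens.map f.base).map i).le) m := by
  rw [pbLE_apply, pbLE_apply, pb_map, ← Functor.map_comp_apply, ← op_comp]
  rfl

theorem pbLE_smul (f : X ⟶ Y) (F : Y.Modules) (V : Y.Opens) (U : X.Opens) (h : U ≤ f ⁻¹ᵁ V)
    (r : Γ(Y, V)) (m : Γ(F, V)) :
    pbLE f F V U h (r • m) = f.appLE V U h r • pbLE f F V U h m := by
  rw [pbLE_apply, pb_smul, Scheme.Modules.map_smul]
  rfl

theorem map_app_pbLE (f : X ⟶ Y) {F F' : Y.Modules} (φ : F ⟶ F') (V : Y.Opens) (U : X.Opens)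
    (h : U ≤ f ⁻¹ᵁ V) (m : Γ(F, V)) :
    ((Scheme.Modules.pullback f).map φ).app U (pbLE f F V U h m) =
      pbLE f F' V U h (φ.app V m) := by
  rw [pbLE_apply, app_presheaf_map, map_app_pb, pbLE_apply]

theorem pbLE_comp (g : X ⟶ Y) (f : Y ⟶ Z) (F : Z.Modules) (V : Z.Opens) (U : Y.Opens)
    (W : X.Opens) (h : U ≤ f ⁻¹ᵁ V) (h' : W ≤ g ⁻¹ᵁ U) (m : Γ(F, V)) :
    ((Scheme.Modules.pullbackComp g f).hom.app F).app W
      (pbLE g ((Scheme.Modules.pullback f).obj F) U W h' (pbLE f F V U h m)) =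
      pbLE (g ≫ f) F V W (h'.trans (g.preimage_mono h)) m := by
  rw [pbLE_apply f, pbLE_map, pbLE_apply g]
  refine (app_presheaf_map _ _ _).trans ?_
  exact congr(((Scheme.Modules.pullback (g ≫ f)).obj F).presheaf.map (homOfLE _).op
    $(pb_comp g f F V m))

theorem pbLE_congr {f g : X ⟶ Y} (e : f = g) (F : Y.Modules) (V : Y.Opens) (U : X.Opens)
    (h : U ≤ f ⁻¹ᵁ V) (m : Γ(F, V)) :
    ((Scheme.Modules.pullbackCongr e).hom.app F).app U (pbLE f F V U h m) =
      pbLE g F V U (e ▸ h) m := by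
  subst e
  simp [Scheme.Modules.pullbackCongr]

/-- For an open immersion, restriction and pullback are both left adjoint to pushforward, and the
isomorphism between them matches the units. -/
theorem pb_restrictFunctorIsoPullback (f : X ⟶ Y) [IsOpenImmersion f] (F : Y.Modules)
    (V : Y.Opens) (m : Γ(F, V)) :
    ((Scheme.Modules.restrictFunctorIsoPullback f).hom.app F).app (f ⁻¹ᵁ V)
      ((F.restrictAppIso f _).inv (F.presheaf.map (homOfLE (f.image_preimage_le V)).op m)) =
      pb f F V m := by
  have h := (Scheme.Modules.restrictAdjunction f).unit_leftAdjointUniq_hom_app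
    (Scheme.Modules.pullbackPushforwardAdjunction f) F
  exact congr(($h).app V m)

end

/-! ### Pullback between spectra is extension of scalars -/

section Spec

variable {R A : CommRingCat.{u}} (φ : R ⟶ A)

/-- Global sections of a pushforward along `Spec A ⟶ Spec R` are the restriction of scalars of
global sections. -/
def pushforwardΓIso : Scheme.Modules.pushforward (Spec.map φ) ⋙ moduleSpecΓFunctor (R := R) ≅
    moduleSpecΓFunctor (R := A) ⋙ ModuleCat.restrictScalars φ.hom :=
  Functor.isoWhiskerRight (pushforwardCompModulesSpecToSheafIso φ)
    (TopCat.Sheaf.forget _ _ ⋙ (evaluation _ _).obj (.op ⊤))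

/-- Pullback along `Spec A ⟶ Spec R` is extension of scalars on sheaves attached to modules. -/
def tildePullbackIso : ModuleCat.extendScalars φ.hom ⋙ tilde.functor A ≅
    tilde.functor R ⋙ Scheme.Modules.pullback (Spec.map φ) :=
  ((ModuleCat.extendRestrictScalarsAdj φ.hom).comp tilde.adjunction).leftAdjointUniq
    ((tilde.adjunction.comp
      (Scheme.Modules.pullbackPushforwardAdjunction (Spec.map φ))).ofNatIsoRight
        (pushforwardΓIso φ))

/-- Both composites are left adjoint to taking global sections with scalars restricted to `R`; the
formula compares the two units. -/
theorem tildePullbackIso_app (M : ModuleCat.{u} R) (m : M) :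
    Scheme.Modules.Hom.app ((tildePullbackIso φ).hom.app M) ⊤
      (tilde.toOpen ((ModuleCat.extendScalars φ.hom).obj M) ⊤
        ((ModuleCat.extendRestrictScalarsAdj φ.hom).unit.app M m)) =
    pb (Spec.map φ) (tilde M) ⊤ (tilde.toOpen M ⊤ m) := by
  have h := Adjunction.unit_leftAdjointUniq_hom_app
    ((ModuleCat.extendRestrictScalarsAdj φ.hom).comp tilde.adjunction)
    ((tilde.adjunction.comp
      (Scheme.Modules.pullbackPushforwardAdjunction (Spec.map φ))).ofNatIsoRight
        (pushforwardΓIso φ)) M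
  have h2 := congr($h m)
  exact h2

/-- The action of `R` on sections is compatible with morphisms. -/
theorem app_smul_Spec {N N' : (Spec R).Modules} (h : N ⟶ N') (U : (Spec R).Opens) (r : R)
    (x : Γ(N, U)) : h.app U (r • x) = r • h.app U x := by
  rw [Scheme.Modules.smul_Spec_def, Scheme.Modules.smul_Spec_def, Scheme.Modules.Hom.app_smul]

/-- An isomorphism of sheaves on an affine scheme is linear on sections. -/
def appLinearEquiv {N N' : (Spec R).Modules} (h : N ≅ N') (U : (Spec R).Opens) :
    Γ(N, U) ≃ₗ[R] Γ(N', U) where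
  toFun := h.hom.app U
  invFun := h.inv.app U
  map_add' := map_add _
  map_smul' := app_smul_Spec h.hom U
  left_inv x := congr(($(h.hom_inv_id)).app U x)
  right_inv x := congr(($(h.inv_hom_id)).app U x)

/-- Global sections of the sheaf attached to a module. -/
def tildeΓEquiv (M : ModuleCat.{u} R) : M ≃ₗ[R] Γ(tilde M, ⊤) := (tilde.isoTop M).toLinearEquiv

theorem isSBC_pb_tilde (M : ModuleCat.{u} R) :
    IsSBC φ.hom (pbLE (Spec.map φ) (tilde M) ⊤ ⊤ le_top).hom := by
  letI := φ.hom.toAlgebra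
  let w : M →+ (ModuleCat.extendScalars φ.hom).obj M :=
    ((ModuleCat.extendRestrictScalarsAdj φ.hom).unit.app M).hom.toAddMonoidHom
  have h1 : IsSBC φ.hom w := ⟨LinearEquiv.refl _ _, fun m => rfl⟩
  have h2 := h1.comp_equiv (tildeΓEquiv (R := A) ((ModuleCat.extendScalars φ.hom).obj M))
    (v := (tildeΓEquiv (R := A) ((ModuleCat.extendScalars φ.hom).obj M) : _ →+ _).comp w)
    fun m => rfl
  have h3 := h2.comp_equiv (appLinearEquiv ((tildePullbackIso φ).app M) ⊤)
      (v := (pbLE (Spec.map φ) (tilde M) ⊤ ⊤ le_top).hom.comp (tildeΓEquiv M : M →+ Γ(tilde M, ⊤)))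
      fun m => ((pbLE_preimage (Spec.map φ) (tilde M) ⊤ _).trans
        (tildePullbackIso_app φ M m).symm)
  exact h3.equiv_comp (tildeΓEquiv M).symm fun m =>
    congr(pbLE (Spec.map φ) (tilde M) ⊤ ⊤ le_top
      $(((tildeΓEquiv M).apply_symm_apply m).symm))

theorem isSBC_pb_Spec (N : (Spec R).Modules) [N.IsQuasicoherent] :
    IsSBC φ.hom (pbLE (Spec.map φ) N ⊤ ⊤ le_top).hom := by
  let e := asIso N.fromTildeΓ
  have h := isSBC_pb_tilde φ ((modulesSpecToSheaf.obj N).presheaf.obj (.op ⊤))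
  have h2 := h.comp_equiv (appLinearEquiv ((Scheme.Modules.pullback (Spec.map φ)).mapIso e) ⊤)
    (v := (pbLE (Spec.map φ) N ⊤ ⊤ le_top).hom.comp (appLinearEquiv e ⊤ : _ →+ _))
    fun m => (map_app_pbLE (Spec.map φ) e.hom ⊤ ⊤ le_top m).symm
  exact h2.equiv_comp (appLinearEquiv e ⊤).symm fun m =>
    congr(pbLE (Spec.map φ) N ⊤ ⊤ le_top $(((appLinearEquiv e ⊤).apply_symm_apply m).symm))

end Spec

/-! ### Base change for sections over affine opens -/

section

variable {X Y : Scheme.{u}}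

theorem bijective_presheaf_map (F : X.Modules) {U V : X.Opens} (h : U = V) (i : U ⟶ V) :
    Function.Bijective (F.presheaf.map i.op) := by
  subst h
  rw [Subsingleton.elim i (𝟙 _), op_id, F.presheaf.map_id]
  exact Function.bijective_id

theorem iso_hom_app_inv_app {F F' : X.Modules} (e : F ≅ F') (U : X.Opens) (x : Γ(F', U)) :
    e.hom.app U (e.inv.app U x) = x := congr(($(e.inv_hom_id)).app U x)

theorem bijective_app_of_iso {F F' : X.Modules} (e : F ≅ F') (U : X.Opens) :
    Function.Bijective (e.hom.app U) :=
  Function.bijective_iff_has_inverse.mpr ⟨e.inv.app U,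
    fun x => congr(($(e.hom_inv_id)).app U x), fun x => congr(($(e.inv_hom_id)).app U x)⟩

theorem bijective_pbLE_of_isOpenImmersion (f : X ⟶ Y) [IsOpenImmersion f] (F : Y.Modules)
    (V : Y.Opens) (U : X.Opens) (h : U = f ⁻¹ᵁ V) (hV : V ≤ f.opensRange) :
    Function.Bijective (pbLE f F V U h.le) := by
  have h1 : Function.Bijective (pb f F V) := by
    have := (bijective_app_of_iso ((Scheme.Modules.restrictFunctorIsoPullback f).app F)
      (f ⁻¹ᵁ V)).comp (bijective_presheaf_map F (by
        rw [Scheme.Hom.image_preimage_eq_opensRange_inf]; exact inf_eq_right.mpr hV)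
          (homOfLE (f.image_preimage_le V)))
    convert this using 1
    ext m
    exact (pb_restrictFunctorIsoPullback f F V m).symm
  exact (bijective_presheaf_map _ h (homOfLE h.le)).comp h1

theorem fromSpec_appLE {U : X.Opens} (hU : IsAffineOpen U) (r : Γ(X, U)) :
    hU.fromSpec.appLE U ⊤ hU.fromSpec_preimage_self.ge r =
      (Scheme.ΓSpecIso Γ(X, U)).inv r := by
  rw [Scheme.Hom.appLE, hU.fromSpec_app_self, Category.assoc, ← Functor.map_comp,
    ← op_comp, Subsingleton.elim (homOfLE _ ≫ _) (𝟙 _), op_id]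
  exact ConcreteCategory.congr_hom ((Spec Γ(X, U)).presheaf.map_id (op ⊤)) _

/-- Sections of a sheaf on an affine open, as global sections on its spectrum. -/
def fromSpecΓEquiv (F : X.Modules) {U : X.Opens} (hU : IsAffineOpen U) :
    Γ(F, U) ≃ₗ[Γ(X, U)] Γ((Scheme.Modules.pullback hU.fromSpec).obj F, ⊤) :=
  LinearEquiv.ofBijective
    { toFun := pbLE hU.fromSpec F U ⊤ hU.fromSpec_preimage_self.ge
      map_add' := map_add _
      map_smul' := fun r m => by
        rw [pbLE_smul, fromSpec_appLE, Scheme.Modules.smul_Spec_def, RingHom.id_apply]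
        congr 1 }
    (bijective_pbLE_of_isOpenImmersion hU.fromSpec F U ⊤ hU.fromSpec_preimage_self.symm
      hU.opensRange_fromSpec.ge)

instance (F : X.Modules) [F.IsQuasicoherent] {U : X.Opens} (hU : IsAffineOpen U) :
    ((Scheme.Modules.pullback hU.fromSpec).obj F).IsQuasicoherent :=
  (SheafOfModules.isQuasicoherent (Spec Γ(X, U)).ringCatSheaf).prop_of_iso
    ((Scheme.Modules.restrictFunctorIsoPullback hU.fromSpec).app F)
    (Scheme.Modules.isQuasicoherent_restrictFunctor hU.fromSpec F)

theorem iso_trans_trans_symm_app {K₁ K₂ K₃ K₄ : Y.Modules ⥤ X.Modules} (a : K₁ ≅ K₂) (b : K₂ ≅ K₃)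
    (c : K₄ ≅ K₃) (F : Y.Modules) (U : X.Opens) {x₁ : Γ(K₁.obj F, U)} {x₂ : Γ(K₂.obj F, U)}
    {x₃ : Γ(K₃.obj F, U)} {x₄ : Γ(K₄.obj F, U)}
    (ha : (a.hom.app F).app U x₁ = x₂) (hb : (b.hom.app F).app U x₂ = x₃)
    (hc : (c.hom.app F).app U x₄ = x₃) :
    Scheme.Modules.Hom.app ((a ≪≫ b ≪≫ c.symm).app F).hom U x₁ = x₄ := by
  apply (bijective_app_of_iso (c.app F) U).injective
  refine Eq.trans ?_ hc.symm
  rw [← hb, ← ha]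
  exact iso_hom_app_inv_app (c.app F) U _

theorem exists_pullback_iso {P Q : Scheme.{u}} {g : P ⟶ Q} {iY : Q ⟶ Y} {iX : P ⟶ X} {f : X ⟶ Y}
    (e : g ≫ iY = iX ≫ f) (F : Y.Modules) :
    ∃ c : (Scheme.Modules.pullback g).obj ((Scheme.Modules.pullback iY).obj F) ≅
      (Scheme.Modules.pullback iX).obj ((Scheme.Modules.pullback f).obj F),
    ∀ (V : Y.Opens) (U : X.Opens) (W : Q.Opens) (W' : P.Opens) (h₁ : W ≤ iY ⁻¹ᵁ V)
      (h₂ : W' ≤ g ⁻¹ᵁ W) (h₃ : U ≤ f ⁻¹ᵁ V) (h₄ : W' ≤ iX ⁻¹ᵁ U) (m : Γ(F, V)),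
      c.hom.app W' (pbLE g _ W W' h₂ (pbLE iY F V W h₁ m)) =
        pbLE iX _ U W' h₄ (pbLE f F V U h₃ m) := by
  refine ⟨(Scheme.Modules.pullbackComp g iY ≪≫ Scheme.Modules.pullbackCongr e ≪≫
    (Scheme.Modules.pullbackComp iX f).symm).app F, fun V U W W' h₁ h₂ h₃ h₄ m => ?_⟩
  exact iso_trans_trans_symm_app _ _ _ _ _ (pbLE_comp g iY F V W W' h₁ h₂ m)
    (pbLE_congr e F V W' (h₂.trans (g.preimage_mono h₁)) m) (pbLE_comp iX f F V U W' h₃ h₄ m)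

/-- The passage from sheaves to modules used throughout: the charts `fromSpec` of `U` and `V`
identify the map with a pullback between spectra, where quasi-coherence makes it an extension of
scalars. -/
theorem isSBC_pbLE (f : X ⟶ Y) (F : Y.Modules) [F.IsQuasicoherent] {V : Y.Opens}
    (hV : IsAffineOpen V) {U : X.Opens} (hU : IsAffineOpen U) (h : U ≤ f ⁻¹ᵁ V) :
    IsSBC (f.appLE V U h).hom (pbLE f F V U h).hom := by
  obtain ⟨c, hc⟩ := exists_pullback_iso (IsAffineOpen.SpecMap_appLE_fromSpec f hV hU h) F
  have h1 := isSBC_pb_Spec (f.appLE V U h) ((Scheme.Modules.pullback hV.fromSpec).obj F)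
  have h2 := h1.comp_equiv (appLinearEquiv c ⊤) (v := (pbLE _ _ ⊤ ⊤ le_top ≫ c.hom.app ⊤).hom)
    fun m => rfl
  have h3 := h2.comp_equiv (fromSpecΓEquiv _ hU).symm
    (v := ((fromSpecΓEquiv ((Scheme.Modules.pullback f).obj F) hU).symm : _ →+ _).comp (pbLE _ _ ⊤ ⊤ le_top ≫ c.hom.app ⊤).hom)
    fun m => rfl
  refine h3.equiv_comp (fromSpecΓEquiv F hV) fun m => ?_
  refine ((fromSpecΓEquiv _ hU).symm_apply_eq.mpr ?_).symm
  exact hc V U ⊤ ⊤ hV.fromSpec_preimage_self.ge le_top h hU.fromSpec_preimage_self.ge m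

end

/-! ### Quasi-coherence as localization of sections -/

section QC

/-- Since `f` acts invertibly on sections over the basic open, the two conditions say exactly that
restriction is localization at `f`. -/
theorem isQuasicoherent_Spec_of_localizing {R : CommRingCat.{u}} (M : (Spec R).Modules)
    (H : ∀ (f : R) (U : (Spec R).Opens) (i : U ⟶ ⊤), U = PrimeSpectrum.basicOpen f →
      (∀ s : Γ(M, ⊤), M.presheaf.map i.op s = 0 → ∃ n : ℕ, f ^ n • s = 0) ∧
      ∀ t : Γ(M, U), ∃ (n : ℕ) (s : Γ(M, ⊤)), f ^ n • t = M.presheaf.map i.op s) :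
    M.IsQuasicoherent := by
  rw [isQuasicoherent_iff_isIso_fromTildeΓ, isIso_fromTildeΓ_iff_isLocalizing]
  intro f
  obtain ⟨H₁, H₂⟩ := H f _ (PrimeSpectrum.basicOpen f).leTop rfl
  refine IsLocalizedModule.mk (fun x => ?_) (fun t => ?_) (fun {s₁ s₂} h => ?_)
  · obtain ⟨_, n, rfl⟩ := x
    rw [map_pow]
    exact (M.isUnit_algebraMap_end_of_le_basicOpen f le_rfl).pow n
  · obtain ⟨n, s, h⟩ := H₂ t
    exact ⟨(s, ⟨f ^ n, n, rfl⟩), h⟩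
  · have h0 : M.presheaf.map (PrimeSpectrum.basicOpen f).leTop.op ((s₁ : Γ(M, ⊤)) - (s₂ : Γ(M, ⊤))) = 0 :=
      (map_sub (M.presheaf.map (PrimeSpectrum.basicOpen f).leTop.op).hom _ _).trans
      (sub_eq_zero.mpr h)
    obtain ⟨n, hn⟩ := H₁ _ h0
    exact ⟨⟨f ^ n, n, rfl⟩, sub_eq_zero.mp ((smul_sub (f ^ n) (s₁ : Γ(M, ⊤)) (s₂ : Γ(M, ⊤))).symm.trans hn)⟩

variable {X : Scheme.{u}}

/-- Transport of presentations along isomorphisms. -/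
def presentationOfIso {F F' : X.Modules} (e : F ≅ F') (p : F.Presentation) : F'.Presentation :=
  haveI : IsIso (C := SheafOfModules X.ringCatSheaf) e.hom := e.isIso_hom
  SheafOfModules.Presentation.ofIsIso.{u, u, u} (R := X.ringCatSheaf) (M := F) (N := F') e.hom p

/-- A presentation over an open subscheme, as a presentation on the corresponding slice site. -/
def presentationOver (F : X.Modules) (U : X.Opens) (p : (F.restrict U.ι).Presentation) :
    SheafOfModules.Presentation.{u} (F.over U) :=
  letI E := U.sheafOfModulesEquivOver X.ringCatSheaf
  haveI : PreservesColimitsOfSize.{u, u} E.inverse :=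
    E.symm.toAdjunction.leftAdjoint_preservesColimits
  letI e : E.functor.obj (F.over U) ≅ F.restrict U.ι := (Scheme.Modules.overFunctorEquiv U).app F
  SheafOfModules.Presentation.ofIsIso.{u, u, u}
    (E.inverse.mapIso e.symm ≪≫ (E.unitIso.app (F.over U)).symm).hom
    (SheafOfModules.Presentation.map (R := U.sheafRestrict.obj X.ringCatSheaf)
      (M := F.restrict U.ι) p E.inverse (U.sheafOfModulesEquivOverInverseUnit X.ringCatSheaf).symm)

theorem nonempty_presentation_restrict (F : X.Modules) {U : X.Opens} (hU : IsAffineOpen U)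
    [(F.restrict hU.fromSpec).IsQuasicoherent] : Nonempty (F.restrict U.ι).Presentation := by
  have : IsIso (F.restrict hU.fromSpec).fromTildeΓ :=
    (isQuasicoherent_iff_isIso_fromTildeΓ _).mp inferInstance
  let p : (F.restrict hU.fromSpec).Presentation := presentationOfIso
    (asIso (F.restrict hU.fromSpec).fromTildeΓ)
    (presentationTilde _ Set.univ Submodule.span_univ _ (Submodule.span_eq _))
  let e : Scheme.Modules.restrictFunctor U.ι ≅ Scheme.Modules.restrictFunctor hU.fromSpec ⋙
      Scheme.Modules.restrictFunctor hU.isoSpec.hom :=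
    Scheme.Modules.restrictFunctorCongr (by simp) ≪≫ Scheme.Modules.restrictFunctorComp _ _
  exact ⟨presentationOfIso (e.app F).symm
    (Scheme.Modules.presentationRestrict hU.isoSpec.hom p)⟩

/-- A quasi-coherent sheaf on a spectrum comes from a module and so has a global presentation; those
on the affine opens form quasi-coherent data for the cover by all of them. -/
theorem isQuasicoherent_of_restrict (F : X.Modules)
    (H : ∀ (U : X.Opens) (hU : IsAffineOpen U), (F.restrict hU.fromSpec).IsQuasicoherent) :
    F.IsQuasicoherent := by
  have hp : ∀ U : X.affineOpens, Nonempty (SheafOfModules.Presentation.{u} (F.over U.1)) := by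
    rintro ⟨U, hU⟩
    have := H U hU
    exact (nonempty_presentation_restrict F hU).map (presentationOver F U)
  refine SheafOfModules.QuasicoherentData.isQuasicoherent (R := X.ringCatSheaf) (M := F)
    { I := X.affineOpens
      X := fun U => (U.1 : X.Opens)
      coversTop := ?_
      presentation := fun U => (hp U).some }
  rw [Opens.coversTop_iff]
  exact iSup_affineOpens_eq_top X

theorem pbLE_pullbackId (F : X.Modules) {U V : X.Opens} (h : U ≤ 𝟙 X ⁻¹ᵁ V)
    (m : Γ(F, V)) : ((Scheme.Modules.pullbackId X).hom.app F).app U (pbLE (𝟙 X) F V U h m) =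
      F.presheaf.map (homOfLE h : U ⟶ V).op m := by
  have e := unit_conjugateEquiv Adjunction.id
    (Scheme.Modules.pullbackPushforwardAdjunction (𝟙 X)) (Scheme.Modules.pullbackId X).hom F
  rw [Scheme.Modules.conjugateEquiv_pullbackId_hom] at e
  rw [pbLE_apply, app_presheaf_map]
  exact congr(F.presheaf.map (homOfLE h : U ⟶ V).op (($e).app V m)).symm

/-- Restriction is pullback along the identity, followed by `pullbackId`. -/
theorem isSBC_presheaf_map (F : X.Modules) [F.IsQuasicoherent] {U V : X.Opens}
    (hU : IsAffineOpen U) (hV : IsAffineOpen V) (i : U ⟶ V) :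
    IsSBC (X.presheaf.map i.op).hom (F.presheaf.map i.op).hom := by
  have h := isSBC_pbLE (𝟙 X) F hV hU i.le
  have e : (Scheme.Hom.appLE (𝟙 X) V U i.le) = X.presheaf.map i.op := by
    simp [Scheme.Hom.appLE]
    rfl
  rw [e] at h
  exact h.comp_equiv
    (LinearEquiv.ofBijective
      { toFun := ((Scheme.Modules.pullbackId X).hom.app F).app U
        map_add' := map_add _
        map_smul' := Scheme.Modules.Hom.app_smul _ } 
      (bijective_app_of_iso ((Scheme.Modules.pullbackId X).app F) U))
    fun m => (pbLE_pullbackId F i.le m).symm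

/-- Sections of `F` over `V` are the localization at `f` of sections over `U`. -/
def IsLocAt (F : X.Modules) {U V : X.Opens} (i : V ⟶ U) (f : Γ(X, U)) : Prop :=
  (∀ s : Γ(F, U), F.presheaf.map i.op s = 0 → ∃ n : ℕ, f ^ n • s = 0) ∧
    ∀ t : Γ(F, V), ∃ (n : ℕ) (s : Γ(F, U)), X.presheaf.map i.op f ^ n • t = F.presheaf.map i.op s

theorem isLocAt_of_isQuasicoherent (F : X.Modules) [F.IsQuasicoherent] {U : X.Opens}
    (hU : IsAffineOpen U) (f : Γ(X, U)) {V : X.Opens} (i : V ⟶ U) (hV : V = X.basicOpen f) :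
    IsLocAt F i f := by
  subst hV
  letI := (X.presheaf.map i.op).hom.toAlgebra
  obtain ⟨e, he⟩ := IsSBC.exists_linearEquiv (R := Γ(X, U)) (A := Γ(X, X.basicOpen f))
    (isSBC_presheaf_map F (hU.basicOpen f) hU i)
  have hloc : IsLocalization.Away f Γ(X, X.basicOpen f) := hU.isLocalization_basicOpen f
  letI : Module Γ(X, U) Γ(F, X.basicOpen f) := Module.compHom _ (X.presheaf.map i.op).hom
  haveI : IsScalarTower Γ(X, U) Γ(X, X.basicOpen f) Γ(F, X.basicOpen f) :=
    ⟨fun r a n => by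
      change (X.presheaf.map i.op r * a) • n = X.presheaf.map i.op r • a • n; rw [mul_smul]⟩
  let l : Γ(F, U) →ₗ[Γ(X, U)] Γ(F, X.basicOpen f) :=
    { toFun := F.presheaf.map i.op, map_add' := map_add _, map_smul' := Scheme.Modules.map_smul _ _ }
  have hl : IsBaseChange Γ(X, X.basicOpen f) l := IsBaseChange.of_equiv e fun m => by
    rw [he, one_smul]; rfl
  have := (isLocalizedModule_iff_isBaseChange (.powers f) Γ(X, X.basicOpen f) l).mpr hl
  refine ⟨fun s hs => ?_, fun t => ?_⟩
  · obtain ⟨⟨_, n, rfl⟩, h⟩ := (IsLocalizedModule.eq_zero_iff (.powers f) l).mp hs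
    exact ⟨n, h⟩
  · obtain ⟨⟨s, ⟨_, n, rfl⟩⟩, h⟩ := IsLocalizedModule.surj (.powers f) l t
    refine ⟨n, s, h ▸ ?_⟩
    rw [← map_pow]
    rfl

theorem isQuasicoherent_of_isLocAt (F : X.Modules)
    (H : ∀ (U : X.Opens), IsAffineOpen U → ∀ (f : Γ(X, U)) (V : X.Opens) (i : V ⟶ U),
      V = X.basicOpen f → IsLocAt F i f) : F.IsQuasicoherent := by
  refine isQuasicoherent_of_restrict F fun U hU => ?_
  refine isQuasicoherent_Spec_of_localizing _ fun f V i hV => ?_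
  have h := H (hU.fromSpec ''ᵁ ⊤) (isAffineOpen_top _ |>.image_of_isOpenImmersion hU.fromSpec) ((hU.fromSpec.appIso ⊤).inv ((Scheme.ΓSpecIso Γ(X, U)).inv f))
    (hU.fromSpec ''ᵁ V) (hU.fromSpec.opensFunctor.map i) (by
      subst hV
      rw [← Scheme.image_basicOpen]
      congr 1
      exact (basicOpen_eq_of_affine f).symm)
  have hsm : ∀ (W : (Spec Γ(X, U)).Opens) (j : W ⟶ ⊤) (n : ℕ) (x : Γ(F.restrict hU.fromSpec, W)),
      f ^ n • x = (F.restrictAppIso hU.fromSpec W).inv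
        (X.presheaf.map (hU.fromSpec.opensFunctor.map j).op
          ((hU.fromSpec.appIso ⊤).inv ((Scheme.ΓSpecIso Γ(X, U)).inv f)) ^ n •
            (F.restrictAppIso hU.fromSpec W).hom x) := by
    intro W j n x
    have e := ConcreteCategory.congr_hom (hU.fromSpec.appIso_inv_naturality j.op)
      ((Scheme.ΓSpecIso Γ(X, U)).inv (f ^ n))
    have e' : X.presheaf.map (hU.fromSpec.opensFunctor.map j).op
          ((hU.fromSpec.appIso ⊤).inv ((Scheme.ΓSpecIso Γ(X, U)).inv f)) ^ n =
        (hU.fromSpec.appIso W).inv ((Spec Γ(X, U)).presheaf.map j.op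
          ((Scheme.ΓSpecIso Γ(X, U)).inv (f ^ n))) := by
      refine Eq.trans ?_ e.symm
      rw [← map_pow, ← map_pow, ← map_pow]
      rfl
    rw [e', Scheme.Modules.smul_Spec_def]
    rfl
  refine ⟨fun s hs => ?_, fun t => ?_⟩
  · obtain ⟨n, hn⟩ := h.1 s hs
    refine ⟨n, (hsm ⊤ (𝟙 ⊤) n s).trans ?_⟩
    rw [show (hU.fromSpec.opensFunctor.map (𝟙 ⊤)).op = 𝟙 _ from Subsingleton.elim _ _,
      X.presheaf.map_id]
    exact hn
  · obtain ⟨n, s, hn⟩ := h.2 t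
    exact ⟨n, s, (hsm V i n t).trans hn⟩

end QC

/-! ### Kernels, epimorphisms and pushforwards of sheaves of modules -/

section Sheaf

variable {X Y : Scheme.{u}}

/-- The structure sheaf as a module over itself. -/
def structureModule (X : Scheme.{u}) : X.Modules := SheafOfModules.unit X.ringCatSheaf

theorem injective_of_mono {F F' : X.Modules} (h : F ⟶ F') [Mono h] (U : X.Opens) :
    Function.Injective (h.app U) := by
  have : Mono ((Scheme.Modules.toPresheaf X).map h) := inferInstance
  have : Mono (((Scheme.Modules.toPresheaf X).map h).app (op U)) := inferInstance
  exact (AddCommGrpCat.mono_iff_injective _).mp this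

theorem mono_of_isBasis {F F' : X.Modules} (h : F ⟶ F') {B : Set X.Opens}
    (hB : Opens.IsBasis B) (H : ∀ U ∈ B, Function.Injective (h.app U)) : Mono h := by
  refine ⟨fun {N} a b hab => hom_ext_of_isBasis hB fun V hV m => H V hV ?_⟩
  exact congr(($hab).app V m)

theorem exists_kernel_ι_app_eq {F F' : X.Modules} (h : F ⟶ F') (U : X.Opens) (s : Γ(F, U))
    (hs : h.app U s = 0) : ∃ k : Γ(kernel h, U), (kernel.ι h).app U k = s := by
  let G := Scheme.Modules.toPresheaf X ⋙ (evaluation _ _).obj (op U)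
  let C : ShortComplex X.Modules := ShortComplex.mk (kernel.ι h) h (kernel.condition h)
  have hC : C.Exact := C.exact_of_f_is_kernel (kernelIsKernel h)
  haveI : G.PreservesZeroMorphisms := ⟨fun _ _ => rfl⟩
  haveI : PreservesLimits ((evaluation (TopologicalSpace.Opens X)ᵒᵖ Ab.{u}).obj (op U)) :=
    inferInstance
  haveI : PreservesLimits G := comp_preservesLimits _ _
  haveI : Mono C.f := inferInstanceAs (Mono (kernel.ι h))
  have h2 := hC.map_of_mono_of_preservesKernel G inferInstance inferInstance
  exact (ShortComplex.ab_exact_iff _).mp h2 s hs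

/-- Every section of the target lifts locally. -/
def LocallySurjective {F F' : X.Modules} (h : F ⟶ F') : Prop :=
  ∀ (U : X.Opens) (t : Γ(F', U)) (x : X), x ∈ U → ∃ (V : X.Opens) (i : V ⟶ U)
      (s : Γ(F, V)), x ∈ V ∧ h.app V s = F'.presheaf.map i.op t

theorem LocallySurjective.epi {F F' : X.Modules} {h : F ⟶ F'} (H : LocallySurjective h) :
    Epi h := by
  refine ⟨fun {N} a b hab => ?_⟩
  ext U t
  apply TopCat.Presheaf.IsSheaf.section_ext N.isSheaf
  intro x hx
  obtain ⟨V, i, s, hxV, hs⟩ := H U t x hx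
  refine ⟨V, i.le, hxV, ?_⟩
  have := congr(($hab).app V s)
  have h2 : a.app V (h.app V s) = b.app V (h.app V s) := this
  rw [hs, app_presheaf_map, app_presheaf_map] at h2
  exact h2

theorem locallySurjective_of_isBasis {F F' : X.Modules} (h : F ⟶ F') {B : Set X.Opens}
    (hB : Opens.IsBasis B) (H : ∀ U ∈ B, Function.Surjective (h.app U)) :
    LocallySurjective h := by
  intro U t x hx
  obtain ⟨W, hW, hxW, hWV⟩ := Opens.isBasis_iff_nbhd.mp hB hx
  obtain ⟨s, hs⟩ := H W hW (F'.presheaf.map (homOfLE hWV).op t)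
  exact ⟨W, homOfLE hWV, s, hxW, hs⟩

theorem isIso_of_isBasis {F F' : X.Modules} (h : F ⟶ F') {B : Set X.Opens}
    (hB : Opens.IsBasis B) (H : ∀ U ∈ B, Function.Bijective (h.app U)) : IsIso h := by
  have := mono_of_isBasis h hB fun U hU => (H U hU).1
  have := (locallySurjective_of_isBasis h hB fun U hU => (H U hU).2).epi
  exact isIso_of_mono_of_epi h

/-- Factor the map through its image as presheaves. After sheafification the inclusion of the image
is mono and, like the whole map, epi, hence an isomorphism; so the inclusion was already locally
bijective. -/
theorem isLocallySurjective_of_epi {R : Sheaf (Opens.grothendieckTopology X) RingCat.{u}} {F F' : SheafOfModules.{u} R}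
    (h : F ⟶ F') [Epi h] : Presheaf.IsLocallySurjective (Opens.grothendieckTopology X)
      ((SheafOfModules.toSheaf R).map h).hom := by
  let adj := PresheafOfModules.sheafificationAdjunction.{u} (𝟙 R.obj)
  let k := (SheafOfModules.forget R ⋙ PresheafOfModules.restrictScalars (𝟙 R.obj)).map h
  let a := PresheafOfModules.sheafification.{u} (𝟙 R.obj)
  have h1 : Epi (a.map k) := by
    have e : a.map k ≫ adj.counit.app F' = adj.counit.app F ≫ h := adj.counit.naturality h
    have : IsIso adj.counit := inferInstance
    have e2 : Epi (a.map k ≫ adj.counit.app F') := e ▸ epi_comp _ _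
    have := epi_comp (a.map k ≫ adj.counit.app F') (inv (adj.counit.app F'))
    rwa [Category.assoc, IsIso.hom_inv_id, Category.comp_id] at this
  have e : a.map k = a.map (Abelian.factorThruImage k) ≫ a.map (Abelian.image.ι k) := by
    rw [← Functor.map_comp, Abelian.image.fac]
  have h2 : Epi (a.map (Abelian.image.ι k)) := by
    rw [e] at h1
    exact epi_of_epi (a.map (Abelian.factorThruImage k)) _
  have h3 : Mono (a.map (Abelian.image.ι k)) := inferInstance
  have h4 : IsIso (a.map (Abelian.image.ι k)) := isIso_of_mono_of_epi _
  have h5 : IsIso ((SheafOfModules.toSheaf _).map (a.map (Abelian.image.ι k))) := inferInstance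
  have h6 := ((Opens.grothendieckTopology X).W_iff
    ((PresheafOfModules.toPresheaf _).map (Abelian.image.ι k))).mpr h5
  rw [GrothendieckTopology.W_iff_isLocallyBijective] at h6
  have h7 := h6.2
  have h8 : Presheaf.IsLocallySurjective (Opens.grothendieckTopology X)
      ((PresheafOfModules.toPresheaf _).map (Abelian.factorThruImage k)) :=
    Presheaf.isLocallySurjective_of_surjective _ _ fun U =>
      PresheafOfModules.surjective_of_epi _ U
  have h9 := Presheaf.isLocallySurjective_comp (Opens.grothendieckTopology X)
    ((PresheafOfModules.toPresheaf _).map (Abelian.factorThruImage k))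
    ((PresheafOfModules.toPresheaf _).map (Abelian.image.ι k))
  rw [← Functor.map_comp, Abelian.image.fac] at h9
  exact h9

theorem locallySurjective_of_epi {F F' : X.Modules} (h : F ⟶ F') [he : Epi h] :
    LocallySurjective h := by
  have := @isLocallySurjective_of_epi X X.ringCatSheaf F F' h he
  intro U t x hx
  obtain ⟨V, i, ⟨s, hs⟩, hxV⟩ := this.imageSieve_mem (U := U) t x hx
  exact ⟨V, i, s, hxV, hs⟩

theorem isQuasicoherent_kernel {F F' : X.Modules} [F.IsQuasicoherent] [F'.IsQuasicoherent]
    (h : F ⟶ F') : (kernel h).IsQuasicoherent := by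
  refine isQuasicoherent_of_isLocAt _ fun U hU f V i hV => ?_
  have h1 := isLocAt_of_isQuasicoherent F hU f i hV
  have h2 := isLocAt_of_isQuasicoherent F' hU f i hV
  constructor
  · intro s hs
    obtain ⟨n, hn⟩ := h1.1 ((kernel.ι h).app U s) (by rw [← app_presheaf_map, hs, map_zero])
    refine ⟨n, injective_of_mono (kernel.ι h) U ?_⟩
    rw [Scheme.Modules.Hom.app_smul, hn, map_zero]
  · intro t
    have hc : ∀ (W : X.Opens) (s : Γ(kernel h, W)), h.app W ((kernel.ι h).app W s) = 0 :=
      fun W s => congr(($(kernel.condition h)).app W s)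
    obtain ⟨n, s, hs⟩ := h1.2 ((kernel.ι h).app V t)
    -- The section `s` extends `f ^ n • t` but need not lie in the kernel. Its image under `h` dies
    -- on `V`, so a further power of `f` kills it.
    obtain ⟨m, hm⟩ := h2.1 (h.app U s) (by
      rw [← app_presheaf_map, ← hs, Scheme.Modules.Hom.app_smul, hc, smul_zero])
    obtain ⟨k, hk⟩ := exists_kernel_ι_app_eq h U (f ^ m • s) (by
      rw [Scheme.Modules.Hom.app_smul, hm])
    refine ⟨m + n, k, injective_of_mono (kernel.ι h) V ?_⟩
    rw [app_presheaf_map, hk, Scheme.Modules.map_smul, ← hs, Scheme.Modules.Hom.app_smul,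
      map_pow, pow_add, mul_smul]

/-- The preimage of `U` is affine, and the preimage of a basic open of `U` is the basic open of the
pulled back function, so the localization is one of rings. -/
theorem isQuasicoherent_pushforward (f : X ⟶ Y) [IsAffineHom f] :
    ((Scheme.Modules.pushforward f).obj (structureModule X)).IsQuasicoherent := by
  refine isQuasicoherent_of_isLocAt _ fun U hU r V i hV => ?_
  subst hV
  have hU' := hU.preimage f
  let j := (Opens.map f.base).map i
  have e : f ⁻¹ᵁ Y.basicOpen r = X.basicOpen (f.app U r) := Scheme.preimage_basicOpen f r
  have key : ∀ (W : X.Opens) (j : W ⟶ f ⁻¹ᵁ U), W = X.basicOpen (f.app U r) →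
      letI := (X.presheaf.map j.op).hom.toAlgebra
      IsLocalization.Away (f.app U r) Γ(X, W) := by
    rintro W j rfl
    exact hU'.isLocalization_basicOpen (f.app U r)
  letI := (X.presheaf.map j.op).hom.toAlgebra
  have hloc := key _ j e
  have hsm : ∀ (n : ℕ) (s : Γ(X, f ⁻¹ᵁ U)), f.app U r ^ n * s = f.app U (r ^ n) * s := by
    intro n s; rw [map_pow]
  constructor
  · intro (s : Γ(X, f ⁻¹ᵁ U)) hs
    obtain ⟨⟨_, n, rfl⟩, hn⟩ := (IsLocalization.map_eq_zero_iff (.powers (f.app U r))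
      Γ(X, f ⁻¹ᵁ Y.basicOpen r) s).mp hs
    exact ⟨n, (hsm n s).symm.trans hn⟩
  · intro (t : Γ(X, f ⁻¹ᵁ Y.basicOpen r))
    obtain ⟨⟨s, ⟨_, n, rfl⟩⟩, hn⟩ := IsLocalization.surj (.powers (f.app U r)) t
    refine ⟨n, s, ?_⟩
    have e2 : f.app (Y.basicOpen r) (Y.presheaf.map i.op r ^ n) * t =
        X.presheaf.map j.op (f.app U r ^ n) * t := by
      rw [← map_pow, ← map_pow]
      congr 1
      exact congr($(f.naturality i.op) (r ^ n))
    refine e2.trans ((mul_comm _ _).trans hn)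

end Sheaf

/-! ### Flat pullback preserves monomorphisms and kernels -/

section FlatPullback

variable {X Y : Scheme.{u}}

theorem isBasis_affineOpens_le_preimage (f : X ⟶ Y) :
    Opens.IsBasis {U : X.Opens | IsAffineOpen U ∧ ∃ V : Y.Opens, IsAffineOpen V ∧ U ≤ f ⁻¹ᵁ V} := by
  rw [Opens.isBasis_iff_nbhd]
  intro W x hx
  obtain ⟨V, hV, hxV, -⟩ := Opens.isBasis_iff_nbhd.mp Y.isBasis_affineOpens
    (show f x ∈ (⊤ : Y.Opens) from trivial)
  obtain ⟨U, hU, hxU, hUW⟩ := Opens.isBasis_iff_nbhd.mp X.isBasis_affineOpens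
    (show x ∈ W ⊓ f ⁻¹ᵁ V from ⟨hx, hxV⟩)
  exact ⟨U, ⟨hU, V, hV, hUW.trans inf_le_right⟩, hxU, hUW.trans inf_le_left⟩

/-- The linear map on sections induced by a morphism of modules. -/
def appLin {F F' : X.Modules} (h : F ⟶ F') (U : X.Opens) : Γ(F, U) →ₗ[Γ(X, U)] Γ(F', U) where
  toFun := h.app U
  map_add' := map_add _
  map_smul' := Scheme.Modules.Hom.app_smul h

theorem pullback_map_injective (f : X ⟶ Y) [Flat f] {F F' : Y.Modules} [F.IsQuasicoherent]
    [F'.IsQuasicoherent] (h : F ⟶ F') [Mono h] {U : X.Opens} (hU : IsAffineOpen U) {V : Y.Opens}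
    (hV : IsAffineOpen V) (hUV : U ≤ f ⁻¹ᵁ V) :
    Function.Injective (((Scheme.Modules.pullback f).map h).app U) :=
  IsSBC.injective_of_flat (Flat.flat_appLE f hV hU hUV) (isSBC_pbLE f F hV hU hUV)
    (isSBC_pbLE f F' hV hU hUV) (appLin h V) (injective_of_mono h V)
    (g := appLin ((Scheme.Modules.pullback f).map h) U) fun m => map_app_pbLE f h V U hUV m

theorem mono_pullback_map (f : X ⟶ Y) [Flat f] {F F' : Y.Modules} [F.IsQuasicoherent]
    [F'.IsQuasicoherent] (h : F ⟶ F') [Mono h] : Mono ((Scheme.Modules.pullback f).map h) :=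
  mono_of_isBasis _ (isBasis_affineOpens_le_preimage f) fun _ ⟨hU, _, hV, hUV⟩ =>
    pullback_map_injective f h hU hV hUV

theorem exists_lift_pullback_kernel (f : X ⟶ Y) [Flat f] {F F' : Y.Modules} [F.IsQuasicoherent]
    [F'.IsQuasicoherent] (h : F ⟶ F') {N : X.Modules} (g : N ⟶ (Scheme.Modules.pullback f).obj F)
    (hg : g ≫ (Scheme.Modules.pullback f).map h = 0) :
    ∃ l, l ≫ (Scheme.Modules.pullback f).map (kernel.ι h) = g := by
  have := isQuasicoherent_kernel h
  have hc : (Scheme.Modules.pullback f).map (kernel.ι h) ≫ (Scheme.Modules.pullback f).map h = 0 := by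
    rw [← Functor.map_comp, kernel.condition, Functor.map_zero]
  -- The comparison from the pullback of the kernel to the kernel of the pullback is checked on
  -- affine opens, where it is flat base change of modules.
  have : IsIso (kernel.lift _ _ hc) := by
    refine isIso_of_isBasis _ (isBasis_affineOpens_le_preimage f) fun U ⟨hU, V, hV, hUV⟩ => ?_
    have key : ∀ z, (kernel.ι ((Scheme.Modules.pullback f).map h)).app U ((kernel.lift _ _ hc).app U z) =
        ((Scheme.Modules.pullback f).map (kernel.ι h)).app U z := fun z =>
      congr(($(kernel.lift_ι ((Scheme.Modules.pullback f).map h) _ hc)).app U z)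
    have hex := IsSBC.exact_of_flat (Flat.flat_appLE f hV hU hUV)
      (isSBC_pbLE f (kernel h) hV hU hUV) (isSBC_pbLE f F hV hU hUV) (isSBC_pbLE f F' hV hU hUV)
      (appLin (kernel.ι h) V) (appLin h V) (fun y => ⟨fun hy => exists_kernel_ι_app_eq h V y hy, by
        rintro ⟨x, rfl⟩
        exact congr(($(kernel.condition h)).app V x)⟩)
      (g := appLin ((Scheme.Modules.pullback f).map (kernel.ι h)) U)
      (g' := appLin ((Scheme.Modules.pullback f).map h) U)
      (fun m => map_app_pbLE f (kernel.ι h) V U hUV m) (fun m => map_app_pbLE f h V U hUV m)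
    constructor
    · intro a b hab
      apply pullback_map_injective f (kernel.ι h) hU hV hUV
      rw [← key, ← key, hab]
    · intro k
      obtain ⟨z, hz⟩ := (hex ((kernel.ι ((Scheme.Modules.pullback f).map h)).app U k)).mp
        (congr(($(kernel.condition ((Scheme.Modules.pullback f).map h))).app U k))
      refine ⟨z, injective_of_mono (kernel.ι ((Scheme.Modules.pullback f).map h)) U ?_⟩
      rw [key]
      exact hz
  refine ⟨kernel.lift _ g hg ≫ inv (kernel.lift _ _ hc), ?_⟩
  have e := (IsIso.inv_comp_eq _).mpr (kernel.lift_ι ((Scheme.Modules.pullback f).map h) _ hc).symm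
  rw [Category.assoc, e, kernel.lift_ι]

end FlatPullback

/-! ### Pulling back an action along a point -/

section PullbackAct

variable {S : Scheme.{u}} {G T : Over S} (g : T ⟶ G) (F : S.Modules)

/-- The identification of `g^* (π^* F)` with `f^* F`. -/
def pbTrIso : (Scheme.Modules.pullback g.left).obj ((Scheme.Modules.pullback G.hom).obj F) ≅
    (Scheme.Modules.pullback T.hom).obj F :=
  (Scheme.Modules.pullbackComp g.left G.hom).app F ≪≫
    (Scheme.Modules.pullbackCongr (Over.w g)).app F

/-- Pullback of sections of `π^* F` along a morphism over the base. -/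
def pbTr (W : G.left.Opens) : Γ((Scheme.Modules.pullback G.hom).obj F, W) →+
    Γ((Scheme.Modules.pullback T.hom).obj F, g.left ⁻¹ᵁ W) :=
  (pb g.left _ W ≫ (pbTrIso g F).hom.app _).hom

theorem pbTr_apply (W : G.left.Opens) (z) :
    pbTr g F W z = (pbTrIso g F).hom.app _ (pb g.left _ W z) := rfl

theorem pbTr_smul (W : G.left.Opens) (d : Γ(G.left, W)) (z) :
    pbTr g F W (d • z) = g.left.app W d • pbTr g F W z := by
  rw [pbTr_apply, pb_smul, Scheme.Modules.Hom.app_smul, pbTr_apply]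

theorem preimage_preimage_eq (g : T ⟶ G) (V : S.Opens) :
    g.left ⁻¹ᵁ G.hom ⁻¹ᵁ V = T.hom ⁻¹ᵁ V := by
  rw [← Over.w g]; rfl

theorem pbTr_pbLE (V : S.Opens) (W : G.left.Opens) (h : W ≤ G.hom ⁻¹ᵁ V) (m : Γ(F, V)) :
    pbTr g F W (pbLE G.hom F V W h m) = pbLE T.hom F V (g.left ⁻¹ᵁ W)
      ((g.left.preimage_mono h).trans (preimage_preimage_eq g V).le) m := by
  rw [pbTr_apply, ← pbLE_preimage]
  have h1 := pbLE_comp g.left G.hom F V W (g.left ⁻¹ᵁ W) h le_rfl m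
  have h2 := pbLE_congr (Over.w g) F V (g.left ⁻¹ᵁ W) (g.left.preimage_mono h) m
  rw [← h1] at h2
  exact h2

theorem pullbackAct_pbTr
    (φ : (Scheme.Modules.pullback G.hom).obj F ≅ (Scheme.Modules.pullback G.hom).obj F)
    (W : G.left.Opens) (z) :
    (pullbackAct φ g).hom.app (g.left ⁻¹ᵁ W) (pbTr g F W z) = pbTr g F W (φ.hom.app W z) := by
  have h1 := iso_hom_app_inv_app (pbTrIso g F).symm (g.left ⁻¹ᵁ W) (pb g.left _ W z)
  have h2 := map_app_pb g.left φ.hom W z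
  refine (congr((pbTrIso g F).hom.app _ (((Scheme.Modules.pullback g.left).map φ.hom).app _ $h1))).trans ?_
  rw [h2, pbTr_apply]

end PullbackAct

theorem isAffineHom_pullback_fst_comp {X Y Z : Scheme.{u}} (f : X ⟶ Z) (g : Y ⟶ Z) [IsAffineHom f]
    [IsAffineHom g] : IsAffineHom (Limits.pullback.fst f g ≫ f) :=
  have : IsAffineHom (Limits.pullback.fst f g) := 
    isAffineHom_isStableUnderBaseChange.of_isPullback (IsPullback.of_hasPullback f g).flip ‹_›
  inferInstance

theorem bijective_productMap_of_isPushout {R A B C : Type u} [CommRing R] [CommRing A] [CommRing B]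
    [CommRing C] [Algebra R A] [Algebra R B] [Algebra R C] (f : A →ₐ[R] C) (g : B →ₐ[R] C)
    (h : IsPushout (CommRingCat.ofHom (algebraMap R A)) (CommRingCat.ofHom (algebraMap R B))
      (CommRingCat.ofHom f.toRingHom) (CommRingCat.ofHom g.toRingHom)) :
    Function.Bijective (Algebra.TensorProduct.productMap f g) := by
  let e := (CommRingCat.isPushout_tensorProduct R A B).isoIsPushout _ _ h
  have he : e.hom.hom = (Algebra.TensorProduct.productMap f g).toRingHom := by
    have e1 := (CommRingCat.isPushout_tensorProduct R A B).inl_isoIsPushout_hom _ _ h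
    have e2 := (CommRingCat.isPushout_tensorProduct R A B).inr_isoIsPushout_hom _ _ h
    ext z
    · exact (congr($e1 z)).trans (by simp)
    · exact (congr($e2 z)).trans (by simp)
  have := ConcreteCategory.bijective_of_isIso e.hom
  change Function.Bijective e.hom.hom at this
  rwa [he] at this

/-! ### Functions over an affine open and integration along a factor -/

section Sec

variable {S : Scheme.{u}} (U : S.affineOpens)

instance (X T : Over S) [hX : IsAffineHom X.hom] [hT : IsAffineHom T.hom] :
    IsAffineHom (X ⊗ T).hom :=
  @isAffineHom_pullback_fst_comp X.left T.left S X.hom T.hom hX hT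

instance : IsAffineHom (𝟙_ (Over S)).hom := inferInstanceAs (IsAffineHom (𝟙 S))

/-- Sections of a scheme over `S` over the preimage of `U`. -/
def Sec (T : Over S) : Type u := Γ(T.left, T.hom ⁻¹ᵁ U.1)

instance (T : Over S) : CommRing (Sec U T) :=
  inferInstanceAs (CommRing Γ(T.left, T.hom ⁻¹ᵁ U.1))

instance (T : Over S) : Algebra Γ(S, U.1) (Sec U T) := (T.hom.app U.1).hom.toAlgebra

variable {U}

theorem appLE_eq_of_eq {X Y : Scheme.{u}} {f f' : X ⟶ Y} (e : f = f') (V : Y.Opens) (W : X.Opens)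
    (h : W ≤ f ⁻¹ᵁ V) (h' : W ≤ f' ⁻¹ᵁ V) : f.appLE V W h = f'.appLE V W h' := by
  subst e; rfl

/-- Pullback of sections. -/
def pull {T T' : Over S} (g : T ⟶ T') : Sec U T' →ₐ[Γ(S, U.1)] Sec U T where
  __ := (g.left.appLE (T'.hom ⁻¹ᵁ U.1) (T.hom ⁻¹ᵁ U.1) (preimage_preimage_eq g U.1).ge).hom
  commutes' r := by
    have h1 := Scheme.Hom.appLE_comp_appLE g.left T'.hom U.1 (T'.hom ⁻¹ᵁ U.1) (T.hom ⁻¹ᵁ U.1)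
      le_rfl (preimage_preimage_eq g U.1).ge
    rw [Scheme.Hom.appLE_eq_app, appLE_eq_of_eq (Over.w g) _ _ _ le_rfl,
      Scheme.Hom.appLE_eq_app] at h1
    exact congr($h1 r)

theorem pull_id (T : Over S) (x : Sec U T) : pull (𝟙 T) x = x := by
  have h : Scheme.Hom.appLE (𝟙 T.left) (T.hom ⁻¹ᵁ U.1) (T.hom ⁻¹ᵁ U.1) le_rfl = 𝟙 _ := by
    simp [Scheme.Hom.appLE]
    exact T.left.presheaf.map_id _
  exact congr($h x)

theorem pull_comp {T T' T'' : Over S} (g : T ⟶ T') (g' : T' ⟶ T'') (x : Sec U T'') :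
    pull (g ≫ g') x = pull g (pull g' x) :=
  congr($((Scheme.Hom.appLE_comp_appLE g.left g'.left _ _ _ (preimage_preimage_eq g' U.1).ge
    (preimage_preimage_eq g U.1).ge).symm) x)

theorem isPullback_fst_snd_left (X T : Over S) :
    IsPullback (fst X T).left (snd X T).left X.hom T.hom :=
  IsPullback.of_hasPullback X.hom T.hom

variable (U) in
theorem bijective_productMap_pull (X T : Over S) [IsAffineHom X.hom] [IsAffineHom T.hom] :
    Function.Bijective (Algebra.TensorProduct.productMap (pull (U := U) (fst X T))
      (pull (snd X T))) := by
  have hU := U.2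
  have h := isIso_pushoutSection_of_isAffineOpen (isPullback_fst_snd_left X T)
    (US := U.1) (UX := X.hom ⁻¹ᵁ U.1) (UT := T.hom ⁻¹ᵁ U.1) (UY := (X ⊗ T).hom ⁻¹ᵁ U.1)
    le_rfl le_rfl (by
      rw [preimage_preimage_eq (fst X T), preimage_preimage_eq (snd X T), inf_idem])
    U.2 (U.2.preimage T.hom) (U.2.preimage X.hom)
  rw [isIso_pushoutSection_iff] at h
  rw [Scheme.Hom.appLE_eq_app, Scheme.Hom.appLE_eq_app] at h
  exact bijective_productMap_of_isPushout _ _ h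

/-- Sections of a product are the tensor product of the sections of the factors. -/
def secProdEquiv (X T : Over S) [IsAffineHom X.hom] [IsAffineHom T.hom] :
    Sec U X ⊗[Γ(S, U.1)] Sec U T ≃ₐ[Γ(S, U.1)] Sec U (X ⊗ T) :=
  AlgEquiv.ofBijective _ (bijective_productMap_pull U X T)

theorem secProdEquiv_tmul (X T : Over S) [IsAffineHom X.hom] [IsAffineHom T.hom]
    (a : Sec U X) (b : Sec U T) :
    secProdEquiv X T (a ⊗ₜ b) = pull (fst X T) a * pull (snd X T) b :=
  Algebra.TensorProduct.productMap_apply_tmul _ _ _ _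

/-- All factors being affine over `S`, functions on a product are sums of products `a(x) b(t)`. Most
identities of integrals below are checked on these. -/
theorem sec_induction {X T : Over S} [IsAffineHom X.hom] [IsAffineHom T.hom]
    {p : Sec U (X ⊗ T) → Prop} (F : Sec U (X ⊗ T))
    (mul : ∀ a b, p (pull (fst X T) a * pull (snd X T) b)) (add : ∀ x y, p x → p y → p (x + y)) :
    p F := by
  obtain ⟨z, rfl⟩ := (secProdEquiv X T).surjective F
  induction z using TensorProduct.induction_on with
  | zero => simpa using mul 0 0
  | tmul a b => rw [secProdEquiv_tmul]; exact mul a b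
  | add x y hx hy => rw [map_add]; exact add _ _ hx hy

/-- Integration over the first factor along a linear functional. -/
def integ {X : Over S} (l : Sec U X →ₗ[Γ(S, U.1)] Γ(S, U.1)) (T : Over S) [IsAffineHom X.hom]
    [IsAffineHom T.hom] : Sec U (X ⊗ T) →ₗ[Γ(S, U.1)] Sec U T :=
  (TensorProduct.lid Γ(S, U.1) (Sec U T)).toLinearMap ∘ₗ l.rTensor (Sec U T) ∘ₗ
    (secProdEquiv X T).symm.toLinearMap

variable {X T T' : Over S} [IsAffineHom X.hom] [IsAffineHom T.hom] [IsAffineHom T'.hom]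
  (l : Sec U X →ₗ[Γ(S, U.1)] Γ(S, U.1))

theorem integ_mul (a : Sec U X) (b : Sec U T) :
    integ l T (pull (fst X T) a * pull (snd X T) b) = l a • b := by
  rw [← secProdEquiv_tmul]
  simp [integ]

theorem integ_fst (a : Sec U X) : integ l T (pull (fst X T) a) = l a • 1 := by
  rw [← integ_mul, map_one, _root_.mul_one]

theorem integ_mul_snd (F : Sec U (X ⊗ T)) (c : Sec U T) :
    integ l T (F * pull (snd X T) c) = integ l T F * c := by
  induction F using sec_induction with
  | mul a b => rw [_root_.mul_assoc, ← map_mul, integ_mul, integ_mul, smul_mul_assoc]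
  | add x y hx hy => rw [add_mul, map_add, map_add, hx, hy, add_mul]

/-- Integration commutes with base change in the parameter. An identity of integrals can thus be
stated for the universal point of `G` and then used for any `T`-point. -/
theorem pull_integ (t : T' ⟶ T) (F : Sec U (X ⊗ T)) :
    pull t (integ l T F) = integ l T' (pull (X ◁ t) F) := by
  induction F using sec_induction with
  | mul a b =>
    rw [integ_mul, map_mul, ← pull_comp, ← pull_comp, whiskerLeft_fst, whiskerLeft_snd, pull_comp,
      integ_mul, map_smul]
  | add x y hx hy => rw [map_add, map_add, hx, hy, map_add, map_add]

theorem integ_comp_pull {Y : Over S} [IsAffineHom Y.hom] (p : Y ⟶ X)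
    (l : Sec U Y →ₗ[Γ(S, U.1)] Γ(S, U.1)) (F : Sec U (X ⊗ T)) :
    integ (l ∘ₗ (pull p).toLinearMap) T F = integ l T (pull (p ▷ T) F) := by
  induction F using sec_induction with
  | mul a b =>
    rw [integ_mul, map_mul, ← pull_comp, ← pull_comp, whiskerRight_fst, whiskerRight_snd, pull_comp,
      integ_mul]
    rfl
  | add x y hx hy => rw [map_add, map_add, hx, hy, map_add]

end Sec

set_option linter.unusedSectionVars false

/-! ### Left integrals and their construction by traces -/

section Integral

variable {S : Scheme.{u}} {U : S.affineOpens} {G T T' : Over S} [GrpObj G] [IsAffineHom G.hom]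
  [IsAffineHom T.hom]

/-- A left invariant functional on the functions on `G`:
`∫ d (g * h) dh = ∫ d (h) dh`, the right hand side being constant in `g`. -/
def IsLeftIntegral (l : Sec U G →ₗ[Γ(S, U.1)] Γ(S, U.1)) : Prop :=
  ∀ d, integ l G (pull (snd G G * fst G G) d) = l d • 1

/-- Translation `(h, t) ↦ (g t * h, t)`. -/
def translate (g : T ⟶ G) : G ⊗ T ⟶ G ⊗ T := lift ((snd G T ≫ g) * fst G T) (snd G T)

theorem translate_fst (g : T ⟶ G) : translate g ≫ fst G T = (snd G T ≫ g) * fst G T :=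
  lift_fst _ _

theorem translate_snd (g : T ⟶ G) : translate g ≫ snd G T = snd G T := lift_snd _ _

theorem translate_fst_assoc (g : T ⟶ G) {Z : Over S} (t : G ⟶ Z) :
    translate g ≫ fst G T ≫ t = ((snd G T ≫ g) * fst G T) ≫ t := by
  rw [← Category.assoc, translate_fst]

theorem translate_snd_assoc (g : T ⟶ G) {Z : Over S} (t : T ⟶ Z) :
    translate g ≫ snd G T ≫ t = snd G T ≫ t := by
  rw [← Category.assoc, translate_snd]

theorem translate_comp (g g' : T ⟶ G) : translate g ≫ translate g' = translate (g' * g) := by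
  apply CartesianMonoidalCategory.hom_ext
  · rw [Category.assoc, translate_fst, translate_fst, comp_mul, translate_fst, ← Category.assoc,
      translate_snd, comp_mul, _root_.mul_assoc]
  · rw [Category.assoc, translate_snd, translate_snd, translate_snd]

theorem translate_one : translate (1 : T ⟶ G) = 𝟙 _ := by
  apply CartesianMonoidalCategory.hom_ext
  · rw [translate_fst, comp_one, _root_.one_mul, Category.id_comp]
  · rw [translate_snd, Category.id_comp]

theorem whiskerLeft_snd_mul_fst (g : T ⟶ G) :
    G ◁ g ≫ (snd G G * fst G G) = (snd G T ≫ g) * fst G T := by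
  rw [comp_mul, whiskerLeft_snd, whiskerLeft_fst]

/-- The definition is the case of the universal point; pull it back along `g` and extend linearly
over the functions on `T`. -/
theorem IsLeftIntegral.integ_translate {l : Sec U G →ₗ[Γ(S, U.1)] Γ(S, U.1)}
    (hl : IsLeftIntegral l) (g : T ⟶ G) (F : Sec U (G ⊗ T)) :
    integ l T (pull (translate g) F) = integ l T F := by
  induction F using sec_induction with
  | mul a b =>
    rw [map_mul, ← pull_comp, ← pull_comp, translate_fst, translate_snd, integ_mul_snd, integ_mul,
      ← whiskerLeft_snd_mul_fst, pull_comp, ← pull_integ, hl, map_smul, map_one, smul_mul_assoc,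
      _root_.one_mul]
  | add x y hx hy => rw [map_add, map_add, hx, hy, map_add]

section Trace

variable {n : ℕ} (e : Fin n → Sec U G) (f : Fin n → Sec U G →ₗ[Γ(S, U.1)] Γ(S, U.1))

/-- Split a surjection from a free module and take the coordinates of the section. Traces are
defined with such a system, so the functions on `G` need not be free. -/
theorem exists_dualBasis {R M : Type*} [CommRing R] [AddCommGroup M] [Module R M] [Module.Finite R M]
    [Module.Projective R M] : ∃ (n : ℕ) (e : Fin n → M) (f : Fin n → M →ₗ[R] R),
      ∀ m, ∑ i, f i m • e i = m := by
  obtain ⟨n, p, hp⟩ := Module.Finite.exists_fin' R M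
  obtain ⟨s, hs⟩ := p.exists_rightInverse_of_surjective (LinearMap.range_eq_top.mpr hp)
  refine ⟨n, fun i => p (Pi.single i 1), fun i => LinearMap.proj i ∘ₗ s, fun m => ?_⟩
  have h1 : p (s m) = m := congr($hs m)
  conv_rhs => rw [← h1, pi_eq_sum_univ' (s m), map_sum]
  refine Finset.sum_congr rfl fun i _ => ?_
  rw [map_smul]
  rfl

variable {e f} (hef : ∀ d, ∑ i, f i d • e i = d)

include hef in
theorem sum_integ_mul (F : Sec U (G ⊗ T)) :
    ∑ i, pull (fst G T) (e i) * pull (snd G T) (integ (f i) T F) = F := by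
  induction F using sec_induction with
  | mul a b =>
    simp_rw [integ_mul, map_smul, mul_smul_comm, ← smul_mul_assoc, ← map_smul]
    rw [← Finset.sum_mul, ← map_sum, hef]
  | add x y hx hy =>
    simp_rw [map_add, mul_add, Finset.sum_add_distrib]
    rw [hx, hy]

variable (e f) in
/-- The trace of an endomorphism of the functions on `G ⊗ T` over the functions on `T`. -/
def tr (E : Sec U (G ⊗ T) → Sec U (G ⊗ T)) : Sec U T :=
  ∑ i, integ (f i) T (E (pull (fst G T) (e i)))

include hef in
theorem tr_comp {E E' : Sec U (G ⊗ T) → Sec U (G ⊗ T)} (hE₀ : ∀ F F', E (F + F') = E F + E F')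
    (hE : ∀ F c, E (F * pull (snd G T) c) = E F * pull (snd G T) c) :
    tr e f (fun F => E (E' F)) = ∑ i, ∑ k, integ (f i) T (E (pull (fst G T) (e k))) *
      integ (f k) T (E' (pull (fst G T) (e i))) := by
  refine Finset.sum_congr rfl fun i _ => ?_
  beta_reduce
  conv_lhs => rw [← sum_integ_mul hef (E' (pull (fst G T) (e i)))]
  rw [show E (∑ _, _) = ∑ _, E _ from map_sum (AddMonoidHom.mk' E hE₀) _ _, map_sum]
  refine Finset.sum_congr rfl fun k _ => ?_
  rw [hE, integ_mul_snd]

-- Cyclicity of the trace: both sides expand to the same double sum of products of matrix entries.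
include hef in
theorem tr_comm {E E' : Sec U (G ⊗ T) → Sec U (G ⊗ T)} (hE₀ : ∀ F F', E (F + F') = E F + E F')
    (hE : ∀ F c, E (F * pull (snd G T) c) = E F * pull (snd G T) c)
    (hE₀' : ∀ F F', E' (F + F') = E' F + E' F')
    (hE' : ∀ F c, E' (F * pull (snd G T) c) = E' F * pull (snd G T) c) :
    tr e f (fun F => E (E' F)) = tr e f (fun F => E' (E F)) := by
  rw [tr_comp hef hE₀ hE, tr_comp hef hE₀' hE', Finset.sum_comm]
  simp_rw [mul_comm]

/-- The operator `F ↦ ((g, t) ↦ ∫ F (g * h, t) dh)`. -/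
def conv (l : Sec U G →ₗ[Γ(S, U.1)] Γ(S, U.1)) (T : Over S) [IsAffineHom T.hom] :
    Sec U (G ⊗ T) →ₗ[Γ(S, U.1)] Sec U (G ⊗ T) :=
  integ l (G ⊗ T) ∘ₗ (pull (lift ((snd G (G ⊗ T) ≫ fst G T) * fst G (G ⊗ T))
    (snd G (G ⊗ T) ≫ snd G T))).toLinearMap

/-- The operator `d ↦ (g ↦ ∫ d (g * h) dh)`. -/
def conv₀ (l : Sec U G →ₗ[Γ(S, U.1)] Γ(S, U.1)) : Sec U G →ₗ[Γ(S, U.1)] Sec U G :=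
  integ l G ∘ₗ (pull (snd G G * fst G G)).toLinearMap

variable (l : Sec U G →ₗ[Γ(S, U.1)] Γ(S, U.1))

theorem conv_apply (F : Sec U (G ⊗ T)) : conv l T F = integ l (G ⊗ T)
    (pull (lift ((snd G (G ⊗ T) ≫ fst G T) * fst G (G ⊗ T)) (snd G (G ⊗ T) ≫ snd G T)) F) := rfl

theorem conv₀_apply (d : Sec U G) : conv₀ l d = integ l G (pull (snd G G * fst G G) d) := rfl

theorem conv_mul_snd (F : Sec U (G ⊗ T)) (c : Sec U T) :
    conv l T (F * pull (snd G T) c) = conv l T F * pull (snd G T) c := by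
  rw [conv_apply, map_mul, ← pull_comp, lift_snd, pull_comp, integ_mul_snd, conv_apply]

theorem conv_fst (a : Sec U G) : conv l T (pull (fst G T) a) = pull (fst G T) (conv₀ l a) := by
  rw [conv_apply, ← pull_comp, lift_fst, ← whiskerLeft_snd_mul_fst, pull_comp, ← pull_integ,
    conv₀_apply]

/-- Convolution acts by translation on the right, so it commutes with left translation, by
associativity in `G`. -/
theorem conv_translate (g : T ⟶ G) (F : Sec U (G ⊗ T)) :
    conv l T (pull (translate g) F) = pull (translate g) (conv l T F) := by
  rw [conv_apply, conv_apply, pull_integ, ← pull_comp, ← pull_comp]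
  refine congrArg (fun t => integ l (G ⊗ T) (pull t F)) ?_
  apply CartesianMonoidalCategory.hom_ext
  · rw [Category.assoc, translate_fst, comp_mul, lift_snd_assoc, lift_fst, Category.assoc,
      Category.assoc, lift_fst, comp_mul, whiskerLeft_snd_assoc, whiskerLeft_fst, translate_fst, comp_mul,
      _root_.mul_assoc]
  · rw [Category.assoc, translate_snd, lift_snd, Category.assoc, lift_snd, whiskerLeft_snd_assoc,
      translate_snd]

variable (e f) in
/-- The functional `x ↦ Tr (y ↦ ∫ x (g * h) y (g * h) dh)`. -/
def trInt : Sec U G →ₗ[Γ(S, U.1)] Γ(S, U.1) :=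
  ∑ i, f i ∘ₗ conv₀ l ∘ₗ LinearMap.mulRight Γ(S, U.1) (e i)

theorem trInt_apply (x : Sec U G) : trInt e f l x = ∑ i, f i (conv₀ l (x * e i)) := by
  simp [trInt]

/-- Traces commute with base change: integrating a function with parameters against `trInt` is again
a trace, now over the functions on `T`. This makes the conjugation argument for invariance
available. -/
theorem integ_trInt (F : Sec U (G ⊗ T)) : integ (trInt e f l) T F =
    tr e f (fun F' => conv l T (F * F')) := by
  induction F using sec_induction with
  | mul a b =>
    rw [integ_mul, trInt_apply, Finset.sum_smul, tr]
    refine Finset.sum_congr rfl fun i _ => ?_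
    rw [mul_right_comm, ← map_mul, conv_mul_snd, conv_fst, integ_mul]
  | add x y hx hy =>
    rw [map_add, hx, hy, tr, tr, tr, ← Finset.sum_add_distrib]
    refine Finset.sum_congr rfl fun i _ => ?_
    rw [add_mul, map_add, map_add]

-- Let `P` be left translation by the universal point, an automorphism of the functions on `G × G`
-- over the second factor. Multiplication by the translate of `d` is `P ∘ (multiplication by d) ∘
-- P⁻¹`, and convolution commutes with `P`; so the traces for `d` and for its translate are those of
-- conjugate operators.
include hef in
theorem isLeftIntegral_trInt : IsLeftIntegral (trInt e f l) := by
  intro d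
  have h1 : pull (snd G G * fst G G) d = pull (translate (𝟙 G)) (pull (fst G G) d) := by
    rw [← pull_comp, translate_fst, Category.comp_id]
  have hPP' (F : Sec U (G ⊗ G)) :
      pull (translate (𝟙 G)) (pull (translate (𝟙 G)⁻¹) F) = F := by
    rw [← pull_comp, translate_comp, inv_mul_cancel, translate_one, pull_id]
  have hP'P (F : Sec U (G ⊗ G)) :
      pull (translate (𝟙 G)⁻¹) (pull (translate (𝟙 G)) F) = F := by
    rw [← pull_comp, translate_comp, mul_inv_cancel, translate_one, pull_id]
  have h2 (F : Sec U (G ⊗ G)) : conv l G (pull (snd G G * fst G G) d * F) =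
      pull (translate (𝟙 G)) (conv l G (pull (fst G G) d * pull (translate (𝟙 G)⁻¹) F)) := by
    rw [← conv_translate, map_mul (pull _), hPP', h1]
  rw [integ_trInt]
  simp_rw [h2]
  rw [tr_comm hef (E := fun F => pull (translate (𝟙 G)) F)
    (E' := fun F => conv l G (pull (fst G G) d * pull (translate (𝟙 G)⁻¹) F))]
  · simp_rw [hP'P]
    rw [← integ_trInt, integ_fst]
  · exact map_add _
  · intro F c
    rw [map_mul (pull _), ← pull_comp (translate _) (snd G G), translate_snd]
  · intro F F'
    rw [map_add, mul_add, map_add]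
  · intro F c
    rw [map_mul (pull _), ← pull_comp (translate _) (snd G G), translate_snd, ← _root_.mul_assoc,
      conv_mul_snd]

theorem algebraMap_sec_unit_bijective (U : S.affineOpens) :
    Function.Bijective (algebraMap Γ(S, U.1) (Sec U (𝟙_ (Over S)))) := by
  change Function.Bijective ((𝟙 S : S ⟶ S).app U.1)
  rw [Scheme.Hom.id_app]
  exact Function.bijective_id

variable (U G) in
/-- Evaluation at the unit section. -/
def counit : Sec U G →ₗ[Γ(S, U.1)] Γ(S, U.1) :=
  (LinearEquiv.ofBijective (Algebra.linearMap _ _)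
    (algebraMap_sec_unit_bijective U)).symm.toLinearMap ∘ₗ (pull η[G]).toLinearMap

theorem pull_one (y : Sec U G) : pull (1 : T ⟶ G) y = counit U G y • 1 := by
  have h : pull η[G] y = counit U G y • 1 := by
    rw [← Algebra.algebraMap_eq_smul_one]
    exact ((LinearEquiv.ofBijective (Algebra.linearMap _ _)
      (algebraMap_sec_unit_bijective U)).apply_symm_apply (pull η[G] y)).symm
  have h1 : (1 : T ⟶ G) = toUnit T ≫ η := rfl
  rw [h1, pull_comp, h, map_smul, map_one]

theorem counit_one : counit U G 1 = 1 := by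
  apply (algebraMap_sec_unit_bijective U).1
  rw [Algebra.algebraMap_eq_smul_one, ← pull_one, map_one, map_one]

include hef in
theorem sum_apply_comm (E E' : Sec U G →ₗ[Γ(S, U.1)] Sec U G) :
    ∑ i, f i (E (E' (e i))) = ∑ i, f i (E' (E (e i))) := by
  have h (E E' : Sec U G →ₗ[Γ(S, U.1)] Sec U G) :
      ∑ i, f i (E (E' (e i))) = ∑ i, ∑ k, f k (E' (e i)) * f i (E (e k)) := by
    refine Finset.sum_congr rfl fun i _ => ?_
    conv_lhs => rw [← hef (E' (e i))]
    simp
  rw [h, h, Finset.sum_comm]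
  simp_rw [mul_comm]

include hef in
theorem sum_inv_mul_conv₀ (y : Sec U G) :
    ∑ j, pull (𝟙 G)⁻¹ (e j) * conv₀ (f j) y = counit U G y • 1 := by
  -- The expansion of `y(gh)` in the dual basis, evaluated at `h = g⁻¹`.
  have h := congrArg (pull (lift (𝟙 G)⁻¹ (𝟙 G))) (sum_integ_mul hef (pull (snd G G * fst G G) y))
  rw [← pull_comp, comp_mul, lift_fst, lift_snd, mul_inv_cancel, pull_one, map_sum] at h
  rw [← h]
  refine Finset.sum_congr rfl fun i _ => ?_
  rw [map_mul, ← pull_comp, ← pull_comp, lift_fst, lift_snd, pull_id, conv₀_apply]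

-- By cyclicity the sum is the trace of `y ↦ ∑ e_j(g⁻¹) ∫ y(gh) df_j(h) = y(1) · 1`, an operator of
-- trace `1`. So the left integrals of the form `trInt` take values that generate the unit ideal.
include hef in
theorem sum_trInt : ∑ j, trInt e f (f j) (pull (𝟙 G)⁻¹ (e j)) = 1 := by
  have h (j) : trInt e f (f j) (pull (𝟙 G)⁻¹ (e j)) =
      ∑ i, f i (pull (𝟙 G)⁻¹ (e j) * conv₀ (f j) (e i)) := by
    rw [trInt_apply]
    exact sum_apply_comm hef (conv₀ (f j)) (LinearMap.mulLeft _ (pull (𝟙 G)⁻¹ (e j)))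
  simp_rw [h]
  rw [Finset.sum_comm]
  simp_rw [← map_sum, sum_inv_mul_conv₀ hef, map_smul, smul_eq_mul, ← counit_one (U := U) (G := G)]
  conv_rhs => rw [← hef 1]
  simp [mul_comm]

end Trace

theorem exists_isLeftIntegral [Module.Finite Γ(S, U.1) (Sec U G)]
    [Module.Projective Γ(S, U.1) (Sec U G)] (p : Ideal Γ(S, U.1)) (hp : p ≠ ⊤) :
    ∃ (l : Sec U G →ₗ[Γ(S, U.1)] Γ(S, U.1)) (y : Sec U G), IsLeftIntegral l ∧ l y ∉ p := by
  obtain ⟨n, e, f, hef⟩ := exists_dualBasis (R := Γ(S, U.1)) (M := Sec U G)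
  by_contra! h
  refine hp (p.eq_top_iff_one.mpr ?_)
  rw [← sum_trInt hef]
  exact Ideal.sum_mem _ fun j _ => h _ _ (isLeftIntegral_trInt hef _)

end Integral

theorem finite_sec {S : Scheme.{u}} (U : S.affineOpens) (G : Over S) [hG : IsFiniteFlat G] :
    Module.Finite Γ(S, U.1) (Sec U G) :=
  have := hG.isFinite
  IsFinite.finite_app G.hom U.1 U.2

theorem projective_sec {S : Scheme.{u}} (U : S.affineOpens) (G : Over S) [hG : IsFiniteFlat G] :
    Module.Projective Γ(S, U.1) (Sec U G) := by
  have := hG.isFinite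
  have := hG.flat
  have := hG.locallyOfFinitePresentation
  have h : G.hom.appLE U.1 (G.hom ⁻¹ᵁ U.1) le_rfl = G.hom.app U.1 := Scheme.Hom.appLE_eq_app _
  have h1 : Module.Flat Γ(S, U.1) (Sec U G) := by
    have := G.hom.flat_appLE U.2 (U.2.preimage G.hom) le_rfl
    rwa [h] at this
  have h2 : Algebra.FinitePresentation Γ(S, U.1) (Sec U G) := by
    have := G.hom.finitePresentation_appLE U.2 (U.2.preimage G.hom) le_rfl
    rwa [h] at this
  have := finite_sec U G
  have := Module.FinitePresentation.of_finite_of_finitePresentation (R := Γ(S, U.1)) (S := Sec U G)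
  exact Module.Flat.projective_of_finitePresentation

theorem exists_linearMap_of_injective {R M N P : Type*} [CommRing R] [AddCommGroup M]
    [AddCommGroup N] [AddCommGroup P] [Module R M] [Module R N] [Module R P] {f : N →ₗ[R] P}
    (hf : Function.Injective f) (g : M →ₗ[R] P) (h : ∀ m, ∃ n, f n = g m) :
    ∃ b : M →ₗ[R] N, ∀ m, f (b m) = g m :=
  ⟨(LinearEquiv.ofInjective f hf).symm.toLinearMap ∘ₗ g.codRestrict _ h, fun m =>
    congrArg Subtype.val ((LinearEquiv.ofInjective f hf).apply_symm_apply (g.codRestrict _ h m))⟩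

/-! ### Faithfully flat descent of functions -/

section FaithfullyFlat

/-- Apply `B ⟶ B / A` to the second tensor factor: `1` goes to zero, so `1 ⊗ q b = 0`, and faithful
flatness gives `q b = 0`. -/
theorem mem_range_algebraMap_of_tmul_eq {A B : Type*} [CommRing A] [CommRing B] [Algebra A B]
    [Module.FaithfullyFlat A B] {b : B} (hb : b ⊗ₜ[A] (1 : B) = (1 : B) ⊗ₜ[A] b) :
    ∃ a : A, algebraMap A B a = b := by
  let q : B →ₗ[A] B ⧸ LinearMap.range (Algebra.linearMap A B) := Submodule.mkQ _
  have h1 : q 1 = 0 := (Submodule.Quotient.mk_eq_zero _).mpr ⟨1, map_one (algebraMap A B)⟩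
  have h2 : (1 : B) ⊗ₜ[A] q b = 0 := by
    have := congrArg (q.lTensor B) hb
    rw [LinearMap.lTensor_tmul, LinearMap.lTensor_tmul, h1, tmul_zero] at this
    exact this.symm
  have h3 : q b = 0 := (Module.FaithfullyFlat.one_tmul_eq_zero_iff A _ _).mp h2
  obtain ⟨a, ha⟩ := (Submodule.Quotient.mk_eq_zero _).mp h3
  exact ⟨a, ha⟩

variable {S : Scheme.{u}} {U : S.affineOpens}

theorem faithfullyFlat_pull {T Q : Over S} [IsAffineHom T.hom] [IsAffineHom Q.hom] (p : T ⟶ Q)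
    [Flat p.left] [Surjective p.left] : (pull (U := U) p).toRingHom.FaithfullyFlat := by
  have hQ : IsAffineOpen (Q.hom ⁻¹ᵁ U.1) := U.2.preimage Q.hom
  have hT : IsAffineOpen (T.hom ⁻¹ᵁ U.1) := U.2.preimage T.hom
  rw [RingHom.FaithfullyFlat.iff_flat_and_comap_surjective]
  refine ⟨p.left.flat_appLE hQ hT _, fun s => ?_⟩
  obtain ⟨y, hy⟩ := p.left.surjective (hQ.fromSpec s)
  have hy' : y ∈ T.hom ⁻¹ᵁ U.1 := by
    rw [← preimage_preimage_eq p U.1]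
    change p.left y ∈ Q.hom ⁻¹ᵁ U.1
    rw [hy]
    exact hQ.range_fromSpec.le ⟨s, rfl⟩
  obtain ⟨t, rfl⟩ := hT.range_fromSpec.ge hy'
  refine ⟨t, hQ.fromSpec.isOpenEmbedding.injective ?_⟩
  rw [← hy]
  exact congr($(IsAffineOpen.SpecMap_appLE_fromSpec p.left hQ hT
    (preimage_preimage_eq p U.1).ge) t)

theorem injective_pull {T Q : Over S} [IsAffineHom T.hom] [IsAffineHom Q.hom] (p : T ⟶ Q)
    [Flat p.left] [Surjective p.left] : Function.Injective (pull (U := U) p) :=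
  (faithfullyFlat_pull p).injective

theorem pull_whiskerRight_secProdEquiv {X Y T : Over S} [IsAffineHom T.hom] [IsAffineHom X.hom]
    [IsAffineHom Y.hom] (p : Y ⟶ X) (z : Sec U X ⊗[Γ(S, U.1)] Sec U T) :
    pull (p ▷ T) (secProdEquiv X T z) =
      secProdEquiv Y T ((pull p).toLinearMap.rTensor (Sec U T) z) := by
  induction z using TensorProduct.induction_on with
  | zero => simp
  | tmul a b =>
    rw [LinearMap.rTensor_tmul, secProdEquiv_tmul, secProdEquiv_tmul, map_mul, ← pull_comp,
      ← pull_comp, whiskerRight_fst, whiskerRight_snd, pull_comp]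
    rfl
  | add x y hx hy => simp only [map_add, hx, hy]

theorem injective_pull_whiskerRight {X Y T : Over S} [IsAffineHom T.hom] [IsAffineHom X.hom]
    [IsAffineHom Y.hom] {p : Y ⟶ X} (hp : Function.Injective (pull (U := U) p))
    [Module.Flat Γ(S, U.1) (Sec U T)] : Function.Injective (pull (U := U) (p ▷ T)) := by
  have h := Module.Flat.rTensor_preserves_injective_linearMap (M := Sec U T)
    (pull (U := U) p).toLinearMap hp
  intro x y hxy
  obtain ⟨x, rfl⟩ := (secProdEquiv X T).surjective x
  obtain ⟨y, rfl⟩ := (secProdEquiv X T).surjective y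
  rw [pull_whiskerRight_secProdEquiv, pull_whiskerRight_secProdEquiv] at hxy
  rw [h ((secProdEquiv Y T).injective hxy)]

end FaithfullyFlat

/-! ### Integrals on quotients and extensions -/

section

variable {S : Scheme.{u}} {U : S.affineOpens}

/-- `G` has a left integral over `U` whose total mass is not in `p`. -/
def HasLeftIntegral (G : Over S) [GrpObj G] [IsAffineHom G.hom] (p : Ideal Γ(S, U.1)) : Prop :=
  ∃ l : Sec U G →ₗ[Γ(S, U.1)] Γ(S, U.1), IsLeftIntegral l ∧ l 1 ∉ p

/-- The integral pushed forward along `q` has the same mass. Its invariance may be checked after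
pulling back along the faithfully flat `q`, where it becomes that of `l`. -/
theorem HasLeftIntegral.of_isQuotient {G Q : Over S} [GrpObj G] [GrpObj Q] [IsAffineHom G.hom]
    [IsAffineHom Q.hom] {p : Ideal Γ(S, U.1)} {q : G ⟶ Q} (hq : IsQuotient q)
    (h : HasLeftIntegral G p) : HasLeftIntegral Q p := by
  obtain ⟨l, hl, hl1⟩ := h
  have := hq.isMonHom
  have := hq.flat
  have := hq.surjective
  refine ⟨l ∘ₗ (pull q).toLinearMap, fun d => injective_pull q ?_, ?_⟩
  · rw [pull_integ, integ_comp_pull, ← pull_comp, ← pull_comp]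
    have h1 : (q ▷ G ≫ Q ◁ q) ≫ (snd Q Q * fst Q Q) = (snd G G * fst G G) ≫ q := by
      rw [comp_mul, MonObj.mul_comp]
      simp
    rw [h1, pull_comp, hl, map_smul, map_one]
    rfl
  · rwa [LinearMap.comp_apply, AlgHom.toLinearMap_apply, map_one]

section Average

variable {H G T : Over S} [GrpObj G] [GrpObj H] [IsAffineHom G.hom] [IsAffineHom H.hom] 
  [IsAffineHom T.hom] (i : H ⟶ G) (l : Sec U H →ₗ[Γ(S, U.1)] Γ(S, U.1))

/-- The operator `a ↦ (g ↦ ∫ a (g * i h) dh)`. -/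
def average : Sec U G →ₗ[Γ(S, U.1)] Sec U G :=
  integ l G ∘ₗ (pull (snd H G * (fst H G ≫ i))).toLinearMap

theorem average_apply (a : Sec U G) :
    average i l a = integ l G (pull (snd H G * (fst H G ≫ i)) a) := rfl

theorem pull_average (t : T ⟶ G) (a : Sec U G) :
    pull t (average i l a) = integ l T (pull ((snd H T ≫ t) * (fst H T ≫ i)) a) := by
  rw [average_apply, pull_integ, ← pull_comp, comp_mul, whiskerLeft_snd, whiskerLeft_fst_assoc]

variable {l} in
-- Since `∫ a(t n h) dh = ∫ a(t h) dh` by left invariance on `H`, an average is invariant under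
-- right translation by `H`.
theorem pull_mul_average [IsMonHom i] (hl : IsLeftIntegral l) (t : T ⟶ G) (n : T ⟶ H)
    (a : Sec U G) : pull (t * (n ≫ i)) (average i l a) = pull t (average i l a) := by
  rw [pull_average, pull_average, ← hl.integ_translate n (pull ((snd H T ≫ t) * _) a), ← pull_comp]
  refine congrArg (fun t => integ l T (pull t a)) ?_
  rw [comp_mul, comp_mul, translate_snd_assoc, translate_fst_assoc, MonObj.mul_comp,
    _root_.mul_assoc, Category.assoc]

theorem average_one : average i l 1 = l 1 • 1 := by
  rw [average_apply, map_one, ← map_one (pull (fst H G)), integ_fst]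

variable {i l} in
-- Fubini for `G ⟶ Q` with parameters in `T`: integrate over the `H`-translates first, then over
-- `Q`. As pullback along `q ▷ T` is injective, any `F'` whose pullback is the fibrewise average of
-- `F` is the right one.
theorem integ_comp_of_average [Module.Flat Γ(S, U.1) (Sec U T)] {Q : Over S} [IsAffineHom Q.hom]
    {q : G ⟶ Q} (hq : Function.Injective (pull (U := U) q))
    {b : Sec U G →ₗ[Γ(S, U.1)] Sec U Q} (hb : ∀ a, pull q (b a) = average i l a)
    (k : Sec U Q →ₗ[Γ(S, U.1)] Γ(S, U.1)) (F : Sec U (G ⊗ T)) (F' : Sec U (Q ⊗ T))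
    (hF : integ l (G ⊗ T) (pull (lift ((snd H (G ⊗ T) ≫ fst G T) * (fst H (G ⊗ T) ≫ i))
      (snd H (G ⊗ T) ≫ snd G T)) F) = pull (q ▷ T) F') :
    integ (k ∘ₗ b) T F = integ k T F' := by
  obtain ⟨F'', h1, h2⟩ : ∃ F'', integ l (G ⊗ T) (pull (lift ((snd H (G ⊗ T) ≫ fst G T) *
      (fst H (G ⊗ T) ≫ i)) (snd H (G ⊗ T) ≫ snd G T)) F) = pull (q ▷ T) F'' ∧
      integ (k ∘ₗ b) T F = integ k T F'' := by
    clear hF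
    induction F using sec_induction with
    | mul x y =>
      refine ⟨pull (fst Q T) (b x) * pull (snd Q T) y, ?_, ?_⟩
      · rw [map_mul, ← pull_comp, ← pull_comp, lift_fst, lift_snd, pull_comp (snd _ _),
          integ_mul_snd, ← pull_average, ← hb, map_mul, ← pull_comp, ← pull_comp, ← pull_comp,
          whiskerRight_fst, whiskerRight_snd]
      · rw [integ_mul, integ_mul, LinearMap.comp_apply]
    | add x y hx hy =>
      obtain ⟨x', hx1, hx2⟩ := hx
      obtain ⟨y', hy1, hy2⟩ := hy
      refine ⟨x' + y', ?_, ?_⟩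
      · simp only [map_add, hx1, hy1]
      · simp only [map_add, hx2, hy2]
  rw [h2, injective_pull_whiskerRight hq (h1.symm.trans hF)]

theorem isAffineHom_left_of_isAffineHom {Q : Over S} [hQ : IsAffineHom Q.hom] (q : G ⟶ Q) :
    IsAffineHom q.left := by
  have h : IsAffineHom (q.left ≫ Q.hom) := by rw [Over.w]; infer_instance
  exact IsAffineHom.of_comp q.left Q.hom

theorem isAffineHom_hom_of_isPullback {Q K : Over S} {q : G ⟶ Q} [hq : IsAffineHom q.left]
    {q₁ q₂ : K ⟶ G} (h : IsPullback q₁ q₂ q q) : IsAffineHom K.hom := by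
  have h1 : IsAffineHom q₁.left :=
    isAffineHom_isStableUnderBaseChange.of_isPullback (h.map (Over.forget S)).flip hq
  rw [← Over.w q₁]
  infer_instance

/-- The functions on `K` are the tensor square of those on `G` over those on `Q`, so this is descent
of an element along a faithfully flat algebra. -/
theorem eq_pull_of_isPullback {Q K : Over S} [IsAffineHom Q.hom] [IsAffineHom K.hom] {q : G ⟶ Q}
    [Flat q.left] [Surjective q.left] {q₁ q₂ : K ⟶ G} (h : IsPullback q₁ q₂ q q) {a : Sec U G}
    (ha : pull q₁ a = pull q₂ a) : ∃ b : Sec U Q, pull q b = a := by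
  let _ : Algebra (Sec U Q) (Sec U G) := (pull q).toRingHom.toAlgebra
  let _ : Algebra (Sec U Q) (Sec U K) := (pull (q₁ ≫ q)).toRingHom.toAlgebra
  have : Module.FaithfullyFlat (Sec U Q) (Sec U G) := faithfullyFlat_pull q
  let f₁ : Sec U G →ₐ[Sec U Q] Sec U K :=
    { (pull q₁).toRingHom with commutes' := fun r => (pull_comp q₁ q r).symm }
  let f₂ : Sec U G →ₐ[Sec U Q] Sec U K :=
    { (pull q₂).toRingHom with
      commutes' := fun r => (pull_comp q₂ q r).symm.trans (congrArg (fun t => pull t r) h.w.symm) }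
  have h1 : IsPullback q₁.left q₂.left q.left q.left := h.map (Over.forget S)
  have h2 := isIso_pushoutSection_of_isAffineOpen h1
    (US := Q.hom ⁻¹ᵁ U.1) (UX := G.hom ⁻¹ᵁ U.1) (UT := G.hom ⁻¹ᵁ U.1) (UY := K.hom ⁻¹ᵁ U.1)
    (preimage_preimage_eq q _).ge (preimage_preimage_eq q _).ge (by
      rw [preimage_preimage_eq q₁, preimage_preimage_eq q₂, inf_idem])
    (U.2.preimage Q.hom) (U.2.preimage G.hom) (U.2.preimage G.hom)
  rw [isIso_pushoutSection_iff] at h2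
  have h3 : Function.Bijective (Algebra.TensorProduct.productMap f₁ f₂) :=
    bijective_productMap_of_isPushout _ _ h2
  refine mem_range_algebraMap_of_tmul_eq (h3.1 ?_)
  rw [Algebra.TensorProduct.productMap_apply_tmul, Algebra.TensorProduct.productMap_apply_tmul,
    map_one, map_one, _root_.mul_one, _root_.one_mul]
  exact ha

theorem IsExtension.hasLeftIntegral {N Q : Over S} [GrpObj N] [GrpObj Q] [IsFiniteFlat N]
    [IsFiniteFlat G] [IsFiniteFlat Q] [IsAffineHom N.hom] [IsAffineHom Q.hom] {i : N ⟶ G} {q : G ⟶ Q}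
    (h : IsExtension i q) {p : Ideal Γ(S, U.1)} [p.IsPrime]
    (hN : HasLeftIntegral N p) (hQ : HasLeftIntegral Q p) : HasLeftIntegral G p := by
  obtain ⟨l, hl, hl1⟩ := hN
  obtain ⟨k, hk, hk1⟩ := hQ
  have := h.isMonHom
  have := h.isQuotient.isMonHom
  have := h.isQuotient.flat
  have := h.isQuotient.surjective
  have := projective_sec U G
  have hq : Function.Injective (pull (U := U) q) := injective_pull q
  -- Two points of `G` with the same image in `Q` differ by a point of `N` on the right, which the
  -- average does not see; hence it descends to `Q`.
  have h1 (a : Sec U G) : ∃ b : Sec U Q, pull q b = average i l a := by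
    let q₁ := Limits.pullback.fst q q
    let q₂ := Limits.pullback.snd q q
    have hq₁₂ : q₁ ≫ q = q₂ ≫ q := Limits.pullback.condition
    have := isAffineHom_left_of_isAffineHom q
    have := isAffineHom_hom_of_isPullback (IsPullback.of_hasPullback q q)
    have h2 : (q₁⁻¹ * q₂) ≫ q = toUnit _ ≫ η := by
      change _ = 1
      rw [MonObj.mul_comp, GrpObj.inv_comp, hq₁₂, inv_mul_cancel]
    refine eq_pull_of_isPullback (IsPullback.of_hasPullback q q) ?_
    have h3 : q₂ = q₁ * (h.isKernel.lift _ _ h2 ≫ i) := by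
      rw [h.isKernel.lift_fst, mul_inv_cancel_left]
    change pull q₁ _ = pull q₂ _
    rw [h3, pull_mul_average i hl]
  obtain ⟨b, hb⟩ : ∃ b : Sec U G →ₗ[Γ(S, U.1)] Sec U Q, ∀ a, pull q (b a) = average i l a :=
    exists_linearMap_of_injective (f := (pull (U := U) q).toLinearMap) hq _ h1
  refine ⟨k ∘ₗ b, fun d => ?_, ?_⟩
  -- The integrand on `Q × G` is `(z, g) ↦ (b d)(q(g) z)`, to which the left invariance of `k`
  -- applies.
  · rw [integ_comp_of_average hq hb k _ (pull ((snd Q G ≫ q) * fst Q G) (b d)),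
      ← whiskerLeft_snd_mul_fst, pull_comp, ← pull_integ, hk, map_smul, map_one, LinearMap.comp_apply]
    rw [← pull_comp, ← pull_comp, comp_mul, comp_mul, lift_snd, lift_fst, whiskerRight_snd_assoc,
      whiskerRight_fst, ← MonObj.mul_comp, pull_comp, hb, pull_average, comp_mul, _root_.mul_assoc]
  -- The mass of `k ∘ b` is `l 1 * k 1`, which avoids `p` because `p` is prime.
  · have h2 : b 1 = l 1 • 1 := hq (by rw [hb, average_one, map_smul, map_one (pull q)])
    rw [LinearMap.comp_apply, h2, map_smul]
    exact fun h3 => (Ideal.IsPrime.mem_or_mem ‹_› h3).elim hl1 hk1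

end Average

end

/-- By lying over, every prime that contains `J` is the contraction of a prime of `B`, which
contains `J B` and hence `c`. -/
theorem mem_radical_of_mem_map {A B : Type*} [CommRing A] [CommRing B] [Algebra A B]
    [Algebra.IsIntegral A B] (hAB : Function.Injective (algebraMap A B)) {J : Ideal A} {c : A}
    (hc : algebraMap A B c ∈ J.map (algebraMap A B)) : c ∈ J.radical := by
  rw [Ideal.radical_eq_sInf, Submodule.mem_sInf]
  rintro P ⟨hJP, hP⟩
  obtain ⟨Q, -, hQ, hQP⟩ := Ideal.exists_ideal_over_prime_of_isIntegral P (⊥ : Ideal B) (by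
    rw [← RingHom.ker_eq_comap_bot, (RingHom.injective_iff_ker_eq_bot _).mp hAB]
    exact bot_le)
  rw [← hQP, Ideal.mem_comap]
  exact Ideal.map_le_iff_le_comap.mpr (by rwa [hQP]) hc

/-! ### Integrals on subgroup schemes -/

section Subgroup

variable {S : Scheme.{u}} {U : S.affineOpens} {H G T : Over S} [GrpObj G] [GrpObj H]
  [IsAffineHom G.hom] [IsAffineHom H.hom] [IsAffineHom T.hom]

/-- Inversion turns a left invariant functional into a right invariant one. -/
theorem integ_comp_inv (l : Sec U G →ₗ[Γ(S, U.1)] Γ(S, U.1)) (hl : IsLeftIntegral l) (g : T ⟶ G)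
    (F : Sec U (G ⊗ T)) : integ (l ∘ₗ (pull (𝟙 G)⁻¹).toLinearMap) T
      (pull (lift (fst G T * (snd G T ≫ g)) (snd G T)) F) =
      integ (l ∘ₗ (pull (𝟙 G)⁻¹).toLinearMap) T F := by
  rw [integ_comp_pull, integ_comp_pull, ← hl.integ_translate g⁻¹ (pull ((𝟙 G)⁻¹ ▷ T) F),
    ← pull_comp, ← pull_comp]
  refine congrArg (fun t => integ l T (pull t F)) ?_
  apply CartesianMonoidalCategory.hom_ext
  · simp only [Category.assoc, lift_fst, comp_mul, whiskerRight_fst, whiskerRight_snd_assoc,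
      translate_fst, GrpObj.comp_inv, Category.comp_id, mul_inv_rev, inv_inv]
  · simp only [Category.assoc, lift_snd, whiskerRight_snd, translate_snd]

theorem apply_integ (r : Sec U G →ₗ[Γ(S, U.1)] Γ(S, U.1)) (l : Sec U H →ₗ[Γ(S, U.1)] Γ(S, U.1))
    (F : Sec U (H ⊗ G)) :
    r (integ l G F) = l (integ r H (pull (lift (snd G H) (fst G H)) F)) := by
  induction F using sec_induction with
  | mul a b =>
    rw [map_mul (pull _), ← pull_comp, ← pull_comp, lift_fst, lift_snd, integ_mul,
      mul_comm (pull (snd G H) a), integ_mul, map_smul, map_smul, smul_eq_mul, smul_eq_mul, mul_comm]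
  | add x y hx hy => simp only [map_add, hx, hy]

/-- By Fubini, exchange the integral over `H` with the right invariant functional on `G`; the latter
absorbs the translation by `H`, leaving the mass of `k`. -/
theorem apply_average (i : H ⟶ G) (l : Sec U G →ₗ[Γ(S, U.1)] Γ(S, U.1)) (hl : IsLeftIntegral l)
    (k : Sec U H →ₗ[Γ(S, U.1)] Γ(S, U.1)) (a : Sec U G) :
    l (pull (𝟙 G)⁻¹ (average i k a)) = l (pull (𝟙 G)⁻¹ a) * k 1 := by
  have h := integ_comp_inv l hl i (pull (fst G H) a)
  rw [← pull_comp, lift_fst, integ_fst] at h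
  have h1 := apply_integ (l ∘ₗ (pull (𝟙 G)⁻¹).toLinearMap) k (pull (snd H G * (fst H G ≫ i)) a)
  rw [← pull_comp, comp_mul, lift_snd, lift_fst_assoc, h, map_smul] at h1
  exact h1

theorem average_mul {i : H ⟶ G} (k : Sec U H →ₗ[Γ(S, U.1)] Γ(S, U.1)) (a b : Sec U G)
    (hb : pull (snd H G * (fst H G ≫ i)) b = pull (snd H G) b) :
    average i k (a * b) = average i k a * b := by
  rw [average_apply, map_mul, hb, integ_mul_snd, average_apply]

/-- The functions on `G` that are invariant under right translation by `H`. -/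
def rightInvariants (U : S.affineOpens) (i : H ⟶ G) : Subalgebra Γ(S, U.1) (Sec U G) :=
  AlgHom.equalizer (pull (snd H G * (fst H G ≫ i))) (pull (snd H G))

theorem average_mem {i : H ⟶ G} [IsMonHom i] {k : Sec U H →ₗ[Γ(S, U.1)] Γ(S, U.1)}
    (hk : IsLeftIntegral k) (a : Sec U G) : average i k a ∈ rightInvariants U i :=
  pull_mul_average i hk (snd H G) (fst H G) a

/-- The averages of the functions on `G`, as an ideal of the right invariant functions. -/
def averageIdeal (i : H ⟶ G) [IsMonHom i] {k : Sec U H →ₗ[Γ(S, U.1)] Γ(S, U.1)}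
    (_ : IsLeftIntegral k) : Ideal (rightInvariants U i) where
  carrier := {b | ∃ a, average i k a = b}
  zero_mem' := ⟨0, map_zero _⟩
  add_mem' := by
    rintro _ _ ⟨a, ha⟩ ⟨b, hb⟩
    exact ⟨a + b, by rw [map_add, ha, hb]; rfl⟩
  smul_mem' := by
    rintro c b ⟨a, ha⟩
    refine ⟨a * c, ?_⟩
    rw [average_mul k a c c.2, ha, mul_comm]
    rfl

/-- The map `F ↦ (g ↦ ∫ F(g, g h) dh)` sends `a(g) b(g')` to `a` times the average of `b`, so all
its values lie in the extended ideal. -/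
theorem smul_one_mem_map_averageIdeal (i : H ⟶ G) [IsMonHom i]
    {k : Sec U H →ₗ[Γ(S, U.1)] Γ(S, U.1)} (hk : IsLeftIntegral k) (y : Sec U G) :
    k (pull i y) • 1 ∈ (averageIdeal i hk).map (algebraMap (rightInvariants U i) (Sec U G)) := by
  have h (F : Sec U (G ⊗ G)) :
      integ k G (pull (lift (snd H G) (snd H G * (fst H G ≫ i))) F) ∈
        (averageIdeal i hk).map (algebraMap (rightInvariants U i) (Sec U G)) := by
    induction F using sec_induction with
    | mul a b =>
      rw [map_mul, ← pull_comp, ← pull_comp, lift_fst, lift_snd, mul_comm, integ_mul_snd]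
      exact Ideal.mul_mem_right _ _ (Ideal.mem_map_of_mem _
        (show (⟨_, average_mem hk b⟩ : rightInvariants U i) ∈ averageIdeal i hk from ⟨b, rfl⟩))
    | add x y hx hy => rw [map_add, map_add]; exact Ideal.add_mem _ hx hy
  -- For `F(g, g') = y(g⁻¹ g')` the integrand is `y(h)`, so the value is the constant `k (pull i
  -- y)`.
  have h1 := h (pull ((fst G G)⁻¹ * snd G G) y)
  rw [← pull_comp, comp_mul, GrpObj.comp_inv, lift_fst, lift_snd, inv_mul_cancel_left, pull_comp,
    integ_fst] at h1
  exact h1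

/-- A finite monomorphism is a closed immersion. -/
theorem surjective_pull_of_mono (i : H ⟶ G) [Mono i] (hH : IsFinite H.hom) :
    Function.Surjective (pull (U := U) i) := by
  have h1 : IsFinite i.left := by
    have : IsFinite (i.left ≫ G.hom) := by rw [Over.w]; infer_instance
    exact IsFinite.of_comp i.left G.hom
  have h2 : IsClosedImmersion i.left := (IsClosedImmersion.iff_isFinite_and_mono _).mpr
    ⟨h1, inferInstance⟩
  have h3 (W) (h : W = i.left ⁻¹ᵁ (G.hom ⁻¹ᵁ U.1)) : Function.Surjective (i.left.appLE _ W h.le) := by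
    subst h
    rw [Scheme.Hom.appLE_eq_app]
    exact i.left.app_surjective _ (U.2.preimage G.hom)
  exact h3 _ (preimage_preimage_eq i U.1).symm

theorem HasLeftIntegral.of_mono (i : H ⟶ G) [IsMonHom i] [Mono i] [hH : IsFiniteFlat H]
    [IsFiniteFlat G] {p : Ideal Γ(S, U.1)} [hp : p.IsPrime] (h : HasLeftIntegral G p) :
    HasLeftIntegral H p := by
  obtain ⟨l, hl, hl1⟩ := h
  have := finite_sec U H
  have := projective_sec U H
  have := finite_sec U G
  -- Only some value of `k` is known to avoid `p`; the point is to show that its mass does too.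
  obtain ⟨k, y, hk, hy⟩ := exists_isLeftIntegral (G := H) p hp.ne_top
  obtain ⟨y, rfl⟩ := surjective_pull_of_mono i hH.isFinite y
  refine ⟨k, hk, fun hk1 => ?_⟩
  have : Algebra.IsIntegral (rightInvariants U i) (Sec U G) :=
    Algebra.IsIntegral.tower_top Γ(S, U.1)
  have h1 := smul_one_mem_map_averageIdeal i hk y
  -- The functions on `G` are finite over the base, hence integral over the right invariant ones, so
  -- a power of the constant is itself an average.
  obtain ⟨n, a, ha⟩ := mem_radical_of_mem_map (A := rightInvariants U i) (B := Sec U G)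
    Subtype.val_injective (c := k (pull i y) • 1) h1
  have h2 := apply_average i l hl k a
  have h3 : average i k a = k (pull i y) ^ n • 1 := by
    rw [ha, smul_pow, one_pow]; rfl
  rw [h3, map_smul, map_one, map_smul, smul_eq_mul] at h2
  have h4 : k (pull i y) ^ n * l 1 ∈ p := by
    rw [h2]; exact Ideal.mul_mem_left _ _ hk1
  exact (hp.mem_or_mem h4).elim (fun h5 => hy (hp.mem_of_pow_mem n h5)) hl1

end Subgroup

/-! ### Pulled back sheaves: sections over an affine open -/

section ModuleSections

variable {S : Scheme.{u}} (U : S.affineOpens) (T : Over S) (F : S.Modules)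

/-- Sections over the preimage of `U` of the pullback of a sheaf to a scheme over `S`. -/
def MSec : Type u := Γ((Scheme.Modules.pullback T.hom).obj F, T.hom ⁻¹ᵁ U.1)

instance : AddCommGroup (MSec U T F) :=
  inferInstanceAs (AddCommGroup Γ((Scheme.Modules.pullback T.hom).obj F, T.hom ⁻¹ᵁ U.1))

instance : Module (Sec U T) (MSec U T F) :=
  inferInstanceAs (Module Γ(T.left, T.hom ⁻¹ᵁ U.1)
    Γ((Scheme.Modules.pullback T.hom).obj F, T.hom ⁻¹ᵁ U.1))

instance : Module Γ(S, U.1) (MSec U T F) := Module.compHom _ (algebraMap Γ(S, U.1) (Sec U T))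

instance : IsScalarTower Γ(S, U.1) (Sec U T) (MSec U T F) := .of_algebraMap_smul fun _ _ => rfl

/-- Pullback of sections of `F` to a scheme over `S`. -/
def unit₀ : Γ(F, U.1) →ₗ[Γ(S, U.1)] MSec U T F where
  toFun := pb T.hom F U.1
  map_add' := map_add _
  map_smul' := pb_smul T.hom F U.1

variable {U T F}

theorem isSBC_unit₀ [F.IsQuasicoherent] [IsAffineHom T.hom] :
    IsSBC (algebraMap Γ(S, U.1) (Sec U T)) (unit₀ U T F).toAddMonoidHom := by
  have h := isSBC_pbLE T.hom F U.2 (U.2.preimage T.hom) le_rfl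
  rw [Scheme.Hom.appLE_eq_app] at h
  have e : (pbLE T.hom F U.1 (T.hom ⁻¹ᵁ U.1) le_rfl).hom = (unit₀ U T F).toAddMonoidHom :=
    AddMonoidHom.ext (pbLE_preimage T.hom F U.1)
  rw [e] at h
  exact h

/-- Over an affine open the sections of the pullback are `Sec U T ⊗ Γ(F, U)`, so sums of multiples
of pulled back sections exhaust them. -/
theorem msec_induction [F.IsQuasicoherent] [IsAffineHom T.hom] {p : MSec U T F → Prop}
    (z : MSec U T F) (smul : ∀ (d : Sec U T) m, p (d • unit₀ U T F m)) (add : ∀ x y, p x → p y → p (x + y)) :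
    p z := by
  obtain ⟨e, he⟩ := (isSBC_unit₀ (U := U) (T := T) (F := F)).exists_linearEquiv
  obtain ⟨z, rfl⟩ := e.surjective z
  induction z using TensorProduct.induction_on with
  | zero => simpa using smul 0 0
  | tmul a b => rw [he]; exact smul a b
  | add x y hx hy => rw [map_add]; exact add _ _ hx hy

theorem exists_mintegrate [F.IsQuasicoherent] [IsAffineHom T.hom] {A N : Type*} [AddCommGroup A]
    [Module Γ(S, U.1) A] [AddCommGroup N] [Module Γ(S, U.1) N]
    (f : Sec U T →ₗ[Γ(S, U.1)] Γ(F, U.1) →ₗ[Γ(S, U.1)] N) :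
    ∃ L : MSec U T F →+ N, ∀ d m, L (d • unit₀ U T F m) = f d m := by
  obtain ⟨e, he⟩ := (isSBC_unit₀ (U := U) (T := T) (F := F)).exists_linearEquiv
  refine ⟨(TensorProduct.lift f).toAddMonoidHom.comp e.symm.toLinearMap.toAddMonoidHom,
    fun d m => ?_⟩
  change TensorProduct.lift f (e.symm (d • (unit₀ U T F).toAddMonoidHom m)) = _
  rw [← he, LinearEquiv.symm_apply_apply, TensorProduct.lift.tmul]

theorem exists_integrate [F.IsQuasicoherent] [IsAffineHom T.hom]
    (l : Sec U T →ₗ[Γ(S, U.1)] Γ(S, U.1)) :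
    ∃ L : MSec U T F →+ Γ(F, U.1), ∀ d m, L (d • unit₀ U T F m) = l d • m :=
  exists_mintegrate (A := Γ(F, U.1)) ((LinearMap.lsmul Γ(S, U.1) Γ(F, U.1)).comp l)

theorem exists_integrate_prod {T' : Over S} [F.IsQuasicoherent] [IsAffineHom T.hom]
    (l : Sec U T →ₗ[Γ(S, U.1)] Sec U T') :
    ∃ L : MSec U T F →+ MSec U T' F, ∀ d m, L (d • unit₀ U T F m) = l d • unit₀ U T' F m :=
  exists_mintegrate (A := Γ(F, U.1))
    (((LinearMap.lsmul (Sec U T') (MSec U T' F)).restrictScalars₁₂ Γ(S, U.1) Γ(S, U.1)).compl₁₂ l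
      (unit₀ U T' F))

variable {T' : Over S}

/-- Pullback of sections along a morphism over `S`. -/
def mpull (g : T ⟶ T') : MSec U T' F →+ MSec U T F :=
  (((Scheme.Modules.pullback T.hom).obj F).presheaf.map
    (homOfLE (preimage_preimage_eq g U.1).ge).op).hom.comp (pbTr g F (T'.hom ⁻¹ᵁ U.1))

theorem mpull_smul (g : T ⟶ T') (d : Sec U T') (z : MSec U T' F) :
    mpull g (d • z) = pull g d • mpull g z := by
  exact (congrArg _ (pbTr_smul g F _ d z)).trans (Scheme.Modules.map_smul _ _ _ _)

theorem mpull_unit₀ (g : T ⟶ T') (m : Γ(F, U.1)) : mpull g (unit₀ U T' F m) = unit₀ U T F m := by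
  have h := pbTr_pbLE g F U.1 (T'.hom ⁻¹ᵁ U.1) le_rfl m
  rw [pbLE_preimage] at h
  refine (congrArg _ h).trans ((map_pbLE _ _ _ _ _ _).trans (pbLE_preimage _ _ _ _))

/-- The action of an automorphism on sections. -/
def mact (φ : (Scheme.Modules.pullback T.hom).obj F ≅ (Scheme.Modules.pullback T.hom).obj F) :
    MSec U T F →ₗ[Sec U T] MSec U T F := appLin φ.hom _

theorem mact_apply (φ : (Scheme.Modules.pullback T.hom).obj F ≅ (Scheme.Modules.pullback T.hom).obj F)
    (z : MSec U T F) : mact φ z = φ.hom.app (T.hom ⁻¹ᵁ U.1) z := rfl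

theorem mpull_apply (g : T ⟶ T') (z : MSec U T' F) :
    mpull g z = ((Scheme.Modules.pullback T.hom).obj F).presheaf.map
      (homOfLE (preimage_preimage_eq g U.1).ge).op (pbTr g F (T'.hom ⁻¹ᵁ U.1) z) := rfl

theorem mact_pullbackAct
    (φ : (Scheme.Modules.pullback T'.hom).obj F ≅ (Scheme.Modules.pullback T'.hom).obj F)
    (g : T ⟶ T') (z : MSec U T' F) :
    mact (pullbackAct φ g) (mpull g z) = mpull g (mact φ z) := by
  have h (W) (i : W ⟶ g.left ⁻¹ᵁ T'.hom ⁻¹ᵁ U.1)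
      (z : Γ((Scheme.Modules.pullback T'.hom).obj F, T'.hom ⁻¹ᵁ U.1)) :
      (pullbackAct φ g).hom.app W (((Scheme.Modules.pullback T.hom).obj F).presheaf.map i.op
        (pbTr g F (T'.hom ⁻¹ᵁ U.1) z)) = ((Scheme.Modules.pullback T.hom).obj F).presheaf.map i.op
          (pbTr g F (T'.hom ⁻¹ᵁ U.1) (φ.hom.app _ z)) := by
    rw [app_presheaf_map, pullbackAct_pbTr]
  rw [mact_apply, mpull_apply, mpull_apply, mact_apply]
  exact h _ _ z

variable (U T) in
/-- The map induced on sections of pullbacks by a morphism of sheaves. -/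
def mmap {F' : S.Modules} (f : F ⟶ F') : MSec U T F →ₗ[Sec U T] MSec U T F' :=
  appLin ((Scheme.Modules.pullback T.hom).map f) _

theorem mmap_unit₀ {F' : S.Modules} (f : F ⟶ F') (m : Γ(F, U.1)) :
    mmap U T f (unit₀ U T F m) = unit₀ U T F' (f.app U.1 m) :=
  map_app_pb T.hom f U.1 m

end ModuleSections

/-! ### The averaging operator on an equivariant sheaf -/

section Reynolds

variable {S : Scheme.{u}} {U : S.affineOpens} {G : Over S} [GrpObj G] [IsAffineHom G.hom]

theorem integ_swap_mul_snd (l : Sec U G →ₗ[Γ(S, U.1)] Γ(S, U.1)) (a b : Sec U G) :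
    integ l G (pull (lift (snd G G) (fst G G)) (pull (snd G G) b * pull (fst G G) a)) = l b • a := by
  rw [map_mul (pull _), ← pull_comp, ← pull_comp, lift_fst, lift_snd, integ_mul]

theorem IsLeftIntegral.integ_swap_mul {l : Sec U G →ₗ[Γ(S, U.1)] Γ(S, U.1)} (hl : IsLeftIntegral l)
    (d : Sec U G) : integ l G (pull (lift (snd G G) (fst G G)) (pull μ[G] d)) = l d • 1 := by
  have h : lift (snd G G) (fst G G) ≫ μ[G] = snd G G * fst G G := rfl
  rw [← pull_comp, h, hl]

theorem mact_iso_trans {T : Over S} {F : S.Modules}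
    (φ ψ : (Scheme.Modules.pullback T.hom).obj F ≅ (Scheme.Modules.pullback T.hom).obj F)
    (z : MSec U T F) : mact (φ ≪≫ ψ) z = mact ψ (mact φ z) := rfl

theorem algebraMap_smul_msec {T : Over S} {F : S.Modules} (r : Γ(S, U.1)) (z : MSec U T F) :
    (r • (1 : Sec U T)) • z = r • z := by
  rw [← Algebra.algebraMap_eq_smul_one]; rfl

/-- Integrating the coaction along a left integral gives invariant sections. -/
theorem mact_unit₀_integrate (F : QCohEquiv G) {l : Sec U G →ₗ[Γ(S, U.1)] Γ(S, U.1)}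
    (hl : IsLeftIntegral l) {L : MSec U G F.sheaf →+ Γ(F.sheaf, U.1)}
    (hL : ∀ d m, L (d • unit₀ U G F.sheaf m) = l d • m) (t : Γ(F.sheaf, U.1)) :
    mact F.act (unit₀ U G F.sheaf (L (mact F.act (unit₀ U G F.sheaf t)))) =
      unit₀ U G F.sheaf (L (mact F.act (unit₀ U G F.sheaf t))) := by
  have := F.isQuasicoherent
  -- `L'` integrates over the second factor of `G × G`; `integ` runs over the first, whence the
  -- swap.
  obtain ⟨L', hL'⟩ := exists_integrate_prod (U := U) (T := G ⊗ G) (T' := G) (F := F.sheaf)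
    (integ l G ∘ₗ (pull (lift (snd G G) (fst G G))).toLinearMap)
  simp only [LinearMap.comp_apply, AlgHom.toLinearMap_apply] at hL'
  have h1 (z : MSec U G F.sheaf) : L' (mpull μ[G] z) = unit₀ U G F.sheaf (L z) := by
    induction z using msec_induction with
    | smul d m =>
      rw [mpull_smul, mpull_unit₀, hL', hl.integ_swap_mul, hL, map_smul, algebraMap_smul_msec]
    | add x y hx hy => simp only [map_add, hx, hy]
  have h2 (d : Sec U G) (w : MSec U G F.sheaf) :
      L' (pull (snd G G) d • mpull (fst G G) w) = l d • w := by
    induction w using msec_induction with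
    | smul a m =>
      rw [mpull_smul, mpull_unit₀, smul_smul, hL', integ_swap_mul_snd, smul_assoc]
    | add x y hx hy => simp only [map_add, smul_add, hx, hy]
  have h3 (z : MSec U G F.sheaf) : L' (mact (pullbackAct F.act (fst G G)) (mpull (snd G G) z)) =
      mact F.act (unit₀ U G F.sheaf (L z)) := by
    induction z using msec_induction with
    | smul d m =>
      rw [mpull_smul, mpull_unit₀, ← mpull_unit₀ (fst G G), map_smul, mact_pullbackAct, h2, hL,
        map_smul, ← algebraMap_smul_msec, ← algebraMap_smul_msec, map_smul]
    | add x y hx hy => simp only [map_add, hx, hy]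
  -- The computation is `g ∫ h t dh = ∫ (g h) t dh = ∫ h t dh`: the cocycle condition gives the
  -- first equality and left invariance, in the form `h1`, the second.
  rw [← h3, ← h1, ← mact_pullbackAct, ← mact_pullbackAct, F.act_mul, mact_iso_trans, mpull_unit₀,
    mpull_unit₀]

theorem map_integrate {F F' : S.Modules} [F.IsQuasicoherent] (f : F ⟶ F')
    {l : Sec U G →ₗ[Γ(S, U.1)] Γ(S, U.1)} {L : MSec U G F →+ Γ(F, U.1)}
    (hL : ∀ d m, L (d • unit₀ U G F m) = l d • m) {L' : MSec U G F' →+ Γ(F', U.1)}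
    (hL' : ∀ d m, L' (d • unit₀ U G F' m) = l d • m) (z : MSec U G F) :
    f.app U.1 (L z) = L' (mmap U G f z) := by
  induction z using msec_induction with
  | smul d m =>
    rw [map_smul (mmap U G f), mmap_unit₀, hL, hL', Scheme.Modules.Hom.app_smul]
  | add x y hx hy => rw [map_add, map_add, map_add, map_add, hx, hy]

end Reynolds

/-! ### Integrals of nonvanishing mass give exactness -/

section Exactness

variable {S : Scheme.{u}}

/-- The inclusion of the invariant subsheaf. -/
def invariantsι {G : Over S} [GrpObj G] (F : QCohEquiv G) :
    (QCohEquiv.invariants G).obj F ⟶ F.sheaf := kernel.ι (F.coaction - F.trivialCoaction)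

instance {G : Over S} [GrpObj G] (F : QCohEquiv G) : Mono (invariantsι F) :=
  inferInstanceAs (Mono (kernel.ι (F.coaction - F.trivialCoaction)))

theorem invariantsι_condition {G : Over S} [GrpObj G] (F : QCohEquiv G) :
    invariantsι F ≫ (F.coaction - F.trivialCoaction) = 0 := kernel.condition _

theorem invariants_map_ι {G : Over S} [GrpObj G] {F F' : QCohEquiv G} (f : F ⟶ F') :
    (QCohEquiv.invariants G).map f ≫ invariantsι F' = invariantsι F ≫ f.hom := kernel.lift_ι _ _ _

theorem exists_lift_invariantsι {G : Over S} [GrpObj G] {F : QCohEquiv G} {A : S.Modules}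
    (a : A ⟶ F.sheaf) (ha : a ≫ (F.coaction - F.trivialCoaction) = 0) :
    ∃ b : A ⟶ (QCohEquiv.invariants G).obj F, b ≫ invariantsι F = a :=
  ⟨kernel.lift _ a ha, kernel.lift_ι _ _ _⟩

theorem exists_invariantsι_app_eq {G : Over S} [GrpObj G] {F : QCohEquiv G} (U : S.Opens)
    (t : Γ(F.sheaf, U)) (ht : (F.coaction - F.trivialCoaction).app U t = 0) :
    ∃ k : Γ((QCohEquiv.invariants G).obj F, U), (invariantsι F).app U k = t :=
  exists_kernel_ι_app_eq _ U t ht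

/-- The prime ideal of functions that vanish at a point. -/
def vanishingIdeal {U : S.Opens} {x : S} (hx : x ∈ U) : Ideal Γ(S, U) :=
  RingHom.ker (S.evaluation U x hx).hom

instance {U : S.Opens} {x : S} (hx : x ∈ U) : (vanishingIdeal hx).IsPrime := RingHom.ker_isPrime _

theorem notMem_vanishingIdeal {U : S.Opens} {x : S} (hx : x ∈ U) (r : Γ(S, U)) :
    r ∉ vanishingIdeal hx ↔ x ∈ S.basicOpen r := S.evaluation_ne_zero_iff_mem_basicOpen x hx r

theorem coaction_sub_app {G : Over S} [GrpObj G] (F : QCohEquiv G) (U : S.affineOpens)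
    (t : Γ(F.sheaf, U.1)) (h : mact F.act (unit₀ U G F.sheaf t) = unit₀ U G F.sheaf t) :
    (F.coaction - F.trivialCoaction).app U.1 t = 0 :=
  sub_eq_zero.mpr h

theorem mact_unit₀_of_coaction_sub_app {G : Over S} [GrpObj G] (F : QCohEquiv G)
    (U : S.affineOpens) (t : Γ(F.sheaf, U.1)) (h : (F.coaction - F.trivialCoaction).app U.1 t = 0) :
    mact F.act (unit₀ U G F.sheaf t) = unit₀ U G F.sheaf t :=
  sub_eq_zero.mp h

theorem mmap_mact {G : Over S} [GrpObj G] {F F' : QCohEquiv G} (f : F ⟶ F') (U : S.affineOpens)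
    (z : MSec U G F.sheaf) : mmap U G f.hom (mact F.act z) = mact F'.act (mmap U G f.hom z) :=
  congr(($(f.comm)).app (G.hom ⁻¹ᵁ U.1) z).symm

/-- Average the lift `t`. Averaging commutes with `f` and multiplies the invariant section `f t` by
the mass of `l`. -/
theorem exists_invariant_lift {G : Over S} [GrpObj G] [IsAffineHom G.hom] {F F' : QCohEquiv G}
    (f : F ⟶ F') {U : S.affineOpens} {l : Sec U G →ₗ[Γ(S, U.1)] Γ(S, U.1)}
    (hl : IsLeftIntegral l) (t : Γ(F.sheaf, U.1))
    (ht : (F'.coaction - F'.trivialCoaction).app U.1 (f.hom.app U.1 t) = 0) :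
    ∃ t', (F.coaction - F.trivialCoaction).app U.1 t' = 0 ∧
      f.hom.app U.1 t' = l 1 • f.hom.app U.1 t := by
  have := F.isQuasicoherent
  have := F'.isQuasicoherent
  obtain ⟨L, hL⟩ := exists_integrate (F := F.sheaf) l
  obtain ⟨L', hL'⟩ := exists_integrate (F := F'.sheaf) l
  refine ⟨L (mact F.act (unit₀ U G F.sheaf t)),
    coaction_sub_app F U _ (mact_unit₀_integrate F hl hL t), ?_⟩
  rw [map_integrate f.hom hL hL', mmap_mact, mmap_unit₀, mact_unit₀_of_coaction_sub_app F' U _ ht,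
    ← hL', one_smul]

theorem epi_invariants_map {G : Over S} [GrpObj G] [IsAffineHom G.hom]
    (h : ∀ (U : S.affineOpens) (x : S) (hx : x ∈ U.1), HasLeftIntegral G (vanishingIdeal hx))
    {F F' : QCohEquiv G} (f : F ⟶ F') [Epi f.hom] : Epi ((QCohEquiv.invariants G).map f) := by
  apply LocallySurjective.epi
  intro W s x hxW
  obtain ⟨V, i, t, hxV, ht⟩ := locallySurjective_of_epi f.hom W ((invariantsι F').app W s) x hxW
  obtain ⟨U, hU, hxU, hUV⟩ := Opens.isBasis_iff_nbhd.mp S.isBasis_affineOpens hxV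
  let j : U ⟶ V := homOfLE hUV
  obtain ⟨l, hl, hl1⟩ := h ⟨U, hU⟩ x hxU
  rw [notMem_vanishingIdeal] at hl1
  have ht' : f.hom.app U (F.sheaf.presheaf.map j.op t) = (invariantsι F').app U
      (((QCohEquiv.invariants G).obj F').presheaf.map (j ≫ i).op s) := by
    rw [app_presheaf_map, ht, app_presheaf_map, op_comp, Functor.map_comp_apply]
  obtain ⟨t', h1, h2⟩ := exists_invariant_lift f hl (F.sheaf.presheaf.map j.op t) (by
    rw [ht']
    exact congr(($(invariantsι_condition F')).app U _))
  let D := S.basicOpen (l 1)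
  let d : D ⟶ U := homOfLE (S.basicOpen_le _)
  -- On the basic open of `l 1`, a neighbourhood of `x`, the mass can be divided out.
  obtain ⟨c, hc⟩ : ∃ c : Γ(S, D), c * S.presheaf.map d.op (l 1) = 1 :=
    (S.toRingedSpace.isUnit_res_basicOpen (l 1)).exists_left_inv
  obtain ⟨k, hk⟩ := exists_invariantsι_app_eq (F := F) D (c • F.sheaf.presheaf.map d.op t') (by
      rw [Scheme.Modules.Hom.app_smul, app_presheaf_map, h1, map_zero, smul_zero])
  refine ⟨D, d ≫ j ≫ i, k, hl1, ?_⟩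
  apply injective_of_mono (invariantsι F') D
  refine (congr(($(invariants_map_ι f)).app D k)).trans ?_
  refine (congrArg (f.hom.app D) hk).trans ?_
  rw [Scheme.Modules.Hom.app_smul, app_presheaf_map, h2, ht', Scheme.Modules.map_smul, smul_smul,
    hc, one_smul, ← app_presheaf_map, ← Functor.map_comp_apply, ← op_comp]

/-- Left exactness: lift as a map of sheaves and test invariance in `F'`. This is legitimate because
`π_* π^*` preserves the monomorphism `f`, by flatness of `G`. -/
theorem exists_lift_invariants_map {G : Over S} [GrpObj G] [Flat G.hom] {F F' F'' : QCohEquiv G}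
    (f : F ⟶ F') (g : F' ⟶ F'') [Mono f.hom] {A : S.Modules}
    (hfg : ∀ k : A ⟶ F'.sheaf, k ≫ g.hom = 0 → ∃ a, a ≫ f.hom = k)
    (k : A ⟶ (QCohEquiv.invariants G).obj F') (hk : k ≫ (QCohEquiv.invariants G).map g = 0) :
    ∃ a, a ≫ (QCohEquiv.invariants G).map f = k := by
  have := F.isQuasicoherent
  have := F'.isQuasicoherent
  obtain ⟨a, ha⟩ := hfg (k ≫ invariantsι F') (by
    rw [Category.assoc, ← invariants_map_ι, ← Category.assoc, hk, zero_comp])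
  have : Mono ((Scheme.Modules.pullback G.hom).map f.hom) := mono_pullback_map G.hom f.hom
  obtain ⟨b, hb⟩ := exists_lift_invariantsι a (by
    rw [← cancel_mono ((Scheme.Modules.pushforward G.hom).map
      ((Scheme.Modules.pullback G.hom).map f.hom)), Category.assoc,
      QCohEquiv.hom_coaction_sub, ← Category.assoc, ha, Category.assoc, invariantsι_condition,
      comp_zero, zero_comp])
  refine ⟨b, ?_⟩
  rw [← cancel_mono (invariantsι F'), Category.assoc, invariants_map_ι, ← Category.assoc, hb, ha]

theorem mono_invariants_map {G : Over S} [GrpObj G] {F F' : QCohEquiv G} (f : F ⟶ F')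
    [Mono f.hom] : Mono ((QCohEquiv.invariants G).map f) := by
  have : Mono ((QCohEquiv.invariants G).map f ≫ invariantsι F') := by
    rw [invariants_map_ι]; exact mono_comp _ _
  exact mono_of_mono _ (invariantsι F')

theorem isLinearlyReductive_of_hasLeftIntegral {G : Over S} [GrpObj G] [IsAffineHom G.hom]
    [Flat G.hom] (h : ∀ (U : S.affineOpens) (x : S) (hx : x ∈ U.1),
      HasLeftIntegral G (vanishingIdeal hx)) : IsLinearlyReductive G := by
  intro C hC
  have hf : Mono C.f.hom := hC.mono_f
  have hf' : Mono (C.map (QCohEquiv.forget G)).f := hC.mono_f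
  have hg : Epi C.g.hom := hC.epi_g
  have hmono : Mono (C.map (QCohEquiv.invariants G)).f := mono_invariants_map C.f
  refine { exact := ?_, mono_f := hmono, epi_g := epi_invariants_map h C.g }
  refine ShortComplex.exact_of_f_is_kernel _ (KernelFork.IsLimit.ofι' _ _ fun {A} k hk => ?_)
  have := exists_lift_invariants_map C.f C.g (fun k hk =>
    ⟨hC.exact.lift k hk, hC.exact.lift_f k hk⟩) k hk
  exact ⟨this.choose, this.choose_spec⟩

end Exactness

/-! ### Morphisms of sheaves from maps on sections -/

section HomOfSections

variable {X : Scheme.{u}}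

/-- A morphism of sheaves of modules from its maps on sections. -/
def homOfSections {F F' : X.Modules} (a : ∀ V : X.Opens, Γ(F, V) →ₗ[Γ(X, V)] Γ(F', V))
    (ha : ∀ (V W : X.Opens) (i : V ⟶ W) (m : Γ(F, W)),
      a V (F.presheaf.map i.op m) = F'.presheaf.map i.op (a W m)) : F ⟶ F' :=
  (Scheme.Modules.fullyFaithfulToPresheafOfModules).preimage
    (PresheafOfModules.homMk { app := fun V => AddCommGrpCat.ofHom (a V.unop).toAddMonoidHom
                               naturality := fun V W i => by
                                 ext m
                                 exact ha W.unop V.unop i.unop m }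
      fun V r m => (a V.unop).map_smul r m)

end HomOfSections

theorem isSBC_of_isPushout {R A B C : CommRingCat.{u}} {f : R ⟶ A} {g : R ⟶ B} {f' : A ⟶ C}
    {g' : B ⟶ C} (h : IsPushout f g f' g') {M N : Type*} [AddCommGroup M] [Module R M]
    [AddCommGroup N] [Module A N] (eM : M ≃+ B) (eN : N ≃+ C)
    (hM : ∀ (r : R) (m : M), eM (r • m) = g r * eM m)
    (hN : ∀ (a : A) (n : N), eN (a • n) = f' a * eN n) {u : M →+ N}
    (hu : ∀ m, eN (u m) = g' (eM m)) : IsSBC f.hom u := by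
  letI := f.hom.toAlgebra
  letI := g.hom.toAlgebra
  letI := (f ≫ f').hom.toAlgebra
  letI := f'.hom.toAlgebra
  haveI : IsScalarTower R A C := .of_algebraMap_eq fun _ => rfl
  let f₁ : A →ₐ[R] C := { f'.hom with commutes' := fun _ => rfl }
  let g₁ : B →ₐ[R] C := { g'.hom with commutes' := fun r => congr($h.w r).symm }
  have hb := bijective_productMap_of_isPushout f₁ g₁ h
  let e : A ⊗[R] B ≃ₗ[A] C := LinearEquiv.ofBijective
    { toFun := Algebra.TensorProduct.productMap f₁ g₁
      map_add' := map_add _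
      map_smul' := fun a z => by
        change Algebra.TensorProduct.productMap f₁ g₁ (a • z) =
          f' a * Algebra.TensorProduct.productMap f₁ g₁ z
        induction z using TensorProduct.induction_on with
        | zero => simp
        | tmul x y =>
          rw [TensorProduct.smul_tmul', Algebra.TensorProduct.productMap_apply_tmul,
            Algebra.TensorProduct.productMap_apply_tmul, smul_eq_mul, map_mul, _root_.mul_assoc]
          rfl
        | add x y hx hy => rw [smul_add, map_add, map_add, hx, hy, mul_add] } hb
  let eM' : M ≃ₗ[R] B := { eM with map_smul' := hM }
  let eN' : N ≃ₗ[A] C := { eN with map_smul' := hN }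
  have h1 : IsSBC (algebraMap R A) (g'.hom : B →+ C) := IsSBC.of_linearEquiv e fun m => by
    change Algebra.TensorProduct.productMap f₁ g₁ (1 ⊗ₜ m) = _
    rw [Algebra.TensorProduct.productMap_apply_tmul, map_one, _root_.one_mul]
    rfl
  refine (h1.equiv_comp eM' (v := (g'.hom : B →+ C).comp eM.toAddMonoidHom)
    fun m => rfl).comp_equiv eN'.symm fun m => ?_
  rw [LinearEquiv.eq_symm_apply]
  exact hu m

/-! ### Pushforward of structure sheaves and affine base change -/

section PushO

variable {S : Scheme.{u}}

/-- The pushforward of the structure sheaf of a scheme over `S`. -/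
def pushO (X : Over S) : S.Modules :=
  (Scheme.Modules.pushforward X.hom).obj (structureModule X.left)

theorem isQuasicoherent_pushO (X : Over S) [IsAffineHom X.hom] : (pushO X).IsQuasicoherent :=
  isQuasicoherent_pushforward X.hom

/-- Sections of the pushforward of the structure sheaf. -/
def secO (X : Over S) (V : S.Opens) : Γ(pushO X, V) ≃+ Γ(X.left, X.hom ⁻¹ᵁ V) := AddEquiv.refl _

theorem secO_smul (X : Over S) (V : S.Opens) (r : Γ(S, V)) (m : Γ(pushO X, V)) :
    secO X V (r • m) = X.hom.app V r * secO X V m := rfl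

theorem secO_map (X : Over S) {V W : S.Opens} (i : V ⟶ W) (m : Γ(pushO X, W)) :
    secO X V ((pushO X).presheaf.map i.op m) =
      X.left.presheaf.map ((Opens.map X.hom.base).map i).op (secO X W m) := rfl

variable (X T : Over S)

theorem snd_preimage_le (V : S.Opens) :
    (snd X T).left ⁻¹ᵁ T.hom ⁻¹ᵁ V ≤ (fst X T).left ⁻¹ᵁ X.hom ⁻¹ᵁ V :=
  (preimage_preimage_eq (snd X T) V).le.trans (preimage_preimage_eq (fst X T) V).ge

/-- The pushforward of the structure sheaf of `X ⊗ T` to `T`. -/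
abbrev pushSnd : T.left.Modules :=
  (Scheme.Modules.pushforward (snd X T).left).obj (structureModule (X ⊗ T).left)

def secSnd (W : T.left.Opens) : Γ(pushSnd X T, W) ≃+ Γ((X ⊗ T).left, (snd X T).left ⁻¹ᵁ W) :=
  AddEquiv.refl _

theorem secSnd_smul (W : T.left.Opens) (r : Γ(T.left, W)) (m : Γ(pushSnd X T, W)) :
    secSnd X T W (r • m) = (snd X T).left.app W r * secSnd X T W m := rfl

theorem secSnd_map {V W : T.left.Opens} (i : V ⟶ W) (m : Γ(pushSnd X T, W)) :
    secSnd X T V ((pushSnd X T).presheaf.map i.op m) =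
      (X ⊗ T).left.presheaf.map ((Opens.map (snd X T).left.base).map i).op (secSnd X T W m) := rfl

theorem appLE_fst_app (V : S.Opens) (r : Γ(S, V)) :
    (fst X T).left.appLE (X.hom ⁻¹ᵁ V) ((snd X T).left ⁻¹ᵁ T.hom ⁻¹ᵁ V) (snd_preimage_le X T V)
      (X.hom.app V r) = (snd X T).left.app (T.hom ⁻¹ᵁ V) (T.hom.app V r) := by
  have h := (isPullback_fst_snd_left X T).w
  have h1 := Scheme.Hom.appLE_comp_appLE (fst X T).left X.hom V (X.hom ⁻¹ᵁ V)
    ((snd X T).left ⁻¹ᵁ T.hom ⁻¹ᵁ V) le_rfl (snd_preimage_le X T V)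
  have h2 := Scheme.Hom.appLE_comp_appLE (snd X T).left T.hom V (T.hom ⁻¹ᵁ V)
    ((snd X T).left ⁻¹ᵁ T.hom ⁻¹ᵁ V) le_rfl le_rfl
  have h3 := (h1.trans (appLE_eq_of_eq h V _ _ _)).trans h2.symm
  rw [Scheme.Hom.appLE_eq_app, Scheme.Hom.appLE_eq_app, Scheme.Hom.appLE_eq_app] at h3
  exact congr($h3 r)

/-- Pullback of functions on `X` to `X ⊗ T`. -/
def fstO (V : S.Opens) : Γ(pushO X, V) →+ Γ(pushSnd X T, T.hom ⁻¹ᵁ V) :=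
  (secSnd X T (T.hom ⁻¹ᵁ V)).symm.toAddMonoidHom.comp
    (((fst X T).left.appLE (X.hom ⁻¹ᵁ V) ((snd X T).left ⁻¹ᵁ T.hom ⁻¹ᵁ V)
      (snd_preimage_le X T V)).hom.toAddMonoidHom.comp (secO X V).toAddMonoidHom)

theorem secSnd_fstO (V : S.Opens) (m : Γ(pushO X, V)) :
    secSnd X T (T.hom ⁻¹ᵁ V) (fstO X T V m) = (fst X T).left.appLE (X.hom ⁻¹ᵁ V)
      ((snd X T).left ⁻¹ᵁ T.hom ⁻¹ᵁ V) (snd_preimage_le X T V) (secO X V m) := rfl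

theorem fstO_map {V W : S.Opens} (i : V ⟶ W) (m : Γ(pushO X, W)) :
    fstO X T V ((pushO X).presheaf.map i.op m) =
      (pushSnd X T).presheaf.map ((Opens.map T.hom.base).map i).op (fstO X T W m) := by
  have h : X.left.presheaf.map ((Opens.map X.hom.base).map i).op ≫
      (fst X T).left.appLE (X.hom ⁻¹ᵁ V) ((snd X T).left ⁻¹ᵁ T.hom ⁻¹ᵁ V) (snd_preimage_le X T V) =
      (fst X T).left.appLE (X.hom ⁻¹ᵁ W) ((snd X T).left ⁻¹ᵁ T.hom ⁻¹ᵁ W) (snd_preimage_le X T W) ≫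
        (X ⊗ T).left.presheaf.map ((Opens.map (snd X T).left.base).map
          ((Opens.map T.hom.base).map i)).op := by
    rw [Scheme.Hom.map_appLE, Scheme.Hom.appLE_map]
  apply (secSnd X T (T.hom ⁻¹ᵁ V)).injective
  rw [secSnd_map, secSnd_fstO, secSnd_fstO, secO_map]
  exact congr($h (secO X W m))

theorem fstO_smul (V : S.Opens) (r : Γ(S, V)) (m : Γ(pushO X, V)) :
    fstO X T V (r • m) = T.hom.app V r • fstO X T V m := by
  apply (secSnd X T (T.hom ⁻¹ᵁ V)).injective
  rw [secSnd_smul, secSnd_fstO, secSnd_fstO, secO_smul, map_mul, appLE_fst_app]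

/-- Pullback of functions on `X` to `X ⊗ T`, as a morphism of sheaves. -/
def baseChange₀ : pushO X ⟶ (Scheme.Modules.pushforward T.hom).obj (pushSnd X T) :=
  homOfSections (fun V =>
    { toFun := fstO X T V
      map_add' := map_add _
      map_smul' := fstO_smul X T V }) fun _ _ i m => fstO_map X T i m

/-- The base change morphism. -/
def baseChange : (Scheme.Modules.pullback T.hom).obj (pushO X) ⟶ pushSnd X T :=
  ((Scheme.Modules.pullbackPushforwardAdjunction T.hom).homEquiv _ _).symm (baseChange₀ X T)

theorem baseChange_pb (V : S.Opens) (m : Γ(pushO X, V)) :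
    secSnd X T (T.hom ⁻¹ᵁ V) ((baseChange X T).app (T.hom ⁻¹ᵁ V) (pb T.hom (pushO X) V m)) =
      (fst X T).left.appLE (X.hom ⁻¹ᵁ V) ((snd X T).left ⁻¹ᵁ T.hom ⁻¹ᵁ V)
        (snd_preimage_le X T V) (secO X V m) := by
  have h := ((Scheme.Modules.pullbackPushforwardAdjunction T.hom).homEquiv_unit _ _ _).symm.trans
    (((Scheme.Modules.pullbackPushforwardAdjunction T.hom).homEquiv _ _).apply_symm_apply
      (baseChange₀ X T))
  exact congr(($h).app V m)

theorem baseChange_pbLE (V : S.Opens) (W : T.left.Opens) (h : W ≤ T.hom ⁻¹ᵁ V)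
    (m : Γ(pushO X, V)) :
    secSnd X T W ((baseChange X T).app W (pbLE T.hom (pushO X) V W h m)) =
      (fst X T).left.appLE (X.hom ⁻¹ᵁ V) ((snd X T).left ⁻¹ᵁ W)
        (((snd X T).left.preimage_mono h).trans (snd_preimage_le X T V)) (secO X V m) := by
  rw [pbLE_apply, app_presheaf_map, secSnd_map, baseChange_pb]
  exact congr($(Scheme.Hom.appLE_map _ _ _) _)

/-- On affine `W` over affine `V`, source and target are both the base change of the functions on
`X` over `V`: the source as a pullback of a quasi-coherent sheaf, the target because functions on
the fibre product form a pushout of rings. -/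
instance isIso_baseChange [IsAffineHom X.hom] : IsIso (baseChange X T) := by
  have := isQuasicoherent_pushO X
  refine isIso_of_isBasis _ (isBasis_affineOpens_le_preimage T.hom) fun W ⟨hW, V, hV, hWV⟩ => ?_
  have h1 := isSBC_pbLE T.hom (pushO X) hV hW hWV
  have h2 := isIso_pushoutSection_of_isAffineOpen (isPullback_fst_snd_left X T)
    (US := V) (UX := X.hom ⁻¹ᵁ V) (UT := W) (UY := (snd X T).left ⁻¹ᵁ W)
    hWV le_rfl (by
      refine (inf_eq_right.mpr ?_).symm
      exact ((snd X T).left.preimage_mono hWV).trans (snd_preimage_le X T V))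
    hV hW (hV.preimage X.hom)
  rw [isIso_pushoutSection_iff, Scheme.Hom.appLE_eq_app, Scheme.Hom.appLE_eq_app] at h2
  have h3 := isSBC_of_isPushout h2.flip (secO X V) (secSnd X T W) (secO_smul X V)
    (secSnd_smul X T W) (u := (appLin (baseChange X T) W).toAddMonoidHom.comp
      (pbLE T.hom (pushO X) V W hWV).hom) fun m => baseChange_pbLE X T V W hWV m
  exact h1.bijective_of_comp h3 (f := appLin (baseChange X T) W) fun m => rfl

end PushO

/-! ### Pullbacks of pushed forward functions as functions on products -/

section BaseChangeSections

variable {S : Scheme.{u}} {U : S.affineOpens} (X T : Over S)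

/-- Sections of the pullback of a pushforward as sections of the fibre product. -/
def bc : MSec U T (pushO X) →+ Sec U (X ⊗ T) :=
  ((X ⊗ T).left.presheaf.map
    (homOfLE (preimage_preimage_eq (snd X T) U.1).ge).op).hom.toAddMonoidHom.comp
    ((secSnd X T (T.hom ⁻¹ᵁ U.1)).toAddMonoidHom.comp
      ((baseChange X T).app (T.hom ⁻¹ᵁ U.1)).hom)

theorem bc_apply (z : MSec U T (pushO X)) : bc X T z =
    (X ⊗ T).left.presheaf.map (homOfLE (preimage_preimage_eq (snd X T) U.1).ge).op
      (secSnd X T (T.hom ⁻¹ᵁ U.1) ((baseChange X T).app (T.hom ⁻¹ᵁ U.1) z)) := rfl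

theorem bc_smul (d : Sec U T) (z : MSec U T (pushO X)) :
    bc X T (d • z) = pull (snd X T) d * bc X T z := by
  have h (d : Γ(T.left, T.hom ⁻¹ᵁ U.1))
      (z : Γ((Scheme.Modules.pullback T.hom).obj (pushO X), T.hom ⁻¹ᵁ U.1)) :
      secSnd X T (T.hom ⁻¹ᵁ U.1) ((baseChange X T).app (T.hom ⁻¹ᵁ U.1) (d • z)) =
      (snd X T).left.app (T.hom ⁻¹ᵁ U.1) d *
        secSnd X T (T.hom ⁻¹ᵁ U.1) ((baseChange X T).app (T.hom ⁻¹ᵁ U.1) z) := by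
    rw [Scheme.Modules.Hom.app_smul, secSnd_smul]
  refine (congrArg ((X ⊗ T).left.presheaf.map _) (h d z)).trans ?_
  rw [map_mul]
  rfl

variable (U) in
/-- Sections of the pushforward of the structure sheaf over an affine open. -/
def secOU : Γ(pushO X, U.1) ≃+ Sec U X := secO X U.1

theorem bc_unit₀ (m : Γ(pushO X, U.1)) :
    bc X T (unit₀ U T (pushO X) m) = pull (fst X T) (secOU U X m) := by
  refine (congrArg ((X ⊗ T).left.presheaf.map _) (baseChange_pb X T U.1 m)).trans ?_
  have h : (fst X T).left.appLE (X.hom ⁻¹ᵁ U.1) ((snd X T).left ⁻¹ᵁ T.hom ⁻¹ᵁ U.1)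
        (snd_preimage_le X T U.1) ≫
      (X ⊗ T).left.presheaf.map (homOfLE (preimage_preimage_eq (snd X T) U.1).ge).op =
      (fst X T).left.appLE (X.hom ⁻¹ᵁ U.1) ((X ⊗ T).hom ⁻¹ᵁ U.1)
        (preimage_preimage_eq (fst X T) U.1).ge := by
    rw [Scheme.Hom.appLE_map]
  exact congr($h (secO X U.1 m))

theorem bijective_presheaf_map_of_eq {Y : Scheme.{u}} {V W : Y.Opens} (h : V = W) (i : V ⟶ W) :
    Function.Bijective (Y.presheaf.map i.op) := by
  subst h
  rw [Subsingleton.elim i (𝟙 _), op_id, Y.presheaf.map_id]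
  exact Function.bijective_id

/-- Identities between sections of pullbacks of `pushO X` may thus be verified as identities of
functions on `X × T`. -/
theorem bijective_bc [IsAffineHom X.hom] : Function.Bijective (bc (U := U) X T) := by
  have h1 := bijective_presheaf_map_of_eq (Y := (X ⊗ T).left)
    (preimage_preimage_eq (snd X T) U.1).symm (homOfLE (preimage_preimage_eq (snd X T) U.1).ge)
  have h2 := bijective_app_of_iso (asIso (baseChange X T)) (T.hom ⁻¹ᵁ U.1)
  exact h1.comp ((secSnd X T (T.hom ⁻¹ᵁ U.1)).bijective.comp h2)

variable {T}

theorem bc_mpull [IsAffineHom X.hom] {T' : Over S} [IsAffineHom T'.hom] (g : T ⟶ T')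
    (z : MSec U T' (pushO X)) : bc X T (mpull g z) = pull (X ◁ g) (bc X T' z) := by
  have := isQuasicoherent_pushO X
  induction z using msec_induction with
  | smul d m =>
    rw [mpull_smul, mpull_unit₀, bc_smul, bc_smul, bc_unit₀, bc_unit₀, map_mul, ← pull_comp,
      ← pull_comp, ← pull_comp, whiskerLeft_fst, whiskerLeft_snd]
  | add x y hx hy => simp only [map_add, hx, hy]

variable {X}

theorem snd_preimage_le_of_comp_snd {σ : X ⊗ T ⟶ X ⊗ T} (hσ : σ ≫ snd X T = snd X T)
    (W : T.left.Opens) : (snd X T).left ⁻¹ᵁ W ≤ σ.left ⁻¹ᵁ (snd X T).left ⁻¹ᵁ W := by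
  rw [← Scheme.Hom.comp_preimage, ← Over.comp_left, hσ]

variable (σ : X ⊗ T ⟶ X ⊗ T) (hσ : σ ≫ snd X T = snd X T)

/-- Pullback of functions along an endomorphism of `X ⊗ T` over `T`, on sections. -/
def secSndMap (W : T.left.Opens) : Γ(pushSnd X T, W) →+ Γ(pushSnd X T, W) :=
  (secSnd X T W).symm.toAddMonoidHom.comp
    ((σ.left.appLE ((snd X T).left ⁻¹ᵁ W) ((snd X T).left ⁻¹ᵁ W)
      (snd_preimage_le_of_comp_snd hσ W)).hom.toAddMonoidHom.comp (secSnd X T W).toAddMonoidHom)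

theorem secSnd_secSndMap (W : T.left.Opens) (m : Γ(pushSnd X T, W)) :
    secSnd X T W (secSndMap σ hσ W m) = σ.left.appLE ((snd X T).left ⁻¹ᵁ W)
      ((snd X T).left ⁻¹ᵁ W) (snd_preimage_le_of_comp_snd hσ W) (secSnd X T W m) := rfl

theorem secSndMap_smul (W : T.left.Opens) (r : Γ(T.left, W)) (m : Γ(pushSnd X T, W)) :
    secSndMap σ hσ W (r • m) = r • secSndMap σ hσ W m := by
  have h : (snd X T).left.app W ≫ σ.left.appLE ((snd X T).left ⁻¹ᵁ W)
      ((snd X T).left ⁻¹ᵁ W) (snd_preimage_le_of_comp_snd hσ W) = (snd X T).left.app W := by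
    rw [← Scheme.Hom.appLE_eq_app, Scheme.Hom.appLE_comp_appLE]
    exact appLE_eq_of_eq congr($(hσ).left) W _ _ _
  apply (secSnd X T W).injective
  rw [secSnd_smul, secSnd_secSndMap, secSnd_secSndMap, secSnd_smul, map_mul]
  exact congrArg (· * _) congr($h r)

theorem secSndMap_map {V W : T.left.Opens} (i : V ⟶ W) (m : Γ(pushSnd X T, W)) :
    secSndMap σ hσ V ((pushSnd X T).presheaf.map i.op m) =
      (pushSnd X T).presheaf.map i.op (secSndMap σ hσ W m) := by
  have h : (X ⊗ T).left.presheaf.map ((Opens.map (snd X T).left.base).map i).op ≫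
      σ.left.appLE ((snd X T).left ⁻¹ᵁ V) ((snd X T).left ⁻¹ᵁ V)
        (snd_preimage_le_of_comp_snd hσ V) =
      σ.left.appLE ((snd X T).left ⁻¹ᵁ W) ((snd X T).left ⁻¹ᵁ W)
        (snd_preimage_le_of_comp_snd hσ W) ≫
        (X ⊗ T).left.presheaf.map ((Opens.map (snd X T).left.base).map i).op := by
    rw [Scheme.Hom.map_appLE, Scheme.Hom.appLE_map]
  apply (secSnd X T V).injective
  rw [secSnd_map, secSnd_secSndMap, secSnd_secSndMap, secSnd_map]
  exact congr($h (secSnd X T W m))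

/-- Pullback of functions along an endomorphism of `X ⊗ T` over `T`. -/
def pushSndMap : pushSnd X T ⟶ pushSnd X T :=
  homOfSections (fun W =>
    { toFun := secSndMap σ hσ W
      map_add' := map_add _
      map_smul' := secSndMap_smul σ hσ W }) fun _ _ i m => secSndMap_map σ hσ i m

variable {σ}

theorem id_appLE_self {Y : Scheme.{u}} (W : Y.Opens) :
    Scheme.Hom.appLE (𝟙 Y) W W le_rfl = 𝟙 _ := by
  simp [Scheme.Hom.appLE]
  exact Y.presheaf.map_id _

theorem pushSndMap_comp {τ : X ⊗ T ⟶ X ⊗ T} (hτ : τ ≫ snd X T = snd X T) (h : σ ≫ τ = 𝟙 _) :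
    pushSndMap τ hτ ≫ pushSndMap σ hσ = 𝟙 _ := by
  ext W m
  have h1 : τ.left.appLE ((snd X T).left ⁻¹ᵁ W) ((snd X T).left ⁻¹ᵁ W)
        (snd_preimage_le_of_comp_snd hτ W) ≫ σ.left.appLE ((snd X T).left ⁻¹ᵁ W)
        ((snd X T).left ⁻¹ᵁ W) (snd_preimage_le_of_comp_snd hσ W) = 𝟙 _ := by
    exact (Scheme.Hom.appLE_comp_appLE _ _ _ _ _ _ _).trans
      ((appLE_eq_of_eq congr($(h).left) _ _ _ le_rfl).trans (id_appLE_self _))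
  apply (secSnd X T W).injective
  exact congr($h1 (secSnd X T W m))

variable {τ : X ⊗ T ⟶ X ⊗ T}

/-- The automorphism of the pullback of `pushO X` to `T` given by an automorphism of `X ⊗ T`
over `T`. -/
def pushAct [IsAffineHom X.hom]
    (hτ : τ ≫ snd X T = snd X T) (h : σ ≫ τ = 𝟙 _) (h' : τ ≫ σ = 𝟙 _) :
    (Scheme.Modules.pullback T.hom).obj (pushO X) ≅
      (Scheme.Modules.pullback T.hom).obj (pushO X) :=
  asIso (baseChange X T) ≪≫ ⟨pushSndMap σ hσ, pushSndMap τ hτ, pushSndMap_comp hτ hσ h',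
    pushSndMap_comp hσ hτ h⟩ ≪≫ (asIso (baseChange X T)).symm

theorem bc_mact_pushAct [IsAffineHom X.hom]
    (hτ : τ ≫ snd X T = snd X T) (h : σ ≫ τ = 𝟙 _) (h' : τ ≫ σ = 𝟙 _)
    (z : MSec U T (pushO X)) : bc X T (mact (pushAct hσ hτ h h') z) = pull σ (bc X T z) := by
  have h1 : σ.left.appLE ((snd X T).left ⁻¹ᵁ T.hom ⁻¹ᵁ U.1) ((snd X T).left ⁻¹ᵁ T.hom ⁻¹ᵁ U.1)
        (snd_preimage_le_of_comp_snd hσ _) ≫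
      (X ⊗ T).left.presheaf.map (homOfLE (preimage_preimage_eq (snd X T) U.1).ge).op =
      (X ⊗ T).left.presheaf.map (homOfLE (preimage_preimage_eq (snd X T) U.1).ge).op ≫
      σ.left.appLE ((X ⊗ T).hom ⁻¹ᵁ U.1) ((X ⊗ T).hom ⁻¹ᵁ U.1)
        (preimage_preimage_eq σ U.1).ge := by
    rw [Scheme.Hom.map_appLE, Scheme.Hom.appLE_map]
  have h2 : (pushAct hσ hτ h h').hom ≫ baseChange X T = baseChange X T ≫ pushSndMap σ hσ := by
    simp [pushAct]
  rw [bc_apply, bc_apply, mact_apply]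
  refine (congrArg (fun z => (X ⊗ T).left.presheaf.map _ (secSnd X T (T.hom ⁻¹ᵁ U.1) z))
    congr(($h2).app (T.hom ⁻¹ᵁ U.1) z)).trans ?_
  exact congr($h1 (secSnd X T (T.hom ⁻¹ᵁ U.1) ((baseChange X T).app (T.hom ⁻¹ᵁ U.1) z)))

theorem iso_ext_mact {F : S.Modules}
    {φ ψ : (Scheme.Modules.pullback T.hom).obj F ≅ (Scheme.Modules.pullback T.hom).obj F}
    (h : ∀ (U : S.affineOpens) (m : Γ(F, U.1)), mact φ (unit₀ U T F m) = mact ψ (unit₀ U T F m)) :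
    φ = ψ := by
  ext1
  exact pullback_hom_ext T.hom S.isBasis_affineOpens fun V hV m => h ⟨V, hV⟩ m

end BaseChangeSections

/-! ### The regular representation with parameters in `Y` -/

section Regular

variable {S : Scheme.{u}} {G T : Over S} [GrpObj G] (Y : Over S)

/-- Translation `((h, y), t) ↦ ((g t * h, y), t)`. -/
def translateProd (g : T ⟶ G) : (G ⊗ Y) ⊗ T ⟶ (G ⊗ Y) ⊗ T :=
  lift (lift ((snd (G ⊗ Y) T ≫ g) * (fst (G ⊗ Y) T ≫ fst G Y)) (fst (G ⊗ Y) T ≫ snd G Y))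
    (snd (G ⊗ Y) T)

theorem translateProd_fst (g : T ⟶ G) : translateProd Y g ≫ fst (G ⊗ Y) T =
    lift ((snd (G ⊗ Y) T ≫ g) * (fst (G ⊗ Y) T ≫ fst G Y)) (fst (G ⊗ Y) T ≫ snd G Y) := lift_fst _ _

theorem translateProd_snd (g : T ⟶ G) :
    translateProd Y g ≫ snd (G ⊗ Y) T = snd (G ⊗ Y) T := lift_snd _ _

theorem translateProd_comp (g g' : T ⟶ G) :
    translateProd Y g ≫ translateProd Y g' = translateProd Y (g' * g) := by
  have h (k : T ⟶ G) : translateProd Y g ≫ snd (G ⊗ Y) T ≫ k = snd (G ⊗ Y) T ≫ k := by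
    rw [← Category.assoc, translateProd_snd]
  have h' {Z : Over S} (k : G ⊗ Y ⟶ Z) : translateProd Y g ≫ fst (G ⊗ Y) T ≫ k =
      lift ((snd (G ⊗ Y) T ≫ g) * (fst (G ⊗ Y) T ≫ fst G Y)) (fst (G ⊗ Y) T ≫ snd G Y) ≫ k := by
    rw [← Category.assoc, translateProd_fst]
  apply CartesianMonoidalCategory.hom_ext
  · rw [Category.assoc, translateProd_fst, translateProd_fst, comp_lift, comp_mul, h, h', h',
      lift_fst, lift_snd, comp_mul, _root_.mul_assoc]
  · rw [Category.assoc, translateProd_snd, translateProd_snd, translateProd_snd]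

theorem translateProd_one : translateProd Y (1 : T ⟶ G) = 𝟙 _ := by
  apply CartesianMonoidalCategory.hom_ext
  · rw [translateProd_fst, comp_one, _root_.one_mul, ← comp_lift, lift_fst_snd, Category.id_comp,
      Category.comp_id]
  · rw [translateProd_snd, Category.id_comp]

theorem translateProd_whiskerLeft_fst {T' : Over S} (t : T ⟶ T') (g : T' ⟶ G) :
    (G ⊗ Y) ◁ t ≫ translateProd Y g ≫ fst (G ⊗ Y) T' = translateProd Y (t ≫ g) ≫ fst (G ⊗ Y) T := by
  rw [translateProd_fst, translateProd_fst, comp_lift, comp_mul, whiskerLeft_snd_assoc,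
    whiskerLeft_fst_assoc, whiskerLeft_fst_assoc]

variable (G) [IsAffineHom G.hom] [IsAffineHom Y.hom]

/-- The action of `G` on the functions on `G ⊗ Y` by left translation. -/
def regularAct : (Scheme.Modules.pullback G.hom).obj (pushO (G ⊗ Y)) ≅
    (Scheme.Modules.pullback G.hom).obj (pushO (G ⊗ Y)) :=
  pushAct (σ := translateProd Y (𝟙 G)⁻¹) (τ := translateProd Y (𝟙 G)) (translateProd_snd _ _)
    (translateProd_snd _ _)
    (by rw [translateProd_comp, mul_inv_cancel, translateProd_one])
    (by rw [translateProd_comp, inv_mul_cancel, translateProd_one])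

variable {G}

theorem bc_mact_regularAct_id {U : S.affineOpens} (z : MSec U G (pushO (G ⊗ Y))) :
    bc (G ⊗ Y) G (mact (regularAct G Y) z) =
      pull (translateProd Y (𝟙 G)⁻¹) (bc (G ⊗ Y) G z) := bc_mact_pushAct _ _ _ _ z

/-- The action is defined at the universal point of `G`. Every section is a combination of sections
pulled back along `t`, so the formula follows for any point `t`. -/
theorem bc_mact_regularAct {U : S.affineOpens} [IsAffineHom T.hom] (t : T ⟶ G)
    (z : MSec U T (pushO (G ⊗ Y))) :
    bc (G ⊗ Y) T (mact (pullbackAct (regularAct G Y) t) z) =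
      pull (translateProd Y t⁻¹) (bc (G ⊗ Y) T z) := by
  have := isQuasicoherent_pushO (G ⊗ Y)
  have h : translateProd Y t⁻¹ ≫ fst (G ⊗ Y) T =
      (G ⊗ Y) ◁ t ≫ translateProd Y (𝟙 G)⁻¹ ≫ fst (G ⊗ Y) G := by
    rw [translateProd_whiskerLeft_fst, GrpObj.comp_inv, Category.comp_id]
  induction z using msec_induction with
  | smul d m =>
    rw [map_smul, bc_smul, bc_smul, map_mul, ← pull_comp _ (snd (G ⊗ Y) T), translateProd_snd,
      ← mpull_unit₀ t, mact_pullbackAct, bc_mpull, bc_mpull, bc_mact_regularAct_id, bc_unit₀,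
      ← pull_comp, ← pull_comp, ← pull_comp, ← pull_comp]
    refine congrArg (_ * pull · _) ?_
    rw [Category.assoc, Category.assoc, whiskerLeft_fst, h]
  | add x y hx hy => simp only [map_add, hx, hy]

theorem fst_mul_snd (G : Over S) [GrpObj G] : fst G G * snd G G = μ[G] := by
  rw [Hom.mul_def, lift_fst_snd, Category.id_comp]

variable (G) in
/-- The regular representation of `G` on the functions on `G ⊗ Y`. -/
def regular : QCohEquiv G where
  sheaf := pushO (G ⊗ Y)
  isQuasicoherent := isQuasicoherent_pushO (G ⊗ Y)
  act := regularAct G Y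
  act_mul := by
    -- The action is `c(h, y) ↦ c(g⁻¹ h, y)`: the inverse offsets the contravariance of pulling back
    -- functions and puts the two factors in the order of the cocycle condition.
    refine iso_ext_mact fun U m => (bijective_bc (G ⊗ Y) _).1 ?_
    rw [mact_iso_trans, bc_mact_regularAct, bc_mact_regularAct, bc_mact_regularAct, ← pull_comp,
      translateProd_comp, ← mul_inv_rev, fst_mul_snd]

end Regular

/-! ### Functions on schemes lying over one point -/

section Restriction

variable {S : Scheme.{u}} (X : Over S)

/-- Restriction of global functions. -/
def resO (V : S.Opens) : Γ(X.left, ⊤) →+* Γ(X.left, X.hom ⁻¹ᵁ V) :=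
  (X.left.presheaf.map (homOfLE le_top : X.hom ⁻¹ᵁ V ⟶ ⊤).op).hom

theorem map_resO {V W : S.Opens} (i : V ⟶ W) (m : Γ(X.left, ⊤)) :
    X.left.presheaf.map ((Opens.map X.hom.base).map i).op (resO X W m) = resO X V m := by
  have h : X.left.presheaf.map (homOfLE le_top : X.hom ⁻¹ᵁ W ⟶ ⊤).op ≫
      X.left.presheaf.map ((Opens.map X.hom.base).map i).op =
      X.left.presheaf.map (homOfLE le_top : X.hom ⁻¹ᵁ V ⟶ ⊤).op := by
    rw [← Functor.map_comp]; rfl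
  exact congr($h m)

/-- Restriction of global functions to the preimage of an affine open. -/
def resSec (U : S.affineOpens) : Γ(X.left, ⊤) →+* Sec U X := resO X U.1

variable {X}

theorem pull_resSec {U : S.affineOpens} {X' : Over S} (g : X ⟶ X') (m : Γ(X'.left, ⊤)) :
    pull g (resSec X' U m) = resSec X U (g.left.appTop m) := by
  have h : X'.left.presheaf.map (homOfLE le_top : X'.hom ⁻¹ᵁ U.1 ⟶ ⊤).op ≫
      g.left.appLE (X'.hom ⁻¹ᵁ U.1) (X.hom ⁻¹ᵁ U.1) (preimage_preimage_eq g U.1).ge =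
      g.left.appTop ≫ X.left.presheaf.map (homOfLE le_top : X.hom ⁻¹ᵁ U.1 ⟶ ⊤).op := by
    rw [Scheme.Hom.map_appLE]
    rfl
  exact congr($h m)

/-- The image of `Y` is at most the point `x`: the preimage of an open set is everything or empty,
depending on whether it contains `x`. -/
def IsOver (Y : Over S) (x : S) : Prop :=
  ∀ V : S.Opens, (x ∈ V → Y.hom ⁻¹ᵁ V = ⊤) ∧ (x ∉ V → Y.hom ⁻¹ᵁ V = ⊥)

variable {Y : Over S} {x : S}

theorem IsOver.of_hom (hY : IsOver Y x) (f : X ⟶ Y) : IsOver X x := fun V =>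
  ⟨fun h => by rw [← preimage_preimage_eq f, (hY V).1 h]; rfl,
    fun h => by rw [← preimage_preimage_eq f, (hY V).2 h]; rfl⟩

theorem IsOver.bijective_resO (hX : IsOver X x) {V : S.Opens} (hV : x ∈ V) :
    Function.Bijective (resO X V) :=
  bijective_presheaf_map_of_eq ((hX V).1 hV) _

theorem IsOver.subsingleton (hX : IsOver X x) {V : S.Opens} (hV : x ∉ V) :
    Subsingleton Γ(X.left, X.hom ⁻¹ᵁ V) := by
  rw [(hX V).2 hV]
  infer_instance

end Restriction

/-! ### Morphisms between pushforwards from schemes over one point -/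

section SkyscraperHom

variable {S : Scheme.{u}} {A Y : Over S} {x : S} (hY : IsOver Y x) (q : A ⟶ Y)
  (Θ : Γ(A.left, ⊤) →+ Γ(Y.left, ⊤))

open Classical in
/-- The map on sections induced by a map on global functions of schemes over a point. -/
def skyMap (V : S.Opens) : Γ(pushO A, V) →+ Γ(pushO Y, V) :=
  if hV : x ∈ V then
    (secO Y V).symm.toAddMonoidHom.comp ((resO Y V).toAddMonoidHom.comp (Θ.comp
      ((AddEquiv.ofBijective (resO A V).toAddMonoidHom
        ((hY.of_hom q).bijective_resO hV)).symm.toAddMonoidHom.comp (secO A V).toAddMonoidHom)))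
  else 0

theorem skyMap_eq {V : S.Opens} (hV : x ∈ V) {m : Γ(pushO A, V)} {m₀ : Γ(A.left, ⊤)}
    (h : secO A V m = resO A V m₀) : secO Y V (skyMap hY q Θ V m) = resO Y V (Θ m₀) := by
  rw [skyMap, dif_pos hV]
  refine congrArg (fun b => resO Y V (Θ b)) ?_
  exact (AddEquiv.symm_apply_eq (AddEquiv.ofBijective (resO A V).toAddMonoidHom
    ((hY.of_hom q).bijective_resO hV))).mpr h

theorem skyMap_map {V W : S.Opens} (i : V ⟶ W) (m : Γ(pushO A, W)) :
    skyMap hY q Θ V ((pushO A).presheaf.map i.op m) =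
      (pushO Y).presheaf.map i.op (skyMap hY q Θ W m) := by
  apply (secO Y V).injective
  by_cases hV : x ∈ V
  · obtain ⟨m₀, h⟩ := ((hY.of_hom q).bijective_resO (i.le hV)).2 (secO A W m)
    rw [skyMap_eq hY q Θ hV (m₀ := m₀) (by rw [secO_map, ← h, map_resO]), secO_map,
      skyMap_eq hY q Θ (i.le hV) h.symm, map_resO]
  · exact (hY.subsingleton hV).elim _ _

theorem app_resO (V : S.Opens) (t : Γ(Y.left, ⊤)) :
    q.left.appLE (Y.hom ⁻¹ᵁ V) (A.hom ⁻¹ᵁ V) (preimage_preimage_eq q V).ge (resO Y V t) =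
      resO A V (q.left.appTop t) := by
  have h : Y.left.presheaf.map (homOfLE le_top : Y.hom ⁻¹ᵁ V ⟶ ⊤).op ≫
      q.left.appLE (Y.hom ⁻¹ᵁ V) (A.hom ⁻¹ᵁ V) (preimage_preimage_eq q V).ge =
      q.left.appTop ≫ A.left.presheaf.map (homOfLE le_top : A.hom ⁻¹ᵁ V ⟶ ⊤).op := by
    rw [Scheme.Hom.map_appLE]
    rfl
  exact congr($h t)

theorem skyMap_smul (hΘ : ∀ t m, Θ (q.left.appTop t * m) = t * Θ m) (V : S.Opens) (r : Γ(S, V))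
    (m : Γ(pushO A, V)) : skyMap hY q Θ V (r • m) = r • skyMap hY q Θ V m := by
  apply (secO Y V).injective
  by_cases hV : x ∈ V
  · obtain ⟨m₀, h⟩ := ((hY.of_hom q).bijective_resO hV).2 (secO A V m)
    obtain ⟨r₀, hr⟩ := (hY.bijective_resO hV).2 (Y.hom.app V r)
    have h1 : A.hom.app V r = resO A V (q.left.appTop r₀) := by
      rw [← app_resO, hr]
      have h2 := Scheme.Hom.appLE_comp_appLE q.left Y.hom V (Y.hom ⁻¹ᵁ V) (A.hom ⁻¹ᵁ V)
        le_rfl (preimage_preimage_eq q V).ge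
      have h3 := h2.trans (appLE_eq_of_eq (Over.w q) V _ _ le_rfl)
      rw [Scheme.Hom.appLE_eq_app, Scheme.Hom.appLE_eq_app] at h3
      exact congr($h3 r).symm
    rw [skyMap_eq hY q Θ hV (m₀ := q.left.appTop r₀ * m₀) (by
      rw [secO_smul, h1, map_mul, h]), secO_smul, skyMap_eq hY q Θ hV h.symm, hΘ, map_mul, hr]
  · exact (hY.subsingleton hV).elim _ _

/-- The morphism of sheaves induced by a map on global functions of schemes over a point. -/
def skyHom (hΘ : ∀ t m, Θ (q.left.appTop t * m) = t * Θ m) : pushO A ⟶ pushO Y :=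
  homOfSections (fun V =>
    { toFun := skyMap hY q Θ V
      map_add' := map_add _
      map_smul' := skyMap_smul hY q Θ hΘ V }) fun _ _ i m => skyMap_map hY q Θ i m

theorem skyHom_app (hΘ : ∀ t m, Θ (q.left.appTop t * m) = t * Θ m) (V : S.Opens)
    (m : Γ(pushO A, V)) : (skyHom hY q Θ hΘ).app V m = skyMap hY q Θ V m := rfl

theorem epi_skyHom (hΘ : ∀ t m, Θ (q.left.appTop t * m) = t * Θ m) (h : Function.Surjective Θ) :
    Epi (skyHom hY q Θ hΘ) := by
  refine (locallySurjective_of_isBasis _ S.isBasis_affineOpens fun V _ => ?_).epi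
  intro t
  by_cases hV : x ∈ V
  · obtain ⟨t₀, ht⟩ := (hY.bijective_resO hV).2 (secO Y V t)
    obtain ⟨m, rfl⟩ := h t₀
    refine ⟨(secO A V).symm (resO A V m), (secO Y V).injective ?_⟩
    rw [skyHom_app, skyMap_eq hY q Θ hV ((secO A V).apply_symm_apply _), ht]
  · exact ⟨0, (hY.subsingleton hV).elim _ _⟩

end SkyscraperHom

/-! ### Equivariant kernels and trivial actions -/

section KernelAction

variable {S : Scheme.{u}} {G : Over S}

theorem pullbackAct_map {F F' : S.Modules} (f : F ⟶ F')
    (φ : (Scheme.Modules.pullback G.hom).obj F ≅ (Scheme.Modules.pullback G.hom).obj F)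
    (φ' : (Scheme.Modules.pullback G.hom).obj F' ≅ (Scheme.Modules.pullback G.hom).obj F')
    (h : (Scheme.Modules.pullback G.hom).map f ≫ φ'.hom =
      φ.hom ≫ (Scheme.Modules.pullback G.hom).map f) {T : Over S} (g : T ⟶ G) :
    (Scheme.Modules.pullback T.hom).map f ≫ (pullbackAct φ' g).hom =
      (pullbackAct φ g).hom ≫ (Scheme.Modules.pullback T.hom).map f := by
  have he : (Scheme.Modules.pullback g.left).map ((Scheme.Modules.pullback G.hom).map f) ≫
      (pbTrIso g F').hom = (pbTrIso g F).hom ≫ (Scheme.Modules.pullback T.hom).map f := by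
    have h1 := (Scheme.Modules.pullbackComp g.left G.hom).hom.naturality f
    have h2 := (Scheme.Modules.pullbackCongr (Over.w g)).hom.naturality f
    refine (Category.assoc _ _ _).symm.trans ((congrArg (· ≫ _) h1).trans ?_)
    exact (Category.assoc _ _ _).trans ((congrArg (_ ≫ ·) h2).trans (Category.assoc _ _ _).symm)
  have he' : (Scheme.Modules.pullback T.hom).map f ≫ (pbTrIso g F').inv = (pbTrIso g F).inv ≫
      (Scheme.Modules.pullback g.left).map ((Scheme.Modules.pullback G.hom).map f) := by
    rw [Iso.comp_inv_eq, Category.assoc, he, Iso.inv_hom_id_assoc]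
  have e {F : S.Modules} (φ : (Scheme.Modules.pullback G.hom).obj F ≅
      (Scheme.Modules.pullback G.hom).obj F) : (pullbackAct φ g).hom =
      (pbTrIso g F).inv ≫ (Scheme.Modules.pullback g.left).map φ.hom ≫ (pbTrIso g F).hom := rfl
  rw [e, e, ← Category.assoc, he', Category.assoc, ← Category.assoc ((Scheme.Modules.pullback g.left).map _),
    ← Functor.map_comp, h, Functor.map_comp, Category.assoc, he, Category.assoc, Category.assoc]

theorem pullbackAct_refl (F : S.Modules) {T : Over S} (g : T ⟶ G) :
    pullbackAct (Iso.refl ((Scheme.Modules.pullback G.hom).obj F)) g = Iso.refl _ := by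
  ext1
  simp [pullbackAct]

variable [GrpObj G]

/-- The trivial action. -/
def trivialAct (F : S.Modules) (hF : F.IsQuasicoherent) : QCohEquiv G where
  sheaf := F
  isQuasicoherent := hF
  act := Iso.refl _
  act_mul := by
    rw [pullbackAct_refl, pullbackAct_refl, pullbackAct_refl]
    rfl

theorem exists_lift_pullback_kernel_ι [Flat G.hom] {F F' : QCohEquiv G} (f : F ⟶ F')
    (a : (Scheme.Modules.pullback G.hom).obj F.sheaf ⟶ (Scheme.Modules.pullback G.hom).obj F.sheaf)
    (b : (Scheme.Modules.pullback G.hom).obj F'.sheaf ⟶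
      (Scheme.Modules.pullback G.hom).obj F'.sheaf)
    (h : a ≫ (Scheme.Modules.pullback G.hom).map f.hom =
      (Scheme.Modules.pullback G.hom).map f.hom ≫ b) :
    ∃ l : (Scheme.Modules.pullback G.hom).obj (kernel f.hom) ⟶
      (Scheme.Modules.pullback G.hom).obj (kernel f.hom),
      l ≫ (Scheme.Modules.pullback G.hom).map (kernel.ι f.hom) =
        (Scheme.Modules.pullback G.hom).map (kernel.ι f.hom) ≫ a := by
  have := F.isQuasicoherent
  have := F'.isQuasicoherent
  refine exists_lift_pullback_kernel G.hom f.hom _ ?_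
  rw [Category.assoc, h, ← Category.assoc, ← Functor.map_comp, kernel.condition,
    CategoryTheory.Functor.map_zero, zero_comp]

/-- Flat pullback preserves the kernel, so the action and its inverse both restrict to it. The
restrictions are mutually inverse because the inclusion stays a monomorphism after pullback. -/
theorem exists_kernel_act [Flat G.hom] {F F' : QCohEquiv G} (f : F ⟶ F') :
    ∃ φ : (Scheme.Modules.pullback G.hom).obj (kernel f.hom) ≅
      (Scheme.Modules.pullback G.hom).obj (kernel f.hom),
      (Scheme.Modules.pullback G.hom).map (kernel.ι f.hom) ≫ F.act.hom =
        φ.hom ≫ (Scheme.Modules.pullback G.hom).map (kernel.ι f.hom) := by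
  have := F.isQuasicoherent
  have := F'.isQuasicoherent
  have := isQuasicoherent_kernel f.hom
  obtain ⟨l, hl⟩ := exists_lift_pullback_kernel_ι f F.act.hom F'.act.hom f.comm.symm
  obtain ⟨l', hl'⟩ := exists_lift_pullback_kernel_ι f F.act.inv F'.act.inv (by
    rw [Iso.inv_comp_eq, ← Category.assoc, ← f.comm, Category.assoc, Iso.hom_inv_id,
      Category.comp_id])
  have := mono_pullback_map G.hom (kernel.ι f.hom)
  refine ⟨⟨l, l', ?_, ?_⟩, hl.symm⟩
  · rw [← cancel_mono ((Scheme.Modules.pullback G.hom).map (kernel.ι f.hom)), Category.assoc, hl',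
      ← Category.assoc, hl, Category.assoc, Iso.hom_inv_id, Category.comp_id, Category.id_comp]
  · rw [← cancel_mono ((Scheme.Modules.pullback G.hom).map (kernel.ι f.hom)), Category.assoc, hl,
      ← Category.assoc, hl', Category.assoc, Iso.inv_hom_id, Category.comp_id, Category.id_comp]

instance flat_tensor_hom (X T : Over S) [hX : Flat X.hom] [hT : Flat T.hom] :
    Flat (X ⊗ T).hom := by
  rw [← Over.w (snd X T)]
  have : Flat (snd X T).left := MorphismProperty.of_isPullback (isPullback_fst_snd_left X T) hX
  infer_instance

/-- The kernel of an equivariant homomorphism. -/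
def kernelEquiv [Flat G.hom] {F F' : QCohEquiv G} (f : F ⟶ F') : QCohEquiv G where
  sheaf := kernel f.hom
  isQuasicoherent := by
    have := F.isQuasicoherent
    have := F'.isQuasicoherent
    exact isQuasicoherent_kernel f.hom
  act := (exists_kernel_act f).choose
  act_mul := by
    have := F.isQuasicoherent
    have := F'.isQuasicoherent
    have := isQuasicoherent_kernel f.hom
    have := mono_pullback_map (G ⊗ G).hom (kernel.ι f.hom)
    have h (g : G ⊗ G ⟶ G) := pullbackAct_map _ _ _ (exists_kernel_act f).choose_spec g
    ext1
    rw [← cancel_mono ((Scheme.Modules.pullback (G ⊗ G).hom).map (kernel.ι f.hom)), ← h, F.act_mul,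
      Iso.trans_hom, Iso.trans_hom, Category.assoc, ← h, ← Category.assoc, h, Category.assoc]

/-- The inclusion of the kernel of an equivariant homomorphism. -/
def kernelEquivι [Flat G.hom] {F F' : QCohEquiv G} (f : F ⟶ F') : kernelEquiv f ⟶ F :=
  QCohEquiv.Hom.mk (kernel.ι f.hom) (exists_kernel_act f).choose_spec

/-- An epimorphism is completed to a short exact sequence by its equivariant kernel. -/
theorem IsLinearlyReductive.epi_invariants_map [Flat G.hom] (hG : IsLinearlyReductive G)
    {F F' : QCohEquiv G} (f : F ⟶ F') [hf : Epi f.hom] :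
    Epi ((QCohEquiv.invariants G).map f) := by
  let C : ShortComplex (QCohEquiv G) := ShortComplex.mk (kernelEquivι f) f
    (QCohEquiv.Hom.ext (kernel.condition f.hom))
  have h : Mono (C.map (QCohEquiv.forget G)).f := inferInstanceAs (Mono (kernel.ι f.hom))
  have h' : Epi (C.map (QCohEquiv.forget G)).g := hf
  exact (hG C ⟨ShortComplex.exact_of_f_is_kernel _ (kernelIsKernel f.hom)⟩).epi_g

theorem isIso_invariantsι_trivialAct {F : S.Modules} (hF : F.IsQuasicoherent) :
    IsIso (invariantsι (trivialAct (G := G) F hF)) := by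
  have h : (trivialAct (G := G) F hF).coaction - (trivialAct (G := G) F hF).trivialCoaction = 0 := by
    rw [QCohEquiv.coaction, sub_eq_zero]
    exact (congrArg (_ ≫ ·) (CategoryTheory.Functor.map_id _ _)).trans (Category.comp_id _)
  exact kernel.ι_of_zero h

end KernelAction

/-! ### Units over a point and the residue field -/

section Point

variable {S : Scheme.{u}} {Y : Over S} {x : S}

/-- The basic open of `r` and `U` have the same preimage in `Y`, and `r` is invertible on the
former. -/
theorem IsOver.isUnit_app (hY : IsOver Y x) {U : S.Opens} {r : Γ(S, U)} (hx : x ∈ S.basicOpen r) :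
    IsUnit (Y.hom.app U r) := by
  let i : S.basicOpen r ⟶ U := homOfLE (S.basicOpen_le r)
  have h := bijective_presheaf_map_of_eq (Y := Y.left) (V := Y.hom ⁻¹ᵁ S.basicOpen r)
    (W := Y.hom ⁻¹ᵁ U) (by rw [(hY _).1 hx, (hY _).1 (i.le hx)]) ((Opens.map Y.hom.base).map i)
  have h1 : IsUnit (Y.left.presheaf.map ((Opens.map Y.hom.base).map i).op (Y.hom.app U r)) := by
    have h2 := (S.toRingedSpace.isUnit_res_basicOpen r).map (Y.hom.app (S.basicOpen r)).hom
    have h3 : Y.hom.app U ≫ Y.left.presheaf.map ((Opens.map Y.hom.base).map i).op =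
      S.presheaf.map i.op ≫ Y.hom.app (S.basicOpen r) := (Y.hom.naturality i.op).symm
    exact congr($h3 r) ▸ h2
  let e := RingEquiv.ofBijective
    (Y.left.presheaf.map ((Opens.map Y.hom.base).map i).op).hom h
  exact (MulEquiv.isUnit_map e).mp h1

theorem IsOver.mem_basicOpen (hY : IsOver Y x) (hY' : Nonempty Y.left) {U : S.Opens} (hx : x ∈ U)
    {r : Γ(S, U)} (hr : IsUnit (Y.hom.app U r)) : x ∈ S.basicOpen r := by
  by_contra h
  have h1 := (hY _).2 h
  rw [Scheme.preimage_basicOpen, Scheme.basicOpen_of_isUnit _ hr, (hY _).1 hx] at h1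
  obtain ⟨y⟩ := hY'
  exact (h1 ▸ Opens.mem_top y : y ∈ (⊥ : Y.left.Opens))

theorem IsOver.isAffineHom (hY : IsOver Y x) [IsAffine Y.left] : IsAffineHom Y.hom := by
  refine ⟨fun U _ => ?_⟩
  by_cases hx : x ∈ U
  · rw [(hY U).1 hx]
    exact isAffineOpen_top _
  · rw [(hY U).2 hx]
    exact isAffineOpen_bot _

variable (x) in
theorem isOver_fromSpecResidueField : IsOver (Over.mk (S.fromSpecResidueField x)) x := by
  have h (z) : S.fromSpecResidueField x z = x := by
    have h1 : S.fromSpecResidueField x z ∈ Set.range (S.fromSpecResidueField x) := ⟨z, rfl⟩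
    rwa [Scheme.range_fromSpecResidueField] at h1
  refine fun V => ⟨fun hV => ?_, fun hV => ?_⟩
  · ext z
    simpa [h] using hV
  · ext z
    simpa [h] using hV

end Point

/-! ### Integration over `G` with parameters in `Y × T` -/

section Reassoc

variable {S : Scheme.{u}} {G Y : Over S}

variable (G Y) in
/-- The reassociation `(g, (y, h)) ↦ ((g, y), h)`. -/
def reassoc (T : Over S) : G ⊗ (Y ⊗ T) ⟶ (G ⊗ Y) ⊗ T :=
  lift (G ◁ fst Y T) (snd G (Y ⊗ T) ≫ snd Y T)

theorem reassoc_fst (T : Over S) : reassoc G Y T ≫ fst (G ⊗ Y) T = G ◁ fst Y T := lift_fst _ _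

theorem reassoc_snd (T : Over S) :
    reassoc G Y T ≫ snd (G ⊗ Y) T = snd G (Y ⊗ T) ≫ snd Y T := lift_snd _ _

theorem reassoc_whiskerRight (T : Over S) :
    reassoc G Y T ≫ (snd G Y ▷ T) = snd G (Y ⊗ T) := by
  apply CartesianMonoidalCategory.hom_ext
  · rw [Category.assoc, whiskerRight_fst, ← Category.assoc, reassoc_fst, whiskerLeft_snd]
  · rw [Category.assoc, whiskerRight_snd, reassoc_snd]

theorem integ_snd_mul {U : S.affineOpens} {T : Over S} [IsAffineHom G.hom] [IsAffineHom T.hom]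
    (l : Sec U G →ₗ[Γ(S, U.1)] Γ(S, U.1)) (c : Sec U T) (F : Sec U (G ⊗ T)) :
    integ l T (pull (snd G T) c * F) = c * integ l T F := by
  rw [_root_.mul_comm, integ_mul_snd, _root_.mul_comm]

/-- Over `x`, restriction to the preimage of any open containing `x` is bijective. An operation
defined over `U` can therefore be read on global functions and then used over every other open. -/
theorem exists_functional {U : S.affineOpens} {x : S} (hY : IsOver Y x) (hx : x ∈ U.1) (A B : Over S) (a : A ⟶ Y) (I : Sec U B →ₗ[Γ(S, U.1)] Sec U A) :
    ∃ Θ : Γ(B.left, ⊤) →+ Γ(A.left, ⊤), ∀ b, resSec A U (Θ b) = I (resSec B U b) := by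
  let e := AddEquiv.ofBijective (resSec A U).toAddMonoidHom ((hY.of_hom a).bijective_resO hx)
  exact ⟨e.symm.toAddMonoidHom.comp (I.toAddMonoidHom.comp (resSec B U).toAddMonoidHom),
    fun b => e.apply_symm_apply _⟩

end Reassoc

/-! ### A left integral as an equivariant morphism from the regular representation -/

section InvariantFunctional

variable {S : Scheme.{u}} {U : S.affineOpens} {G Y : Over S} [GrpObj G] [IsAffineHom G.hom]
  [IsAffineHom Y.hom] {x : S} (hY : IsOver Y x) (hx : x ∈ U.1)
  (l : Sec U G →ₗ[Γ(S, U.1)] Γ(S, U.1))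

theorem reassoc_translateProd {T : Over S} [IsAffineHom T.hom] (g : T ⟶ G) :
    reassoc G Y T ≫ translateProd Y g = translate (snd Y T ≫ g) ≫ reassoc G Y T := by
  have h {Z : Over S} (k : G ⊗ Y ⟶ Z) :
      reassoc G Y T ≫ fst (G ⊗ Y) T ≫ k = G ◁ fst Y T ≫ k := by
    rw [← Category.assoc, reassoc_fst]
  apply CartesianMonoidalCategory.hom_ext
  · rw [Category.assoc, translateProd_fst, Category.assoc, reassoc_fst, comp_lift, comp_mul, h, h,
      whiskerLeft_fst, whiskerLeft_snd, ← Category.assoc, reassoc_snd]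
    apply CartesianMonoidalCategory.hom_ext
    · rw [lift_fst, Category.assoc, Category.assoc, whiskerLeft_fst, translate_fst]
    · rw [lift_snd, Category.assoc, whiskerLeft_snd, translate_snd_assoc]
  · rw [Category.assoc, translateProd_snd, Category.assoc, reassoc_snd, translate_snd_assoc]

variable {l} {Θ : Γ((G ⊗ Y).left, ⊤) →+ Γ(Y.left, ⊤)}
  (hl : ∀ b, resSec Y U (Θ b) = integ l Y (resSec (G ⊗ Y) U b))

include hY hx hl in
theorem functional_mul (t : Γ(Y.left, ⊤)) (m : Γ((G ⊗ Y).left, ⊤)) :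
    Θ ((snd G Y).left.appTop t * m) = t * Θ m := by
  apply (hY.bijective_resO hx).1
  change resSec Y U _ = resSec Y U _
  rw [hl, map_mul, map_mul (resSec _ _), ← pull_resSec, hl, integ_snd_mul]

-- The value `l y` becomes invertible on `Y`, so a multiple of `y` integrates to `1`; linearity over
-- the functions on `Y` does the rest.
include hY hx hl in
theorem surjective_functional {y : Sec U G} (h : l y ∉ vanishingIdeal hx) :
    Function.Surjective Θ := by
  rw [notMem_vanishingIdeal] at h
  obtain ⟨c, hc⟩ : ∃ c : Sec U Y, c * algebraMap _ _ (l y) = 1 :=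
    (hY.isUnit_app h).exists_left_inv
  obtain ⟨y₀, hy₀⟩ := ((hY.of_hom (snd G Y)).bijective_resO hx).2 (pull (fst G Y) y)
  obtain ⟨c₀, hc₀⟩ := (hY.bijective_resO hx).2 c
  have h1 : c₀ * Θ y₀ = 1 := by
    apply (hY.bijective_resO hx).1
    change resSec Y U _ = resSec Y U _
    change resSec (G ⊗ Y) U _ = _ at hy₀
    change resSec Y U _ = _ at hc₀
    rw [map_mul, hl, hy₀, hc₀, integ_fst, map_one, ← Algebra.algebraMap_eq_smul_one, hc]
  intro t
  exact ⟨(snd G Y).left.appTop (t * c₀) * y₀, by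
    rw [functional_mul hY hx hl, _root_.mul_assoc, h1, _root_.mul_one]⟩

/-- The morphism of sheaves given by an integral. -/
abbrev integHom : pushO (G ⊗ Y) ⟶ pushO Y :=
  skyHom hY (snd G Y) Θ (functional_mul hY hx hl)

variable {Θ' : Γ(((G ⊗ Y) ⊗ G).left, ⊤) →+ Γ((Y ⊗ G).left, ⊤)}
  (hl' : ∀ b, resSec (Y ⊗ G) U (Θ' b) =
    integ l (Y ⊗ G) (pull (reassoc G Y G) (resSec ((G ⊗ Y) ⊗ G) U b)))

-- The pullback of `integHom` to `G` is integration over the first factor of `G × (Y × G)`. The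
-- integral lives over `U`, but the formula is needed on every affine `V` containing `x`, so it
-- passes through the global map `Θ'`.
include hl' in
theorem bc_mmap_integHom {V : S.affineOpens} (hV : x ∈ V.1) (z : MSec V G (pushO (G ⊗ Y))) (b)
    (hb : bc (G ⊗ Y) G z = resSec ((G ⊗ Y) ⊗ G) V b) :
    bc Y G (mmap V G (integHom hY hx hl) z) = resSec (Y ⊗ G) V (Θ' b) := by
  have := isQuasicoherent_pushO (G ⊗ Y)
  have h1 := (hY.of_hom (fst _ G ≫ snd G Y)).bijective_resO hV
  induction z using msec_induction generalizing b with
  | smul d m =>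
    obtain ⟨d₀, hd⟩ := ((hY.of_hom (fst Y G)).bijective_resO hV).2 (pull (snd Y G) d)
    obtain ⟨m₀, hm⟩ := ((hY.of_hom (snd G Y)).bijective_resO hV).2 (secO (G ⊗ Y) V.1 m)
    change resSec (Y ⊗ G) V _ = _ at hd
    have hb' : b = ((snd G Y) ▷ G).left.appTop d₀ * (fst (G ⊗ Y) G).left.appTop m₀ := by
      apply h1.1
      refine hb.symm.trans ?_
      change _ = resSec _ V _
      rw [bc_smul, bc_unit₀, map_mul, ← pull_resSec, ← pull_resSec, hd, ← pull_comp,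
        whiskerRight_snd]
      exact congrArg (_ * pull (fst (G ⊗ Y) G) ·) hm.symm
    have h2 : Θ' b = d₀ * (fst Y G).left.appTop (Θ m₀) := by
      apply ((hY.of_hom (fst Y G)).bijective_resO hx).1
      change resSec _ U _ = resSec _ U _
      rw [hl', hb', map_mul, map_mul (pull _), map_mul (resSec _ _), ← pull_resSec, ← pull_resSec, ← pull_resSec,
        ← pull_comp, ← pull_comp, reassoc_fst, reassoc_whiskerRight, hl, pull_integ,
        integ_snd_mul]
    have h3 : secOU V Y ((integHom hY hx hl).app V.1 m) = resSec Y V (Θ m₀) :=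
      skyMap_eq hY (snd G Y) Θ hV hm.symm
    rw [map_smul, mmap_unit₀, bc_smul, bc_unit₀, h2, map_mul, ← pull_resSec, ← hd, h3]
  | add z₁ z₂ ih₁ ih₂ =>
    obtain ⟨b₁, hb₁⟩ := h1.2 (bc (G ⊗ Y) G z₁)
    obtain ⟨b₂, hb₂⟩ := h1.2 (bc (G ⊗ Y) G z₂)
    have hb' : b = b₁ + b₂ := by
      apply h1.1
      refine hb.symm.trans ?_
      rw [map_add, map_add, hb₁, hb₂]
      rfl
    rw [map_add, map_add, ih₁ b₁ hb₁.symm, ih₂ b₂ hb₂.symm, hb', map_add, map_add]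

/-- Over affine opens containing `x` this is left invariance of `l` with parameters in `Y × G`; over
the others the target has no nonzero sections. -/
theorem regularAct_integHom (hinv : IsLeftIntegral l) :
    (Scheme.Modules.pullback G.hom).map (integHom hY hx hl) =
      (regularAct G Y).hom ≫ (Scheme.Modules.pullback G.hom).map (integHom hY hx hl) := by
  refine pullback_hom_ext G.hom S.isBasis_affineOpens fun V hV m => ?_
  let V' : S.affineOpens := ⟨V, hV⟩
  suffices h : mmap V' G (integHom hY hx hl) (unit₀ V' G _ m) =
    mmap V' G (integHom hY hx hl) (mact (regularAct G Y) (unit₀ V' G _ m)) from h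
  apply (bijective_bc Y G).1
  by_cases hxV : x ∈ V
  · obtain ⟨Θ', hl'⟩ := exists_functional hY hx (Y ⊗ G) ((G ⊗ Y) ⊗ G) (fst Y G)
      (integ l (Y ⊗ G) ∘ₗ (pull (reassoc G Y G)).toLinearMap)
    obtain ⟨m₀, hm⟩ := ((hY.of_hom (snd G Y)).bijective_resO hxV).2 (secO (G ⊗ Y) V m)
    change resSec (G ⊗ Y) V' _ = secOU V' _ m at hm
    have h1 : bc (G ⊗ Y) G (unit₀ V' G _ m) =
        resSec ((G ⊗ Y) ⊗ G) V' ((fst (G ⊗ Y) G).left.appTop m₀) := by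
      rw [bc_unit₀, ← hm, pull_resSec]
    rw [bc_mmap_integHom hY hx hl hl' hxV _ _ h1,
      bc_mmap_integHom hY hx hl hl' hxV _
        ((translateProd Y (𝟙 G)⁻¹).left.appTop ((fst (G ⊗ Y) G).left.appTop m₀))
        (by rw [bc_mact_regularAct_id, h1, pull_resSec])]
    refine congrArg _ (((hY.of_hom (fst Y G)).bijective_resO hx).1 ?_)
    change resSec _ U _ = resSec _ U _
    rw [hl', hl', LinearMap.comp_apply, LinearMap.comp_apply, ← pull_resSec (translateProd _ _)]
    change integ l _ (pull _ _) = integ l _ (pull _ (pull _ _))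
    rw [← pull_comp (reassoc G Y G), reassoc_translateProd, pull_comp, hinv.integ_translate]
  · exact ((hY.of_hom (fst Y G)).subsingleton hxV).elim _ _

/-- The equivariant morphism given by a left integral. -/
def integEquiv (hinv : IsLeftIntegral l) :
    regular G Y ⟶ trivialAct (pushO Y) (isQuasicoherent_pushO Y) :=
  QCohEquiv.Hom.mk (integHom hY hx hl) ((Category.comp_id _).trans (regularAct_integHom hY hx hl hinv))

/-- An invariant function on `G ⊗ Y` comes from `Y`. -/
theorem eq_pull_of_invariant {V : S.affineOpens} {c : Γ(pushO (G ⊗ Y), V.1)}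
    (hc : mact (regularAct G Y) (unit₀ V G _ c) = unit₀ V G _ c) :
    ∃ b : Sec V Y, secOU V (G ⊗ Y) c = pull (snd G Y) b := by
  have h := congrArg (bc (G ⊗ Y) G) hc
  rw [bc_mact_regularAct_id, bc_unit₀] at h
  -- Translate the point `(g, y)` by `g` itself: invariance gives `c(g, y) = c(g⁻¹ g, y) = c(1, y)`.
  have h1 := congrArg (pull (lift (𝟙 _) (fst G Y))) h
  rw [← pull_comp, ← pull_comp, ← pull_comp, lift_fst, pull_id, Category.assoc,
    translateProd_fst, comp_lift, comp_mul, lift_snd_assoc, lift_fst_assoc, lift_fst_assoc,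
    Category.id_comp, Category.id_comp, GrpObj.comp_inv, Category.comp_id, inv_mul_cancel] at h1
  have h2 : lift (1 : G ⊗ Y ⟶ G) (snd G Y) = snd G Y ≫ CartesianMonoidalCategory.lift 1 (𝟙 Y) := by
    rw [comp_lift, comp_one, Category.comp_id]
  exact ⟨pull (CartesianMonoidalCategory.lift 1 (𝟙 Y)) (secOU V (G ⊗ Y) c), by rw [← pull_comp, ← h2, h1]⟩

end InvariantFunctional

/-! ### Linear reductivity forces nonvanishing mass -/

section Main

variable {S : Scheme.{u}} {U : S.affineOpens} {G : Over S} [GrpObj G] [IsAffineHom G.hom]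

/-- Were `l 1` zero at `x`, integration over the residue field would kill all invariant functions,
these being constant along `G`. It is nevertheless an equivariant epimorphism because `l y` is
nonzero there, and exactness forbids this. -/
theorem IsLinearlyReductive.apply_one_notMem [Flat G.hom] (hG : IsLinearlyReductive G) {x : S}
    (hx : x ∈ U.1) {l : Sec U G →ₗ[Γ(S, U.1)] Γ(S, U.1)} (hinv : IsLeftIntegral l) {y : Sec U G}
    (hy : l y ∉ vanishingIdeal hx) : l 1 ∉ vanishingIdeal hx := by
  let Y : Over S := Over.mk (S.fromSpecResidueField x)
  have hY : IsOver Y x := isOver_fromSpecResidueField x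
  have : IsAffine Y.left := inferInstanceAs (IsAffine (Spec _))
  have hne : Nonempty Y.left := inferInstanceAs (Nonempty (Spec (S.residueField x)))
  have := hY.isAffineHom
  obtain ⟨Θ, hl⟩ := exists_functional hY hx Y (G ⊗ Y) (𝟙 Y) (integ l Y)
  let f := integEquiv hY hx hl hinv
  have hf : Epi f.hom := epi_skyHom hY (snd G Y) Θ
    (functional_mul hY hx hl) (surjective_functional hY hx hl hy)
  have h1 := hG.epi_invariants_map f
  have h2 := isIso_invariantsι_trivialAct (G := G) (isQuasicoherent_pushO Y)
  have h3 : Epi (invariantsι (regular G Y) ≫ f.hom) := by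
    rw [← invariants_map_ι]
    exact epi_comp _ _
  -- Exactness, with every section of the trivial target invariant, lifts the function `1` to an
  -- invariant function near `x`.
  obtain ⟨W, i, s, hxW, hs⟩ := locallySurjective_of_epi (invariantsι (regular G Y) ≫ f.hom) U.1
    ((secO Y U.1).symm 1) x hx
  obtain ⟨V, hV, hxV, hVW⟩ := Opens.isBasis_iff_nbhd.mp S.isBasis_affineOpens hxW
  let j : V ⟶ W := homOfLE hVW
  let V' : S.affineOpens := ⟨V, hV⟩
  let k := ((QCohEquiv.invariants G).obj (regular G Y)).presheaf.map j.op s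
  let c : Γ(pushO (G ⊗ Y), V) := (invariantsι (regular G Y)).app V k
  have hc : mact (regularAct G Y) (unit₀ V' G _ c) = unit₀ V' G _ c :=
    mact_unit₀_of_coaction_sub_app (regular G Y) V' c
      congr(($(invariantsι_condition (regular G Y))).app V k)
  have hfc : f.hom.app V c = (pushO Y).presheaf.map (j ≫ i).op ((secO Y U.1).symm 1) := by
    refine (app_presheaf_map (invariantsι (regular G Y) ≫ f.hom) j s).trans ?_
    rw [hs, op_comp, Functor.map_comp_apply]
    rfl
  have hfc' : secO Y V (f.hom.app V c) = 1 := by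
    rw [hfc, secO_map, AddEquiv.apply_symm_apply, map_one]
  obtain ⟨b, hb⟩ := eq_pull_of_invariant hc
  obtain ⟨b₀, rfl⟩ := (hY.bijective_resO hxV).2 b
  have h4 : secO (G ⊗ Y) V c = resO (G ⊗ Y) V ((snd G Y).left.appTop b₀) :=
    hb.trans (pull_resSec (U := V') (snd G Y) b₀)
  have h5 : Θ ((snd G Y).left.appTop b₀) = 1 := by
    apply (hY.bijective_resO hxV).1
    rw [← skyMap_eq hY (snd G Y) Θ hxV h4, map_one]
    exact hfc'
  -- The lift is pulled back from a function `b₀` on `Y`, so its integral is `b₀` times the image of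
  -- `l 1`. As this equals `1`, the mass is a unit on `Y`.
  have h6 := hl ((snd G Y).left.appTop b₀)
  rw [h5, map_one, ← pull_resSec, ← _root_.mul_one (pull _ _), integ_snd_mul,
    ← map_one (pull (fst G Y)), integ_fst, ← Algebra.algebraMap_eq_smul_one] at h6
  rw [notMem_vanishingIdeal]
  exact hY.mem_basicOpen hne hx (IsUnit.of_mul_eq_one_right _ h6.symm)

theorem IsLinearlyReductive.hasLeftIntegral [IsFiniteFlat G] (hG : IsLinearlyReductive G) {x : S}
    (hx : x ∈ U.1) : HasLeftIntegral G (vanishingIdeal hx) := by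
  have : Flat G.hom := IsFiniteFlat.flat
  have := finite_sec U G
  have := projective_sec U G
  obtain ⟨l, y, hl, hy⟩ := exists_isLeftIntegral (U := U) (G := G) (vanishingIdeal hx)
    (Ideal.IsPrime.ne_top inferInstance)
  exact ⟨l, hl, hG.apply_one_notMem hx hl hy⟩

end Main

end LinRed

end

/-! ### The three closure properties -/

theorem mainTheorem11 (S : Scheme.{u}) [QuasiSeparatedSpace S] :
    -- subgroup schemes
    (∀ (H G : Over S) [GrpObj H] [GrpObj G] [LinRed.IsFiniteFlat H] [LinRed.IsFiniteFlat G]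
      (i : H ⟶ G) [IsMonHom i] [Mono i],
      LinRed.IsLinearlyReductive G → LinRed.IsLinearlyReductive H) ∧
    -- quotients
    (∀ (G Q : Over S) [GrpObj G] [GrpObj Q] [LinRed.IsFiniteFlat G] [LinRed.IsFiniteFlat Q]
      (p : G ⟶ Q), LinRed.IsQuotient p →
      LinRed.IsLinearlyReductive G → LinRed.IsLinearlyReductive Q) ∧
    -- extensions
    (∀ (N G Q : Over S) [GrpObj N] [GrpObj G] [GrpObj Q]
      [LinRed.IsFiniteFlat N] [LinRed.IsFiniteFlat G] [LinRed.IsFiniteFlat Q]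
      (i : N ⟶ G) (p : G ⟶ Q), LinRed.IsExtension i p →
      LinRed.IsLinearlyReductive N → LinRed.IsLinearlyReductive Q →
        LinRed.IsLinearlyReductive G) := by
  have flat (G : Over S) [LinRed.IsFiniteFlat G] : Flat G.hom := LinRed.IsFiniteFlat.flat
  have aff (G : Over S) [LinRed.IsFiniteFlat G] : IsAffineHom G.hom :=
    have : IsFinite G.hom := LinRed.IsFiniteFlat.isFinite
    inferInstance
  refine ⟨fun H G _ _ _ _ i _ _ hG => ?_, fun G Q _ _ _ _ p hp hG => ?_,
    fun N G Q _ _ _ _ _ _ i p h hN hQ => ?_⟩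
  · have := flat H
    have := aff H
    have := aff G
    exact LinRed.isLinearlyReductive_of_hasLeftIntegral fun U x hx =>
      LinRed.HasLeftIntegral.of_mono i (hG.hasLeftIntegral hx)
  · have := flat Q
    have := aff Q
    have := aff G
    exact LinRed.isLinearlyReductive_of_hasLeftIntegral fun U x hx =>
      LinRed.HasLeftIntegral.of_isQuotient hp (hG.hasLeftIntegral hx)
  · have := flat G
    have := aff G
    have := aff N
    have := aff Q
    exact LinRed.isLinearlyReductive_of_hasLeftIntegral fun U x hx =>
      h.hasLeftIntegral (hN.hasLeftIntegral hx) (hQ.hasLeftIntegral hx)
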